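/- **Setting.** Let $r,\varepsilon>0$ and put $\psi_r(t)=1$ for $|t|\le r$, $\psi_r(t)=\exp\bigl(1-\frac{1}{1-(|t|/r-1)^2}\bigr)$ for $r<|t|<2r$, $\psi_r(t)=0$ for $|t|\ge 2r$, and $m(r)=\int_{\mathbb R}\psi_r(|\xi|^2)\,d\xi$. Let $(z_k)_{k\in\mathbb N}$ be real numbers and let $$Z_k=\chi_kV_k+(1-\chi_k)U_k ,\qquad k\in\mathbb N,$$ almost surely, where all the random variables $\chi_k,V_k,U_k$, $k\in\mathbb N$, are independent, $\mathbb P(\chi_k=1)=\varepsilon m(r)=1-\mathbb P(\chi_k=0)$, and $V_k$ has density $\frac1{m(r)}\psi_r(|\xi-z_k|^2)$; that is, the law of $Z_k$ is bounded below by $\varepsilon\psi_r(|\xi-z_k|^2)\,d\xi$ and is split accordingly. Assume $\mathbb E(Z_k)=0$ and $\mathbb E(Z_k^2)=1$ for all $k$. Let $c=(c(\alpha))_{\alpha}$, $\alpha\in\bigcup_m\mathbb N^m$, be real coefficients that are symmetric and vanish as soon as two entries of $\alpha$ coincide. With $Z^\alpha=\prod_iZ_{\alpha_i}$ put, for $N\ge1$,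 $$\Phi_m(c,Z)=\sum_{\alpha\in\mathbb N^m}c(\alpha)Z^\alpha\ \text{(limit in $L^2$ of the sums over $\alpha$ with bounded entries)},\qquad S_N(c,Z)=\sum_{m=1}^N\Phi_m(c,Z),$$ $$i_N(c)=\sum_{m=1}^N m!\sum_{\alpha\in\mathbb N^m}c(\alpha)^2 ,\qquad \overline\kappa_N(c)=\sum_{l=1}^N\kappa_{4,l}(c)^{1/4},\qquad \overline\delta_N(c)=\sum_{l=1}^N\delta_l(c),$$ where $\kappa_{4,l}(c)=\mathbb E(X^4)-3\,\mathbb E(X^2)^2$ with $X=\Phi_l(c,G)$ for i.i.d. standard normal $G_1,G_2,\dots$, and $\delta_l(c)=\sup_k\bigl(\sum_{\alpha\in\mathbb N^{l-1}}c(k,\alpha)^2\bigr)^{1/2}$. Assume $0<i_N(c)<\infty$. For a polynomial $Q$ in finitely many of the $Z_k$ let $D_kQ(Z)=\chi_k\,(\partial_kQ)(Z)$; let $D$ also denote the closure of this operator, from $L^2(\Omega)$ to $L^2(\Omega;\ell^2)$, let $\mathbb D^{1,2}$ be the domain of the closure, and let $\sigma_F=\sum_k|D_kF|^2$ be the Malliavin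 covariance of $F\in\mathbb D^{1,2}$. **Lemma 4.6.** For every $p\ge1$ and every $M<\infty$ there is a constant $C_p>0$, depending only on $p$ and $M$, such that in the above setting, whenever $\sup_k\|Z_k\|_{\max(2p,4)}\le M$, one has $S_N(c,Z)\in\mathbb D^{1,2}$ and, for every $\eta\le\frac12\,\varepsilon m(r)\,i_N(c)$, $$\mathbb P\bigl(\sigma_{S_N(c,Z)}\le\eta\bigr)\le\Bigl(\frac{C_p\,(1+i_N(c))}{\varepsilon m(r)\,i_N(c)}\,(N!)^3\,2^N N^{-5/4}\,\bigl(\overline\kappa_N(c)+\overline\delta_N(c)\bigr)\Bigr)^p .$$ In particular $C_p$ depends neither on $N$, $c$, $\eta$ nor on $r$, $\varepsilon$, $(z_k)$. -/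

import Mathlib

open MeasureTheory ProbabilityTheory Filter Topology

namespace StochSeries

noncomputable section

/-- A family of coefficients `c(α)`, one for every multi-index `α` of every length `m`. -/
abbrev Coeff : Type := (m : ℕ) → (Fin m → ℕ) → ℝ

/-- The coefficients are symmetric and null on all the diagonals. -/
structure Coeff.Admissible (c : Coeff) : Prop where
  symm : ∀ (m : ℕ) (α : Fin m → ℕ) (π : Equiv.Perm (Fin m)), c m (α ∘ π) = c m α
  diag : ∀ (m : ℕ) (α : Fin m → ℕ) (i j : Fin m), i ≠ j → α i = α j → c m α = 0

/-- `|c|_m ^ 2`, the sum of `c(α)^2` over all multi-indices of length `m`. -/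
def normSq (c : Coeff) (m : ℕ) : ℝ := ∑' α : Fin m → ℕ, c m α ^ 2

/-- `i_N(c)`, the sum over `1 ≤ m ≤ N` of `m! |c|_m ^ 2`. -/
def iN (c : Coeff) (N : ℕ) : ℝ := ∑ m ∈ Finset.Icc 1 N, (m.factorial : ℝ) * normSq c m

/-- The influence factor `δ_m(c)`, which is the supremum over `k` of the `ℓ²` norm of
`c(k, ·)` on the multi-indices of length `m - 1` (used for `m ≥ 1` only). -/
def delta (c : Coeff) : ℕ → ℝ
  | 0 => 0
  | n + 1 => ⨆ k : ℕ, Real.sqrt (∑' α : Fin n → ℕ, c (n + 1) (Fin.cons k α) ^ 2)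

/-- The sum of the influence factors of order `1, …, N`. -/
def deltaBar (c : Coeff) (N : ℕ) : ℝ := ∑ l ∈ Finset.Icc 1 N, delta c l

section Series

variable {Ω : Type*} [MeasurableSpace Ω]

/-- The truncation of `Φ_m(c, Z)` to the multi-indices with all entries `< J`. -/
def partialPhi (c : Coeff) (Z : ℕ → Ω → ℝ) (m J : ℕ) (ω : Ω) : ℝ :=
  ∑ α : Fin m → Fin J, c m (fun i => (α i : ℕ)) * ∏ i, Z (α i) ω

open scoped Classical in
/-- A version of the limit in `L²(P)` of a sequence of random variables
(it is `0` if there is no limit). It is determined up to almost sure equality. -/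
def l2Lim (P : Measure Ω) (X : ℕ → Ω → ℝ) : Ω → ℝ :=
  if h : ∃ F : Ω → ℝ, MemLp F 2 P ∧
      Tendsto (fun J => eLpNorm (fun ω => X J ω - F ω) 2 P) atTop (𝓝 0)
  then h.choose else 0

/-- The homogeneous stochastic series `Φ_m(c, Z)`, the sum of `c(α) Z^α` over all multi-indices
of length `m`; the series is summed in `L²`. -/
def Phi (P : Measure Ω) (c : Coeff) (Z : ℕ → Ω → ℝ) (m : ℕ) : Ω → ℝ :=
  l2Lim P (partialPhi c Z m)

/-- `S_N(c, Z) = Φ_1(c, Z) + ⋯ + Φ_N(c, Z)`. -/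
def SN (P : Measure Ω) (c : Coeff) (Z : ℕ → Ω → ℝ) (N : ℕ) (ω : Ω) : ℝ :=
  ∑ m ∈ Finset.Icc 1 N, Phi P c Z m ω

/-- The fourth cumulant `E(X^4) - 3 E(X^2)^2` (of a centred random variable). -/
def cumulant4 (P : Measure Ω) (X : Ω → ℝ) : ℝ :=
  (∫ ω, X ω ^ 4 ∂P) - 3 * (∫ ω, X ω ^ 2 ∂P) ^ 2

end Series

/-- The law of a sequence of independent standard normal random variables;
the sequence itself is given by the coordinates. -/
def gaussSeq : Measure (ℕ → ℝ) := Measure.infinitePi (fun _ : ℕ => gaussianReal 0 1)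

/-- `κ_{4,m}(c)`, the fourth cumulant of `Φ_m(c, G)` with `G` i.i.d. standard normal. -/
def kappa4 (c : Coeff) (m : ℕ) : ℝ :=
  cumulant4 gaussSeq (Phi gaussSeq c (fun k ω => ω k) m)

/-- The sum over `1 ≤ l ≤ N` of `κ_{4,l}(c) ^ (1/4)`. -/
def kappaBar (c : Coeff) (N : ℕ) : ℝ := ∑ l ∈ Finset.Icc 1 N, kappa4 c l ^ (1 / 4 : ℝ)

/-- `θ_r(t) = 1 - 1 / (1 - (t / r - 1)^2)`. -/
def theta (r t : ℝ) : ℝ := 1 - 1 / (1 - (t / r - 1) ^ 2)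

/-- The smooth cut-off `ψ_r`, equal to `1` for `|t| ≤ r`, to `exp (θ_r |t|)` for `r < |t| < 2 r`
and to `0` for `|t| ≥ 2 r` (where `θ_r` tends to `-∞`). -/
def psi (r t : ℝ) : ℝ :=
  if |t| ≤ r then 1 else if |t| < 2 * r then Real.exp (theta r |t|) else 0

/-- `m(r)`, the integral of `ψ_r(|ξ|^2)` over the real line. -/
def mass (r : ℝ) : ℝ := ∫ ξ : ℝ, psi r (ξ ^ 2)

section Malliavin

variable {Ω : Type*} [MeasurableSpace Ω]

/-- The splitting `Z_k = χ_k V_k + (1 - χ_k) U_k` of a sequence of random variables: all the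
variables `χ_k, V_k, U_k` are independent, `χ_k` is Bernoulli with parameter `ε m(r)` and `V_k` has
the density `ψ_r(|ξ - z_k|^2) / m(r)`. As a consequence
`law(Z_k) = ε ψ_r(|ξ - z_k|^2) dξ + (1 - ε m(r)) law(U_k)`, so that the law of `U_k` is the
normalized difference of `law(Z_k)` and `ε ψ_r(|ξ - z_k|^2) dξ`, and `law(Z_k)` is bounded below
by `ε ψ_r(|ξ - z_k|^2) dξ`. -/
structure IsSplitting (P : Measure Ω) (r ε : ℝ) (z : ℕ → ℝ) (Z χ V U : ℕ → Ω → ℝ) : Prop where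
  measurable_chi : ∀ k, Measurable (χ k)
  measurable_V : ∀ k, Measurable (V k)
  measurable_U : ∀ k, Measurable (U k)
  indep : iIndepFun (fun i : ℕ × Fin 3 => ![χ i.1, V i.1, U i.1] i.2) P
  chi_one : ∀ k, P {ω | χ k ω = 1} = ENNReal.ofReal (ε * mass r)
  chi_zero : ∀ k, P {ω | χ k ω = 0} = ENNReal.ofReal (1 - ε * mass r)
  law_V : ∀ k, P.map (V k) =
    volume.withDensity (fun ξ => ENNReal.ofReal (psi r ((ξ - z k) ^ 2) / mass r))
  eq_split : ∀ k, ∀ᵐ ω ∂P, Z k ω = χ k ω * V k ω + (1 - χ k ω) * U k ω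

/-- The simple functional `Q(Z)` given by a polynomial `Q`. -/
def simpleFunctional (Z : ℕ → Ω → ℝ) (Q : MvPolynomial ℕ ℝ) (ω : Ω) : ℝ :=
  MvPolynomial.eval (fun k => Z k ω) Q

/-- The derivative `D_k Q(Z) = χ_k (∂_k Q)(Z)` of a simple functional. -/
def simpleDeriv (χ Z : ℕ → Ω → ℝ) (Q : MvPolynomial ℕ ℝ) (k : ℕ) (ω : Ω) : ℝ :=
  χ k ω * MvPolynomial.eval (fun j => Z j ω) (MvPolynomial.pderiv k Q)

/-- `F` belongs to the Sobolev space `𝔻^{1,2}` and `G = (G_k)` is its derivative `DF`: the pair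
`(F, G)` is in the closure, in `L²(Ω) × L²(Ω; ℓ²)`, of the graph of `D` on simple functionals. -/
def IsMalliavinDeriv (P : Measure Ω) (χ Z : ℕ → Ω → ℝ) (F : Ω → ℝ) (G : ℕ → Ω → ℝ) : Prop :=
  MemLp F 2 P ∧ (∀ k, AEStronglyMeasurable (G k) P) ∧
  ∃ Q : ℕ → MvPolynomial ℕ ℝ,
    Tendsto (fun n => eLpNorm (fun ω => simpleFunctional Z (Q n) ω - F ω) 2 P) atTop (𝓝 0) ∧
    Tendsto (fun n => ∫⁻ ω, ∑' k, ENNReal.ofReal ((simpleDeriv χ Z (Q n) k ω - G k ω) ^ 2) ∂P)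
      atTop (𝓝 0)

/-- The Malliavin covariance `σ_F = |DF|^2` in `ℓ²`, as a function of `G = DF`. -/
def malliavinCov (G : ℕ → Ω → ℝ) (ω : Ω) : ℝ := ∑' k, G k ω ^ 2

end Malliavin

end

end StochSeries

open MeasureTheory ProbabilityTheory Filter Topology

namespace StochSeries

noncomputable section

/-! ### Configurations and link forms -/

/-! Since `c` is symmetric and null on diagonals, the series truncated to the first `n` variables is
a multilinear polynomial `∑ f(A) Z_A` over finite sets `A` of sites, with `f(A) = |A|! c(A)`, and `∑
f(A)^2` increases to `i_N(c)` as `n` grows. Its Malliavin covariance is `∑_k χ_k (∑_{A ∋ k} f(A)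
Z_{A - k})^2`. Put `p₀ = ε m(r)`, write `χ_k = p₀ + ξ_k`, and write each `Z_j^2` as `1 + (Z_j^2 -
1)`. The covariance becomes a polynomial in products over the sites of the variables `1, Z_j, Z_j^2
- 1, ξ_j`, independent from site to site and, except for `1`, centred. Its constant term is `p₀ ∑
|A| f(A)^2`, which is at least `p₀ ∑ f(A)^2`. A covariance below `p₀ i_N(c) / 2` therefore forces
the centred remainder to be of order `p₀ i_N(c)`, which Markov's inequality in `L^q`, `q = max(p,
2)`, makes unlikely. Two estimates bound the remainder.

Moments. By the two-smoothness of `L^q` (`MomentBound.add_of_orthogonal`), adding one independent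
site at a time shows that the squared `L^q` norm of such a polynomial is at most the sum of its
squared coefficients, with a factor `L` for each nontrivial site variable (`momentBound_sitePoly`).
No moments beyond the order `2 q` of `Z` are needed, and only bounded powers of `L` occur because
the degree is bounded.

Coefficients. A coefficient in which some `Z_j^2 - 1` or `ξ_j` appears comes from pairs of sets
sharing the site `j`, and is controlled by the influence factors (`sum_covCoeff_sq_le_of_two`,
`sum_chiCoeff_sq_le`). All the others are contractions of `f` with itself, weighted by the number of
contracted sites (`covCoeff_eq_sum_split`). A contraction of two homogeneous parts is bounded
through the proper contractions of one of them with itself (`sum_contr_sq_le`), and the sum of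
squares of those is at most the fourth cumulant of the same form in Gaussian variables
(`contrSq_le_cumulant`).

The truncated derivatives converge in `L²(Ω; ℓ²)`, so the series has a derivative and its covariance
is the almost sure limit of truncated covariances along a subsequence (`IsSeq.exists_deriv`). Any
other derivative of the series coincides with it because the operator is closable: given all the
other splitting variables, a simple functional is a polynomial in `V_k`, whose density is bounded
below on compact subsets of an open interval, and one can integrate by parts there
(`IsSplitting.ae_eq_zero_of_tendsto`). Finally the exponential dependence on `N` is absorbed by a
factorial. -/

theorem sum_fin_snoc {β : Type*} [Fintype β] {n : ℕ} (F : (Fin (n + 1) → β) → ℝ) :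
    ∑ τ, F τ = ∑ b, ∑ τ' : Fin n → β, F (Fin.snoc (α := fun _ => β) τ' b) := by
  rw [← Fintype.sum_prod_type' (f := fun b τ' => F (Fin.snoc (α := fun _ => β) τ' b))]
  exact (Fintype.sum_equiv (Fin.snocEquiv (fun _ : Fin (n + 1) => β)) _ _ (fun _ => rfl)).symm

/-- The coefficient of the site variable of type `t` in the product of the site variables
with exponents `x` and `y`; types `0, 1, 2` stand for `1`, `Z`, `Z ^ 2 - 1`. -/
def linkW (x y : Bool) (t : Fin 4) : ℝ :=
  if x = y then (if t = 0 ∨ (x = true ∧ t = 2) then 1 else 0) else (if t = 1 then 1 else 0)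

/-- The part of `linkW` without contraction. -/
def topW (x y : Bool) (t : Fin 4) : ℝ := if (t : ℕ) = x.toNat + y.toNat then 1 else 0

/-- The indicator of `a = p + r`. -/
def joinW (a p r : Bool) : ℝ := if a.toNat = p.toNat + r.toNat then 1 else 0

/-- The indicator that `t` is the sum of `p` and `s`, not both of them being present. -/
def splitW (p s : Bool) (t : Fin 4) : ℝ :=
  if (t : ℕ) = p.toNat + s.toNat ∧ (p && s) = false then 1 else 0

/-- The weight with value `1` at the type `0` and `L` at all the others. -/
def typeWt (L : ℝ) (t : Fin 4) : ℝ := if t = 0 then 1 else L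

/-- The number of sites in a configuration. -/
def size {n : ℕ} (A : Fin n → Bool) : ℕ := ∑ j, (A j).toNat

/-- The coefficient, at the types `τ`, of the product of two multilinear polynomials. -/
def linkForm {n : ℕ} (g h : (Fin n → Bool) → ℝ) (τ : Fin n → Fin 4) : ℝ :=
  ∑ A, ∑ B, g A * h B * ∏ j, linkW (A j) (B j) (τ j)

/-- The part of `linkForm` without contractions. -/
def topForm {n : ℕ} (g h : (Fin n → Bool) → ℝ) (τ : Fin n → Fin 4) : ℝ :=
  ∑ A, ∑ B, g A * h B * ∏ j, topW (A j) (B j) (τ j)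

/-- The coefficient at the disjoint union of `P` and `R`, null if they are not disjoint. -/
def joinF {n : ℕ} (f : (Fin n → Bool) → ℝ) (P R : Fin n → Bool) : ℝ :=
  ∑ A, f A * ∏ j, joinW (A j) (P j) (R j)

/-- The weighted sum of squares `∑ A, lam ^ |A| g(A) ^ 2`. -/
def wSq {n : ℕ} (lam : ℝ) (g : (Fin n → Bool) → ℝ) : ℝ :=
  ∑ A, (∏ j, if A j then lam else 1) * g A ^ 2

theorem wSq_nonneg {n : ℕ} {lam : ℝ} (h : 0 ≤ lam) (g : (Fin n → Bool) → ℝ) : 0 ≤ wSq lam g :=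
  Finset.sum_nonneg fun A _ => mul_nonneg
    (Finset.prod_nonneg fun j _ => by split_ifs <;> linarith) (sq_nonneg _)

theorem wSq_snoc {n : ℕ} (lam : ℝ) (g : (Fin (n + 1) → Bool) → ℝ) :
    wSq lam g = wSq lam (fun A => g (Fin.snoc (α := fun _ => Bool) A false))
      + lam * wSq lam (fun A => g (Fin.snoc (α := fun _ => Bool) A true)) := by
  simp only [wSq, sum_fin_snoc, Fintype.sum_bool, Fin.prod_univ_castSucc, Fin.snoc_castSucc,
    Fin.snoc_last, Finset.mul_sum]
  rw [add_comm]
  congr 1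
  · exact Finset.sum_congr rfl fun A _ => by simp
  · exact Finset.sum_congr rfl fun A _ => by simp; ring

theorem linkForm_snoc {n : ℕ} (g h : (Fin (n + 1) → Bool) → ℝ) (τ : Fin n → Fin 4) (t : Fin 4) :
    linkForm g h (Fin.snoc (α := fun _ => Fin 4) τ t) = ∑ x : Bool, ∑ y : Bool, linkW x y t *
      linkForm (fun A => g (Fin.snoc (α := fun _ => Bool) A x))
        (fun A => h (Fin.snoc (α := fun _ => Bool) A y)) τ := by
  simp only [linkForm, sum_fin_snoc, Fintype.sum_bool, Fin.prod_univ_castSucc, Fin.snoc_castSucc,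
    Fin.snoc_last, Finset.mul_sum, Finset.sum_add_distrib]
  congr 1 <;> congr 1 <;>
    exact Finset.sum_congr rfl fun A _ => Finset.sum_congr rfl fun B _ => by ring

/-- Cauchy–Schwarz bounds the cross term by `2 √(a b c d) ≤ a d + c b`, which are exactly the cross
terms of the product on the right. It handles type `0` at a site, which arises both when neither set
contains the site and when both do. -/
theorem sum_mul_sq_add_le {ι : Type*} (s : Finset ι) (w u v : ι → ℝ) (hw : ∀ i ∈ s, 0 ≤ w i)
    {a b c d : ℝ} (ha : 0 ≤ a) (hb : 0 ≤ b) (hc : 0 ≤ c) (hd : 0 ≤ d)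
    (hu : ∑ i ∈ s, w i * u i ^ 2 ≤ a * b) (hv : ∑ i ∈ s, w i * v i ^ 2 ≤ c * d) :
    ∑ i ∈ s, w i * (u i + v i) ^ 2 ≤ (a + c) * (b + d) := by
  have hcs : (∑ i ∈ s, w i * (u i * v i)) ^ 2
      ≤ (∑ i ∈ s, w i * u i ^ 2) * (∑ i ∈ s, w i * v i ^ 2) := by
    refine Finset.sum_sq_le_sum_mul_sum_of_sq_le_mul s (fun i hi => ?_) (fun i hi => ?_)
      (fun i hi => le_of_eq (by ring))
    · exact mul_nonneg (hw i hi) (sq_nonneg _)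
    · exact mul_nonneg (hw i hi) (sq_nonneg _)
  have h0 : 0 ≤ ∑ i ∈ s, w i * v i ^ 2 :=
    Finset.sum_nonneg fun i hi => mul_nonneg (hw i hi) (sq_nonneg _)
  have h1 : (∑ i ∈ s, w i * (u i * v i)) ^ 2 ≤ (a * b) * (c * d) :=
    hcs.trans (mul_le_mul hu hv h0 (mul_nonneg ha hb))
  have h2 : 2 * ∑ i ∈ s, w i * (u i * v i) ≤ a * d + c * b := by
    refine le_of_abs_le (abs_le_of_sq_le_sq ?_ (by positivity))
    nlinarith [sq_nonneg (a * d - c * b)]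
  have h3 : ∑ i ∈ s, w i * (u i + v i) ^ 2 = ∑ i ∈ s, w i * u i ^ 2
      + 2 * ∑ i ∈ s, w i * (u i * v i) + ∑ i ∈ s, w i * v i ^ 2 := by
    rw [Finset.mul_sum, ← Finset.sum_add_distrib, ← Finset.sum_add_distrib]
    exact Finset.sum_congr rfl fun i _ => by ring
  rw [h3]; nlinarith

theorem typeWt_nonneg {L : ℝ} (hL : 0 ≤ L) (t : Fin 4) : 0 ≤ typeWt L t := by
  unfold typeWt; split_ifs <;> linarith

/-- Induction on the last site. Type `1` squares a sum of two terms and costs `2 L`, on top of the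
`1` coming from type `0`; hence the weight `2 L + 1`. Its square has room for type `2`. The bound
does not depend on the number of sites, since only occupied sites carry a weight. -/
theorem sum_typeWt_mul_linkForm_sq_le {L : ℝ} (hL : 0 ≤ L) {n : ℕ} (g h : (Fin n → Bool) → ℝ) :
    ∑ τ, (∏ j, typeWt L (τ j)) * linkForm g h τ ^ 2 ≤ wSq (2 * L + 1) g * wSq (2 * L + 1) h := by
  induction n with
  | zero =>
    simp [linkForm, wSq, mul_pow]
  | succ n ih =>
    obtain ⟨g0, hg0⟩ : ∃ g0, g0 = fun A => g (Fin.snoc (α := fun _ => Bool) A false) := ⟨_, rfl⟩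
    obtain ⟨g1, hg1⟩ : ∃ g1, g1 = fun A => g (Fin.snoc (α := fun _ => Bool) A true) := ⟨_, rfl⟩
    obtain ⟨h0, hh0⟩ : ∃ h0, h0 = fun A => h (Fin.snoc (α := fun _ => Bool) A false) := ⟨_, rfl⟩
    obtain ⟨h1, hh1⟩ : ∃ h1, h1 = fun A => h (Fin.snoc (α := fun _ => Bool) A true) := ⟨_, rfl⟩
    have hlam : (0 : ℝ) ≤ 2 * L + 1 := by linarith
    have G0 := wSq_nonneg hlam g0
    have G1 := wSq_nonneg hlam g1
    have H0 := wSq_nonneg hlam h0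
    have H1 := wSq_nonneg hlam h1
    have hw : ∀ τ ∈ (Finset.univ : Finset (Fin n → Fin 4)), 0 ≤ ∏ j, typeWt L (τ j) :=
      fun τ _ => Finset.prod_nonneg fun j _ => typeWt_nonneg hL _
    have e0 : ∑ τ : Fin n → Fin 4, (∏ j, typeWt L (τ j)) * (linkForm g0 h0 τ + linkForm g1 h1 τ) ^ 2
        ≤ (wSq (2 * L + 1) g0 + wSq (2 * L + 1) g1) * (wSq (2 * L + 1) h0 + wSq (2 * L + 1) h1) :=
      sum_mul_sq_add_le Finset.univ _ _ _ hw G0 H0 G1 H1 (ih g0 h0) (ih g1 h1)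
    have e1 : ∑ τ : Fin n → Fin 4, (∏ j, typeWt L (τ j)) * (linkForm g0 h1 τ + linkForm g1 h0 τ) ^ 2
        ≤ 2 * (wSq (2 * L + 1) g0 * wSq (2 * L + 1) h1
          + wSq (2 * L + 1) g1 * wSq (2 * L + 1) h0) := by
      refine le_trans ?_ (mul_le_mul_of_nonneg_left (add_le_add (ih g0 h1) (ih g1 h0)) zero_le_two)
      rw [← Finset.sum_add_distrib, Finset.mul_sum]
      refine Finset.sum_le_sum fun τ hτ => ?_
      nlinarith [mul_nonneg (hw τ hτ) (sq_nonneg (linkForm g0 h1 τ - linkForm g1 h0 τ))]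
    have e2 := ih g1 h1
    -- Type `3` never occurs in a product of powers of `Z`, so only three types of the last site
    -- contribute.
    have key : ∑ τ, (∏ j, typeWt L (τ j)) * linkForm g h τ ^ 2
        = (∑ τ : Fin n → Fin 4, (∏ j, typeWt L (τ j)) * (linkForm g0 h0 τ + linkForm g1 h1 τ) ^ 2)
        + L * (∑ τ : Fin n → Fin 4,
          (∏ j, typeWt L (τ j)) * (linkForm g0 h1 τ + linkForm g1 h0 τ) ^ 2)
        + L * (∑ τ : Fin n → Fin 4, (∏ j, typeWt L (τ j)) * (linkForm g1 h1 τ) ^ 2) := by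
      rw [sum_fin_snoc, Fin.sum_univ_four]
      simp only [Fin.prod_univ_castSucc, Fin.snoc_castSucc, Fin.snoc_last, linkForm_snoc,
        Fintype.sum_bool, ← hg0, ← hg1, ← hh0, ← hh1]
      simp only [linkW, typeWt]
      simp only [Finset.mul_sum]
      have z : ∑ x : Fin n → Fin 4, ((∏ j, if x j = 0 then (1 : ℝ) else L) * L) * 0 ^ 2 = 0 := by
        simp
      simp (decide := true) only [if_true, if_false, one_mul, zero_mul, add_zero, zero_add, z]
      simp
      refine congrArg₂ _ (congrArg₂ _ ?_ ?_) ?_ <;> refine Finset.sum_congr rfl fun τ _ => ?_ <;>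
        ring
    rw [key, wSq_snoc _ g, wSq_snoc _ h, ← hg0, ← hg1, ← hh0, ← hh1]
    show _ ≤ (wSq (2 * L + 1) g0 + (2 * L + 1) * wSq (2 * L + 1) g1)
      * (wSq (2 * L + 1) h0 + (2 * L + 1) * wSq (2 * L + 1) h1)
    have m1 := mul_le_mul_of_nonneg_left e1 hL
    have m2 := mul_le_mul_of_nonneg_left e2 hL
    have p11 := mul_nonneg G1 H1
    nlinarith [mul_nonneg hL p11, mul_nonneg (mul_nonneg hL hL) p11]

/-! ### Contractions and the fourth moment of a Gaussian form -/

/-- The values of `E (X_t ^ 2)` for the types `t` of a standard normal site. -/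
def typeNu (t : Fin 4) : ℝ := if t = 2 then 2 else 1

/-- The part of degree `l` of `f`. -/
def homPart {n : ℕ} (f : (Fin n → Bool) → ℝ) (l : ℕ) (A : Fin n → Bool) : ℝ :=
  if size A = l then f A else 0

/-- The contraction `∑ R, f(P ⊔ R) g(S ⊔ R)`. -/
def contr {n : ℕ} (f g : (Fin n → Bool) → ℝ) (P S : Fin n → Bool) : ℝ :=
  ∑ R, joinF f P R * joinF g S R

/-- The sum of the squared norms of the proper contractions of a form of degree `l`. -/
def contrSq {n : ℕ} (f : (Fin n → Bool) → ℝ) (l : ℕ) : ℝ :=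
  ∑ P, ∑ T, if 0 < size P ∧ size P < l then contr f f P T ^ 2 else 0

theorem sum_prod_eq {β : Type*} [Fintype β] {n : ℕ} (F : Fin n → β → ℝ) :
    ∑ τ : Fin n → β, ∏ j, F j (τ j) = ∏ j, ∑ b, F j b := by
  classical
  exact (Fintype.prod_sum F).symm

theorem joinW_symm (a p r : Bool) : joinW a p r = joinW a r p := by
  simp [joinW, add_comm]

theorem joinF_symm {n : ℕ} (f : (Fin n → Bool) → ℝ) (P R : Fin n → Bool) :
    joinF f P R = joinF f R P := by
  unfold joinF
  exact Finset.sum_congr rfl fun A _ => by simp_rw [joinW_symm]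

theorem joinW_nonneg (a p r : Bool) : 0 ≤ joinW a p r := by
  unfold joinW; split_ifs <;> norm_num

theorem joinF_ne_zero {n : ℕ} {f : (Fin n → Bool) → ℝ} {P R : Fin n → Bool}
    (h : joinF f P R ≠ 0) : ∃ A, f A ≠ 0 ∧ size A = size P + size R := by
  obtain ⟨A, -, hA⟩ := Finset.exists_ne_zero_of_sum_ne_zero h
  refine ⟨A, left_ne_zero_of_mul hA, ?_⟩
  have h2 := Finset.prod_ne_zero_iff.1 (right_ne_zero_of_mul hA)
  unfold size
  rw [← Finset.sum_add_distrib]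
  refine Finset.sum_congr rfl fun j _ => ?_
  by_contra hne
  exact h2 j (Finset.mem_univ j) (by simp [joinW, hne])

theorem joinF_hom_size {n : ℕ} {f : (Fin n → Bool) → ℝ} {l : ℕ}
    (hf : ∀ A, f A ≠ 0 → size A = l) {P R : Fin n → Bool} (h : joinF f P R ≠ 0) :
    size P + size R = l := by
  obtain ⟨A, hA, h2⟩ := joinF_ne_zero h
  rw [← h2, hf A hA]

theorem joinF_zero_right {n : ℕ} (f : (Fin n → Bool) → ℝ) (P : Fin n → Bool) :
    joinF f P (fun _ => false) = f P := by
  unfold joinF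
  rw [Finset.sum_eq_single P]
  · simp [joinW]
  · intro A _ hA
    obtain ⟨j, hj⟩ := Function.ne_iff.1 hA
    rw [Finset.prod_eq_zero (Finset.mem_univ j), mul_zero]
    cases h1 : A j <;> cases h2 : P j <;> simp_all [joinW]
  · simp

theorem joinF_zero_left {n : ℕ} (f : (Fin n → Bool) → ℝ) (P : Fin n → Bool) :
    joinF f (fun _ => false) P = f P := by
  rw [joinF_symm, joinF_zero_right]

theorem size_eq_zero {n : ℕ} {P : Fin n → Bool} (h : size P = 0) : P = fun _ => false := by
  funext j
  have := (Finset.sum_eq_zero_iff.1 h) j (Finset.mem_univ j)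
  cases hj : P j <;> simp_all

theorem size_false {n : ℕ} : size (fun _ : Fin n => false) = 0 := by simp [size]

/-- Since the kernels are products over the sites, summing over `τ` first reduces identities between
such quadratic sums to identities at a single site. -/
theorem sum_mul_sum_kernel {β : Type*} [Fintype β] {n : ℕ} (w : β → ℝ)
    (K₁ K₂ : Bool → Bool → β → ℝ) (φ ψ : (Fin n → Bool) → (Fin n → Bool) → ℝ) :
    ∑ τ : Fin n → β, (∏ j, w (τ j)) * ((∑ A, ∑ B, φ A B * ∏ j, K₁ (A j) (B j) (τ j))
      * ∑ C, ∑ D, ψ C D * ∏ j, K₂ (C j) (D j) (τ j))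
    = ∑ A, ∑ B, ∑ C, ∑ D, φ A B * ψ C D
        * ∏ j, ∑ b, w b * K₁ (A j) (B j) b * K₂ (C j) (D j) b := by
  simp_rw [Finset.sum_mul, Finset.mul_sum]
  rw [Finset.sum_comm]
  refine Finset.sum_congr rfl fun A _ => ?_
  rw [Finset.sum_comm]
  refine Finset.sum_congr rfl fun B _ => ?_
  rw [Finset.sum_comm]
  refine Finset.sum_congr rfl fun C _ => ?_
  rw [Finset.sum_comm]
  refine Finset.sum_congr rfl fun D _ => ?_
  rw [← sum_prod_eq, Finset.mul_sum]
  refine Finset.sum_congr rfl fun τ _ => ?_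
  simp_rw [Finset.prod_mul_distrib]
  ring

theorem contr_eq {n : ℕ} (f g : (Fin n → Bool) → ℝ) (P T : Fin n → Bool) :
    contr f g P T = ∑ A, ∑ E, f A * g E
      * ∏ j, ∑ q : Bool, joinW (A j) (P j) q * joinW (E j) (T j) q := by
  unfold contr joinF
  simp_rw [Finset.sum_mul, Finset.mul_sum]
  rw [Finset.sum_comm]
  refine Finset.sum_congr rfl fun A _ => ?_
  rw [Finset.sum_comm]
  refine Finset.sum_congr rfl fun B _ => ?_
  rw [← sum_prod_eq, Finset.mul_sum]
  refine Finset.sum_congr rfl fun τ _ => ?_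
  simp_rw [Finset.prod_mul_distrib]
  ring

/-- Both sides are sums of `f(A) f(B) f(C) f(D)` times a product of local weights. On the left these
express `A + B = C + D` as multisets; on the right they express the same condition in the form `A -
D = C - B`. After exchanging the roles of two of the four sets, the weights agree site by site. The
value `2` of `typeNu` matches the two possibilities at a site of all four sets: it is kept in both
contractions or contracted in both. -/
theorem sum_typeNu_mul_topForm_sq {n : ℕ} (f : (Fin n → Bool) → ℝ) :
    ∑ τ, (∏ j, typeNu (τ j)) * topForm f f τ ^ 2 = ∑ P, ∑ T, contr f f P T ^ 2 := by
  have h1 := sum_mul_sum_kernel (n := n) typeNu topW topW (fun A B => f A * f B)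
    (fun C D => f C * f D)
  have h2 := sum_mul_sum_kernel (n := n) (β := Bool × Bool) (fun _ => 1)
    (fun a e b => ∑ q : Bool, joinW a b.1 q * joinW e b.2 q)
    (fun c d b => ∑ q : Bool, joinW c b.1 q * joinW d b.2 q)
    (fun A E => f A * f E) (fun C D => f C * f D)
  have h3 : ∑ P, ∑ T, contr f f P T ^ 2 = ∑ τ : Fin n → Bool × Bool,
      contr f f (fun j => (τ j).1) (fun j => (τ j).2) ^ 2 := by
    rw [← Fintype.sum_prod_type' (f := fun P T => contr f f P T ^ 2)]
    exact (Fintype.sum_equiv (Equiv.arrowProdEquivProdArrow (Fin n) (fun _ => Bool) (fun _ => Bool))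
      _ _ (fun _ => rfl)).symm
  have h4 : ∑ τ : Fin n → Bool × Bool, contr f f (fun j => (τ j).1) (fun j => (τ j).2) ^ 2
      = ∑ A, ∑ E, ∑ C, ∑ D, (f A * f E) * (f C * f D) * ∏ j, ∑ b : Bool × Bool,
        1 * (∑ q : Bool, joinW (A j) b.1 q * joinW (E j) b.2 q)
          * (∑ q : Bool, joinW (C j) b.1 q * joinW (D j) b.2 q) := by
    rw [← h2]
    refine Finset.sum_congr rfl fun τ _ => ?_
    rw [contr_eq, sq]; simp
  have h5 : ∑ τ, (∏ j, typeNu (τ j)) * topForm f f τ ^ 2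
      = ∑ A, ∑ B, ∑ C, ∑ D, (f A * f B) * (f C * f D)
        * ∏ j, ∑ b, typeNu b * topW (A j) (B j) b * topW (C j) (D j) b := by
    rw [← h1]
    refine Finset.sum_congr rfl fun τ _ => ?_
    rw [sq]; rfl
  rw [h5, h3, h4]
  refine Finset.sum_congr rfl fun A _ => ?_
  have loc : ∀ x y z u : Bool, ∑ b, typeNu b * topW x y b * topW z u b
      = ∑ b : Bool × Bool, 1 * (∑ q : Bool, joinW x b.1 q * joinW u b.2 q)
          * (∑ q : Bool, joinW z b.1 q * joinW y b.2 q) := by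
    intro x y z u
    rw [Fin.sum_univ_four]
    simp only [Fintype.sum_prod_type, Fintype.sum_bool]
    cases x <;> cases y <;> cases z <;> cases u <;>
      simp [typeNu, topW, joinW] <;> norm_num [Fin.ext_iff]
  have swap : ∀ F : (Fin n → Bool) → (Fin n → Bool) → (Fin n → Bool) → ℝ,
      ∑ B, ∑ C, ∑ D, F B C D = ∑ D, ∑ C, ∑ B, F B C D := by
    intro F
    rw [Finset.sum_comm]
    conv_rhs => rw [Finset.sum_comm]
    exact Finset.sum_congr rfl fun C _ => Finset.sum_comm
  rw [swap]
  refine Finset.sum_congr rfl fun E _ => Finset.sum_congr rfl fun C _ =>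
    Finset.sum_congr rfl fun D _ => ?_
  rw [Finset.prod_congr rfl fun j _ => loc (A j) (D j) (C j) (E j)]
  ring

/-- The degree of a type vector. -/
def deg {n : ℕ} (τ : Fin n → Fin 4) : ℕ := ∑ j, (τ j : ℕ)

theorem topForm_ne_zero {n : ℕ} {f : (Fin n → Bool) → ℝ} {l : ℕ}
    (hf : ∀ A, f A ≠ 0 → size A = l) {τ : Fin n → Fin 4} (h : topForm f f τ ≠ 0) :
    deg τ = 2 * l := by
  obtain ⟨A, -, hA⟩ := Finset.exists_ne_zero_of_sum_ne_zero h
  obtain ⟨B, -, hB⟩ := Finset.exists_ne_zero_of_sum_ne_zero hA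
  have h1 := hf A (left_ne_zero_of_mul (left_ne_zero_of_mul hB))
  have h2 := hf B (right_ne_zero_of_mul (left_ne_zero_of_mul hB))
  have h3 := Finset.prod_ne_zero_iff.1 (right_ne_zero_of_mul hB)
  have : deg τ = size A + size B := by
    unfold deg size
    rw [← Finset.sum_add_distrib]
    refine Finset.sum_congr rfl fun j _ => ?_
    by_contra hne
    exact h3 j (Finset.mem_univ j) (by simp [topW, hne])
  omega

theorem linkW_of_topW {x y : Bool} {t : Fin 4} (h : (t : ℕ) = x.toNat + y.toNat) :
    linkW x y t = 1 := by
  revert h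
  cases x <;> cases y <;> fin_cases t <;> simp [linkW]

theorem le_of_linkW {x y : Bool} {t : Fin 4} (h : linkW x y t ≠ 0) :
    (t : ℕ) ≤ x.toNat + y.toNat := by
  revert h
  cases x <;> cases y <;> fin_cases t <;> simp [linkW]

/-- Each contraction lowers the degree by two, so at the top degree `2 * l` only uncontracted
products survive. -/
theorem linkForm_eq_topForm {n : ℕ} {f : (Fin n → Bool) → ℝ} {l : ℕ}
    (hf : ∀ A, f A ≠ 0 → size A = l) {τ : Fin n → Fin 4} (h : deg τ = 2 * l) :
    linkForm f f τ = topForm f f τ := by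
  unfold linkForm topForm
  refine Finset.sum_congr rfl fun A _ => Finset.sum_congr rfl fun B _ => ?_
  by_cases hA : f A = 0
  · simp [hA]
  by_cases hB : f B = 0
  · simp [hB]
  congr 1
  by_cases hall : ∀ j, (τ j : ℕ) = (A j).toNat + (B j).toNat
  · exact Finset.prod_congr rfl fun j _ => by rw [linkW_of_topW (hall j)]; simp [topW, hall j]
  · push Not at hall
    obtain ⟨j, hj⟩ := hall
    have h1 : ∏ j, topW (A j) (B j) (τ j) = 0 :=
      Finset.prod_eq_zero (Finset.mem_univ j) (by simp [topW, hj])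
    rw [h1]
    by_contra hne
    have h2 := Finset.prod_ne_zero_iff.1 hne
    have h3 : deg τ < size A + size B := by
      unfold deg size
      rw [← Finset.sum_add_distrib]
      refine Finset.sum_lt_sum (fun i _ => le_of_linkW (h2 i (Finset.mem_univ i)))
        ⟨j, Finset.mem_univ j, lt_of_le_of_ne (le_of_linkW (h2 j (Finset.mem_univ j))) hj⟩
    rw [h, hf A hA, hf B hB] at h3
    omega

theorem linkForm_zero {n : ℕ} (f : (Fin n → Bool) → ℝ) :
    linkForm f f (fun _ => 0) = ∑ A, f A ^ 2 := by
  unfold linkForm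
  refine Finset.sum_congr rfl fun A _ => ?_
  rw [Finset.sum_eq_single A]
  · simp [linkW]; ring
  · intro B _ hB
    obtain ⟨j, hj⟩ := Function.ne_iff.1 hB
    rw [Finset.prod_eq_zero (Finset.mem_univ j), mul_zero]
    simp [linkW, hj.symm]
  · simp

theorem typeNu_pos (t : Fin 4) : 0 < typeNu t := by unfold typeNu; split_ifs <;> norm_num

/-- The right side is the fourth moment in the Gaussian case, and three times the squared second
moment is to be extracted. One copy is the coefficient at `τ = 0`. The two others sit in the top
degree, among the contractions: the total one, `P = T = ∅`, and the empty one, where `P` has `l`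
sites and the contraction is `f(P) f(T)`. The intermediate sizes of `P` give `contrSq`, and what is
left is nonnegative. -/
theorem contrSq_add_le {n : ℕ} {f : (Fin n → Bool) → ℝ} {l : ℕ} (hl : 1 ≤ l)
    (hf : ∀ A, f A ≠ 0 → size A = l) :
    contrSq f l + 3 * (∑ A, f A ^ 2) ^ 2 ≤ ∑ τ, (∏ j, typeNu (τ j)) * linkForm f f τ ^ 2 := by
  set s := ∑ A, f A ^ 2
  have hf0 : f (fun _ => false) = 0 := by
    by_contra h
    have := hf _ h
    rw [size_false] at this
    omega
  have h1 : contrSq f l + 2 * s ^ 2 ≤ ∑ P, ∑ T, contr f f P T ^ 2 := by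
    have e1 : ∑ P : Fin n → Bool, (if P = fun _ => false then s ^ 2 else 0) = s ^ 2 := by simp
    have e2 : ∑ P : Fin n → Bool, f P ^ 2 * s = s ^ 2 := by rw [← Finset.sum_mul, sq]
    have e3 : contrSq f l + 2 * s ^ 2 = ∑ P, ((∑ T, if 0 < size P ∧ size P < l
        then contr f f P T ^ 2 else 0) + (if P = fun _ => false then s ^ 2 else 0)
        + f P ^ 2 * s) := by
      rw [Finset.sum_add_distrib, Finset.sum_add_distrib, e1, e2, contrSq]; ring
    rw [e3]
    refine Finset.sum_le_sum fun P _ => ?_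
    by_cases hP0 : P = fun _ => false
    · subst hP0
      simp only [size_false, lt_irrefl, false_and, if_false, Finset.sum_const_zero, if_true, hf0]
      have : contr f f (fun _ => false) (fun _ => false) ^ 2 = s ^ 2 := by
        congr 1
        exact Finset.sum_congr rfl fun R _ => by rw [joinF_zero_left]; ring
      rw [← this]
      have := Finset.single_le_sum (f := fun T => contr f f (fun _ => false) T ^ 2)
        (fun T _ => sq_nonneg _) (Finset.mem_univ (fun _ : Fin n => false))
      simpa using this
    · have hpos : 0 < size P := Nat.pos_of_ne_zero fun h => hP0 (size_eq_zero h)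
      simp only [hP0, if_false, add_zero]
      by_cases hlt : size P < l
      · have : f P = 0 := by
          by_contra h
          have := hf P h
          omega
        simp [this, hpos, hlt]
      · simp only [hlt, and_false, if_false, Finset.sum_const_zero, zero_add]
        simp only [s]
        rw [Finset.mul_sum]
        refine Finset.sum_le_sum fun T _ => le_of_eq ?_
        have : contr f f P T = f P * f T := by
          unfold contr
          rw [Finset.sum_eq_single (fun _ => false)]
          · rw [joinF_zero_right, joinF_zero_right]
          · intro R _ hR
            have hRpos : 0 < size R := Nat.pos_of_ne_zero fun h => hR (size_eq_zero h)
            have : joinF f P R = 0 := by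
              by_contra h
              have := joinF_hom_size hf h
              omega
            rw [this, zero_mul]
          · simp
        rw [this]; ring
  rw [← sum_typeNu_mul_topForm_sq] at h1
  have h2 : s ^ 2 + ∑ τ, (∏ j, typeNu (τ j)) * topForm f f τ ^ 2
      ≤ ∑ τ, (∏ j, typeNu (τ j)) * linkForm f f τ ^ 2 := by
    have e1 : ∑ τ : Fin n → Fin 4, (if τ = fun _ => 0 then s ^ 2 else 0) = s ^ 2 := by simp
    rw [← e1, ← Finset.sum_add_distrib]
    refine Finset.sum_le_sum fun τ _ => ?_
    by_cases h0 : τ = fun _ => 0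
    · subst h0
      have : topForm f f (fun _ => 0) = 0 := by
        by_contra h
        have := topForm_ne_zero hf h
        simp [deg] at this
        omega
      rw [this, linkForm_zero]
      simp [typeNu, s]
    · simp only [h0, if_false, zero_add]
      have hnu : 0 ≤ ∏ j, typeNu (τ j) := Finset.prod_nonneg fun j _ => (typeNu_pos _).le
      by_cases ht : topForm f f τ = 0
      · rw [ht]
        have := mul_nonneg hnu (sq_nonneg (linkForm f f τ))
        simpa using this
      · rw [linkForm_eq_topForm hf (topForm_ne_zero hf ht)]
  linarith

/-! ### The coefficients of the Malliavin covariance -/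

/-- The restriction of `f` to the configurations containing the site `k`. -/
def restr {n : ℕ} (f : (Fin n → Bool) → ℝ) (k : Fin n) (A : Fin n → Bool) : ℝ :=
  if A k then f A else 0

/-- The coefficients of `(∑ A ∋ k, f(A) Z_{A - k}) ^ 2`. -/
def siteCoeff {n : ℕ} (f : (Fin n → Bool) → ℝ) (k : Fin n) (τ : Fin n → Fin 4) : ℝ :=
  if τ k = 0 then linkForm (restr f k) (restr f k) τ else 0

/-- The coefficients of `∑ k, (∑ A ∋ k, f(A) Z_{A - k}) ^ 2`. -/
def covCoeff {n : ℕ} (f : (Fin n → Bool) → ℝ) (τ : Fin n → Fin 4) : ℝ := ∑ k, siteCoeff f k τ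

theorem linkW_nonneg (x y : Bool) (t : Fin 4) : 0 ≤ linkW x y t := by
  unfold linkW; split_ifs <;> norm_num

theorem siteCoeff_eq_zero {n : ℕ} {f : (Fin n → Bool) → ℝ} {k j : Fin n} {τ : Fin n → Fin 4}
    (h : τ j = 3) : siteCoeff f k τ = 0 := by
  unfold siteCoeff
  split_ifs
  · refine Finset.sum_eq_zero fun A _ => Finset.sum_eq_zero fun B _ => ?_
    rw [Finset.prod_eq_zero (Finset.mem_univ j), mul_zero]
    rw [h]
    cases A j <;> cases B j <;> simp [linkW]
  · rfl

theorem sum_siteCoeff_sq_le {L : ℝ} (hL : 0 ≤ L) {n : ℕ} (f : (Fin n → Bool) → ℝ) (k : Fin n) :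
    ∑ τ, (∏ j, typeWt L (τ j)) * siteCoeff f k τ ^ 2 ≤ wSq (2 * L + 1) (restr f k) ^ 2 := by
  rw [sq (wSq _ _)]
  refine le_trans (Finset.sum_le_sum fun τ _ => ?_)
    (sum_typeWt_mul_linkForm_sq_le hL (restr f k) (restr f k))
  refine mul_le_mul_of_nonneg_left ?_ (Finset.prod_nonneg fun j _ => typeWt_nonneg hL _)
  unfold siteCoeff
  split_ifs
  · rfl
  · simpa using sq_nonneg _

theorem siteCoeff_eq_sum {n : ℕ} (f : (Fin n → Bool) → ℝ) (k : Fin n) (τ : Fin n → Fin 4) :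
    siteCoeff f k τ = ∑ A, ∑ B, f A * f B
      * ((if A k = true ∧ B k = true ∧ τ k = 0 then 1 else 0) * ∏ j, linkW (A j) (B j) (τ j)) := by
  unfold siteCoeff linkForm restr
  split_ifs with h
  · refine Finset.sum_congr rfl fun A _ => Finset.sum_congr rfl fun B _ => ?_
    by_cases hA : A k = true <;> by_cases hB : B k = true <;> simp [hA, hB, h]
  · simp [h]

/-- The number of contracted sites. -/
def nContr {n : ℕ} (A B : Fin n → Bool) (τ : Fin n → Fin 4) : ℝ :=
  ∑ k, if A k = true ∧ B k = true ∧ τ k = 0 then 1 else 0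

/-- Removing `Z_k` from both factors has the same effect on coefficients as contracting the site
`k`. Summing over `k` therefore multiplies each link by the number of its contracted sites. -/
theorem covCoeff_eq_sum {n : ℕ} (f : (Fin n → Bool) → ℝ) (τ : Fin n → Fin 4) :
    covCoeff f τ = ∑ A, ∑ B, f A * f B * (nContr A B τ * ∏ j, linkW (A j) (B j) (τ j)) := by
  unfold covCoeff nContr
  simp_rw [siteCoeff_eq_sum]
  rw [Finset.sum_comm]
  refine Finset.sum_congr rfl fun A _ => ?_
  rw [Finset.sum_comm]
  refine Finset.sum_congr rfl fun B _ => ?_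
  rw [Finset.sum_mul, Finset.mul_sum]

theorem nContr_nonneg {n : ℕ} (A B : Fin n → Bool) (τ : Fin n → Fin 4) : 0 ≤ nContr A B τ :=
  Finset.sum_nonneg fun k _ => by split_ifs <;> norm_num

theorem nContr_le {n : ℕ} (A B : Fin n → Bool) (τ : Fin n → Fin 4) : nContr A B τ ≤ size A := by
  unfold nContr size
  push_cast
  refine Finset.sum_le_sum fun k _ => ?_
  by_cases hA : A k = true
  · simp only [hA, true_and]; split_ifs <;> simp
  · simp [hA]

/-- Type `2` at `j` means that both factors contain `Z_j`, so only sets through `j` matter, and at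
most `N` sites are contracted. -/
theorem abs_covCoeff_le {n : ℕ} {f : (Fin n → Bool) → ℝ} {N : ℕ}
    (hf : ∀ A, f A ≠ 0 → size A ≤ N) {τ : Fin n → Fin 4} {j : Fin n} (hj : τ j = 2) :
    |covCoeff f τ| ≤ N * linkForm (fun A => |restr f j A|) (fun A => |restr f j A|) τ := by
  rw [covCoeff_eq_sum, linkForm, Finset.mul_sum]
  refine (Finset.abs_sum_le_sum_abs _ _).trans (Finset.sum_le_sum fun A _ => ?_)
  rw [Finset.mul_sum]
  refine (Finset.abs_sum_le_sum_abs _ _).trans (Finset.sum_le_sum fun B _ => ?_)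
  have hW : 0 ≤ ∏ j, linkW (A j) (B j) (τ j) := Finset.prod_nonneg fun j _ => linkW_nonneg _ _ _
  by_cases hfA : f A = 0
  · simp [hfA, restr]
  by_cases h : A j = true ∧ B j = true
  · simp only [restr, h.1, h.2, if_true]
    rw [abs_mul, abs_mul, abs_mul, abs_of_nonneg hW, abs_of_nonneg (nContr_nonneg A B τ)]
    have : nContr A B τ ≤ N := (nContr_le A B τ).trans (by exact_mod_cast hf A hfA)
    have h2 : |f A| * |f B| * (nContr A B τ * ∏ j, linkW (A j) (B j) (τ j))
        ≤ |f A| * |f B| * (N * ∏ j, linkW (A j) (B j) (τ j)) := by gcongr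
    linarith
  · have : ∏ j, linkW (A j) (B j) (τ j) = 0 := by
      refine Finset.prod_eq_zero (Finset.mem_univ j) ?_
      rw [hj]
      revert h
      cases A j <;> cases B j <;> simp [linkW]
    simp [this]

theorem wSq_abs {n : ℕ} (lam : ℝ) (g : (Fin n → Bool) → ℝ) :
    wSq lam (fun A => |g A|) = wSq lam g := by simp [wSq]

theorem sum_covCoeff_sq_le_of_two {L : ℝ} (hL : 0 ≤ L) {n : ℕ} {f : (Fin n → Bool) → ℝ} {N : ℕ}
    (hf : ∀ A, f A ≠ 0 → size A ≤ N) :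
    ∑ τ, (if ∃ j, τ j = 2 then (∏ j, typeWt L (τ j)) * covCoeff f τ ^ 2 else 0)
      ≤ N ^ 2 * ∑ j, wSq (2 * L + 1) (restr f j) ^ 2 := by
  have hw : ∀ τ : Fin n → Fin 4, 0 ≤ ∏ j, typeWt L (τ j) :=
    fun τ => Finset.prod_nonneg fun j _ => typeWt_nonneg hL _
  have h1 : ∀ τ : Fin n → Fin 4,
      (if ∃ j, τ j = 2 then (∏ j, typeWt L (τ j)) * covCoeff f τ ^ 2 else 0)
      ≤ ∑ j, (N : ℝ) ^ 2 * ((∏ j, typeWt L (τ j)) *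
        linkForm (fun A => |restr f j A|) (fun A => |restr f j A|) τ ^ 2) := by
    intro τ
    have hnn : ∀ j ∈ Finset.univ, 0 ≤ (N : ℝ) ^ 2 * ((∏ j, typeWt L (τ j)) *
        linkForm (fun A => |restr f j A|) (fun A => |restr f j A|) τ ^ 2) := fun j _ =>
      mul_nonneg (sq_nonneg _) (mul_nonneg (hw τ) (sq_nonneg _))
    split_ifs with h
    · obtain ⟨j, hj⟩ := h
      -- One site of type `2` suffices; the sum over all `j` removes the choice and leaves the
      -- influences.
      refine le_trans ?_ (Finset.single_le_sum hnn (Finset.mem_univ j))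
      have := sq_le_sq' (by linarith [abs_nonneg (covCoeff f τ), abs_covCoeff_le hf hj])
        (abs_covCoeff_le hf hj)
      rw [sq_abs] at this
      have := mul_le_mul_of_nonneg_left this (hw τ)
      linarith
    · exact Finset.sum_nonneg hnn
  refine (Finset.sum_le_sum fun τ _ => h1 τ).trans ?_
  rw [Finset.sum_comm, Finset.mul_sum]
  refine Finset.sum_le_sum fun j _ => ?_
  rw [← Finset.mul_sum]
  refine mul_le_mul_of_nonneg_left ?_ (sq_nonneg _)
  have := sum_typeWt_mul_linkForm_sq_le hL (fun A => |restr f j A|) (fun A => |restr f j A|)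
  rwa [wSq_abs, ← sq] at this

/-! ### Contractions in the covariance -/

/-- In matrix terms, the squared Hilbert–Schmidt norm of `U Vᵀ` is the inner product of the Gram
matrices `Uᵀ U` and `Vᵀ V`. -/
theorem sum_sq_contraction_le {α β γ : Type*} [Fintype α] [Fintype β] [Fintype γ]
    (u : α → γ → ℝ) (v : β → γ → ℝ) :
    ∑ P, ∑ S, (∑ R, u P R * v S R) ^ 2
      ≤ √(∑ R, ∑ R', (∑ P, u P R * u P R') ^ 2) * √(∑ R, ∑ R', (∑ S, v S R * v S R') ^ 2) := by
  have h1 : ∑ P, ∑ S, (∑ R, u P R * v S R) ^ 2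
      = ∑ x : γ × γ, (∑ P, u P x.1 * u P x.2) * (∑ S, v S x.1 * v S x.2) := by
    rw [Fintype.sum_prod_type]
    simp_rw [sq, Finset.sum_mul, Finset.mul_sum]
    have : ∀ P, ∑ S, ∑ R, ∑ R', u P R * v S R * (u P R' * v S R')
        = ∑ R, ∑ R', ∑ S, u P R * v S R * (u P R' * v S R') := by
      intro P
      rw [Finset.sum_comm]
      exact Finset.sum_congr rfl fun R _ => Finset.sum_comm
    simp_rw [this]
    rw [Finset.sum_comm]
    refine Finset.sum_congr rfl fun R _ => ?_
    rw [Finset.sum_comm]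
    refine Finset.sum_congr rfl fun R' _ => Finset.sum_congr rfl fun P _ =>
      Finset.sum_congr rfl fun S _ => by ring
  rw [h1, ← Fintype.sum_prod_type' (f := fun R R' => (∑ P, u P R * u P R') ^ 2),
    ← Fintype.sum_prod_type' (f := fun R R' => (∑ S, v S R * v S R') ^ 2)]
  exact Real.sum_mul_le_sqrt_mul_sqrt _ _ _

theorem sum_sq_gram_le {β γ : Type*} [Fintype β] [Fintype γ] (v : β → γ → ℝ) :
    ∑ R, ∑ R', (∑ S, v S R * v S R') ^ 2 ≤ (∑ R, ∑ S, v S R ^ 2) ^ 2 := by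
  rw [sq (∑ R, ∑ S, v S R ^ 2), Finset.sum_mul_sum]
  exact Finset.sum_le_sum fun R _ => Finset.sum_le_sum fun R' _ =>
    Finset.sum_mul_sq_le_sq_mul_sq _ _ _

/-- Each `A` is met once for each of the `2 ^ |A|` ways to split it into two disjoint parts. -/
theorem sum_joinF_sq_le {n : ℕ} {f : (Fin n → Bool) → ℝ} {m : ℕ}
    (hf : ∀ A, f A ≠ 0 → size A ≤ m) :
    ∑ R, ∑ S, joinF f S R ^ 2 ≤ 2 ^ m * ∑ A, f A ^ 2 := by
  have h1 : ∀ S R, joinF f S R ^ 2 ≤ ∑ A, f A ^ 2 * ∏ j, joinW (A j) (S j) (R j) := by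
    intro S R
    have hp : ∀ A : Fin n → Bool, 0 ≤ ∏ j, joinW (A j) (S j) (R j) :=
      fun A => Finset.prod_nonneg fun j _ => joinW_nonneg _ _ _
    have h2 := Finset.sum_sq_le_sum_mul_sum_of_sq_le_mul Finset.univ
      (r := fun A => f A * ∏ j, joinW (A j) (S j) (R j))
      (f := fun A => f A ^ 2 * ∏ j, joinW (A j) (S j) (R j))
      (g := fun A => ∏ j, joinW (A j) (S j) (R j))
      (fun A _ => mul_nonneg (sq_nonneg _) (hp A)) (fun A _ => hp A)
      (fun A _ => le_of_eq (by ring))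
    have h3 : ∑ A : Fin n → Bool, ∏ j, joinW (A j) (S j) (R j) ≤ 1 := by
      rw [sum_prod_eq (fun j a => joinW a (S j) (R j))]
      refine Finset.prod_le_one (fun j _ => Finset.sum_nonneg fun _ _ => joinW_nonneg _ _ _)
        fun j _ => ?_
      rw [Fintype.sum_bool]
      cases S j <;> cases R j <;> norm_num [joinW]
    refine h2.trans ?_
    exact mul_le_of_le_one_right (Finset.sum_nonneg fun A _ => mul_nonneg (sq_nonneg _) (hp A)) h3
  calc ∑ R, ∑ S, joinF f S R ^ 2
      ≤ ∑ R, ∑ S, ∑ A, f A ^ 2 * ∏ j, joinW (A j) (S j) (R j) :=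
        Finset.sum_le_sum fun R _ => Finset.sum_le_sum fun S _ => h1 S R
    _ = ∑ A, f A ^ 2 * ∑ R : Fin n → Bool, ∑ S : Fin n → Bool, ∏ j, joinW (A j) (S j) (R j) := by
        simp_rw [Finset.mul_sum]
        rw [Finset.sum_comm' (t' := Finset.univ) (s' := fun _ => Finset.univ) (by simp)]
        conv_rhs => rw [Finset.sum_comm]
        conv_lhs => rw [Finset.sum_comm]
        refine Finset.sum_congr rfl fun R _ => ?_
        rw [Finset.sum_comm]
    _ ≤ ∑ A, f A ^ 2 * 2 ^ m := by
        refine Finset.sum_le_sum fun A _ => ?_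
        by_cases hA : f A = 0
        · simp [hA]
        refine mul_le_mul_of_nonneg_left ?_ (sq_nonneg _)
        have e1 : ∑ R : Fin n → Bool, ∑ S : Fin n → Bool, ∏ j, joinW (A j) (S j) (R j)
            = ∏ j, (2 : ℝ) ^ (A j).toNat := by
          simp_rw [fun R : Fin n → Bool => sum_prod_eq (fun j s => joinW (A j) s (R j))]
          rw [sum_prod_eq (fun j r => ∑ s, joinW (A j) s r)]
          refine Finset.prod_congr rfl fun j _ => ?_
          simp only [Fintype.sum_bool]
          cases A j <;> norm_num [joinW]
        rw [e1, Finset.prod_pow_eq_pow_sum]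
        exact pow_le_pow_right₀ one_le_two (hf A hA)
    _ = 2 ^ m * ∑ A, f A ^ 2 := by rw [← Finset.sum_mul]; ring

theorem homPart_ne_zero {n : ℕ} {f : (Fin n → Bool) → ℝ} {l : ℕ} (A : Fin n → Bool)
    (h : homPart f l A ≠ 0) : size A = l := by
  unfold homPart at h; by_contra h'; simp [h'] at h

theorem contr_symm {n : ℕ} (f g : (Fin n → Bool) → ℝ) (P S : Fin n → Bool) :
    contr f g P S = contr g f S P :=
  Finset.sum_congr rfl fun _ _ => mul_comm _ _

/-- The Gram matrix of `f` is again a contraction of `f` with itself, and a proper one: nonzero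
terms have `|P| + |R| = l`, so `0 < |P| < l` amounts to `0 < |R| < l`. The Gram matrix of `g` is
bounded by its full norm. Thus mixed contractions need no separate hypothesis. -/
theorem sum_contr_sq_le {n : ℕ} {f g : (Fin n → Bool) → ℝ} {l m : ℕ}
    (hf : ∀ A, f A ≠ 0 → size A = l) (hg : ∀ A, g A ≠ 0 → size A ≤ m) :
    ∑ P, ∑ S, (if 0 < size P ∧ size P < l then contr f g P S ^ 2 else 0)
      ≤ √(contrSq f l) * (2 ^ m * ∑ A, g A ^ 2) := by
  have h1 : ∀ P S, (if 0 < size P ∧ size P < l then contr f g P S ^ 2 else 0)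
      = (∑ R, (if 0 < size P ∧ size P < l then joinF f P R else 0) * joinF g S R) ^ 2 := by
    intro P S
    split_ifs
    · rfl
    · simp
  simp_rw [h1]
  refine (sum_sq_contraction_le _ _).trans ?_
  refine mul_le_mul (Real.sqrt_le_sqrt (le_of_eq ?_)) ?_ (Real.sqrt_nonneg _) (Real.sqrt_nonneg _)
  · unfold contrSq
    refine Finset.sum_congr rfl fun R _ => Finset.sum_congr rfl fun R' _ => ?_
    have : ∀ P, (if 0 < size P ∧ size P < l then joinF f P R else 0)
        * (if 0 < size P ∧ size P < l then joinF f P R' else 0)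
        = if 0 < size R ∧ size R < l then joinF f R P * joinF f R' P else 0 := by
      intro P
      rw [joinF_symm f R P, joinF_symm f R' P]
      by_cases h : joinF f P R = 0
      · simp [h]
      · have h2 := joinF_hom_size hf h
        have : (0 < size P ∧ size P < l) ↔ (0 < size R ∧ size R < l) := by omega
        simp only [this]
        split_ifs <;> simp
    simp_rw [this]
    split_ifs
    · rfl
    · simp
  · refine Real.sqrt_le_iff.2 ⟨by positivity, ?_⟩
    refine (sum_sq_gram_le _).trans ?_
    exact pow_le_pow_left₀ (Finset.sum_nonneg fun _ _ => Finset.sum_nonneg fun _ _ => sq_nonneg _)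
      (sum_joinF_sq_le hg) 2

theorem splitW_nonneg (p s : Bool) (t : Fin 4) : 0 ≤ splitW p s t := by
  unfold splitW; split_ifs <;> norm_num

theorem linkW_eq_sum (x y : Bool) {t : Fin 4} (h2 : t ≠ 2) :
    linkW x y t = ∑ p : Bool, ∑ s : Bool, ∑ r : Bool, splitW p s t * (joinW x p r * joinW y s r) := by
  revert h2
  simp only [Fintype.sum_bool]
  cases x <;> cases y <;> fin_cases t <;> simp [linkW, splitW, joinW]

theorem size_eq_nContr {n : ℕ} {A B P S R : Fin n → Bool} {τ : Fin n → Fin 4}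
    (h : ∏ j, splitW (P j) (S j) (τ j) * (joinW (A j) (P j) (R j) * joinW (B j) (S j) (R j)) ≠ 0) :
    (size R : ℝ) = nContr A B τ := by
  unfold size nContr
  push_cast
  refine Finset.sum_congr rfl fun j _ => ?_
  have := Finset.prod_ne_zero_iff.1 h j (Finset.mem_univ j)
  revert this
  generalize A j = a; generalize B j = b; generalize P j = p; generalize S j = s
  generalize R j = r; generalize τ j = t
  cases a <;> cases b <;> cases p <;> cases s <;> cases r <;> fin_cases t <;>
    simp [splitW, joinW]

/-- In the absence of type `2`, the sites of type `1` are distributed between `P` and `S`, and a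
site of type `0` is either in neither set or contracted. The contracted sites form `R`, whence the
factor `size R`. -/
theorem covCoeff_eq_sum_split {n : ℕ} (f : (Fin n → Bool) → ℝ) {τ : Fin n → Fin 4}
    (hτ : ∀ j, τ j ≠ 2) :
    covCoeff f τ = ∑ P : Fin n → Bool, ∑ S : Fin n → Bool, (∏ j, splitW (P j) (S j) (τ j)) *
      ∑ R : Fin n → Bool, size R * (joinF f P R * joinF f S R) := by
  have h1 : ∀ A B : Fin n → Bool, nContr A B τ * ∏ j, linkW (A j) (B j) (τ j)
      = ∑ P : Fin n → Bool, ∑ S : Fin n → Bool, ∑ R : Fin n → Bool, (size R : ℝ) *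
        ∏ j, splitW (P j) (S j) (τ j) * (joinW (A j) (P j) (R j) * joinW (B j) (S j) (R j)) := by
    intro A B
    rw [Finset.prod_congr rfl fun j _ => linkW_eq_sum (A j) (B j) (hτ j),
      ← sum_prod_eq (fun j p => ∑ s : Bool, ∑ r : Bool,
        splitW p s (τ j) * (joinW (A j) p r * joinW (B j) s r)), Finset.mul_sum]
    refine Finset.sum_congr rfl fun P _ => ?_
    rw [← sum_prod_eq (fun j s => ∑ r : Bool,
        splitW (P j) s (τ j) * (joinW (A j) (P j) r * joinW (B j) s r)), Finset.mul_sum]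
    refine Finset.sum_congr rfl fun S _ => ?_
    rw [← sum_prod_eq (fun j r =>
        splitW (P j) (S j) (τ j) * (joinW (A j) (P j) r * joinW (B j) (S j) r)), Finset.mul_sum]
    refine Finset.sum_congr rfl fun R _ => ?_
    by_cases h : ∏ j, splitW (P j) (S j) (τ j)
        * (joinW (A j) (P j) (R j) * joinW (B j) (S j) (R j)) = 0
    · rw [h]; simp
    · rw [size_eq_nContr h]
  rw [covCoeff_eq_sum]
  simp_rw [h1, joinF, Finset.sum_mul, Finset.mul_sum]
  have key : ∀ F : (Fin n → Bool) → (Fin n → Bool) → (Fin n → Bool) → (Fin n → Bool) →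
      (Fin n → Bool) → ℝ, ∑ A, ∑ B, ∑ P, ∑ S, ∑ R, F A B P S R
        = ∑ P, ∑ S, ∑ R, ∑ A, ∑ B, F A B P S R := by
    intro F
    have c1 : ∀ A, ∑ B, ∑ P, ∑ S, ∑ R, F A B P S R = ∑ P, ∑ S, ∑ R, ∑ B, F A B P S R := by
      intro A
      rw [Finset.sum_comm]
      refine Finset.sum_congr rfl fun P _ => ?_
      rw [Finset.sum_comm]
      exact Finset.sum_congr rfl fun S _ => Finset.sum_comm
    simp_rw [c1]
    rw [Finset.sum_comm]
    refine Finset.sum_congr rfl fun P _ => ?_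
    rw [Finset.sum_comm]
    exact Finset.sum_congr rfl fun S _ => Finset.sum_comm
  rw [key]
  refine Finset.sum_congr rfl fun P _ => Finset.sum_congr rfl fun S _ =>
    Finset.sum_congr rfl fun R _ => Finset.sum_congr rfl fun A _ => Finset.sum_congr rfl fun B _ => ?_
  simp_rw [Finset.prod_mul_distrib]
  ring

theorem contr_homPart {n : ℕ} (f : (Fin n → Bool) → ℝ) {N : ℕ}
    (hf : ∀ A, f A ≠ 0 → 1 ≤ size A ∧ size A ≤ N) (A : Fin n → Bool) :
    f A = ∑ l ∈ Finset.Icc 1 N, homPart f l A := by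
  unfold homPart
  rw [Finset.sum_ite_eq]
  by_cases h : f A = 0
  · simp [h]
  · rw [if_pos (Finset.mem_Icc.2 (hf A h))]

theorem joinF_sum {n : ℕ} {ι : Type*} (s : Finset ι) (F : ι → (Fin n → Bool) → ℝ)
    (f : (Fin n → Bool) → ℝ) (h : ∀ A, f A = ∑ l ∈ s, F l A) (P R : Fin n → Bool) :
    joinF f P R = ∑ l ∈ s, joinF (F l) P R := by
  unfold joinF
  simp_rw [h, Finset.sum_mul]
  exact Finset.sum_comm

/-- In the homogeneous part of degree `l` the size of `R` is `l - size P`, so it leaves the sum and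
is at most `N`; the truncated subtraction produces the condition `size P < l`. Cauchy–Schwarz over
the `N ^ 2` pairs of degrees gives the other half of `N ^ 4`. -/
theorem sum_size_mul_joinF_sq_le {n : ℕ} {f : (Fin n → Bool) → ℝ} {N : ℕ}
    (hf : ∀ A, f A ≠ 0 → 1 ≤ size A ∧ size A ≤ N) (P S : Fin n → Bool) :
    (∑ R : Fin n → Bool, size R * (joinF f P R * joinF f S R)) ^ 2
      ≤ N ^ 4 * ∑ l ∈ Finset.Icc 1 N, ∑ m ∈ Finset.Icc 1 N,
        if size P < l then contr (homPart f l) (homPart f m) P S ^ 2 else 0 := by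
  have h1 : ∑ R : Fin n → Bool, size R * (joinF f P R * joinF f S R)
      = ∑ x ∈ Finset.Icc 1 N ×ˢ Finset.Icc 1 N, ((x.1 - size P : ℕ) : ℝ)
        * contr (homPart f x.1) (homPart f x.2) P S := by
    rw [Finset.sum_product]
    simp_rw [contr, Finset.mul_sum]
    simp_rw [joinF_sum _ _ _ (contr_homPart f hf), Finset.sum_mul_sum, Finset.mul_sum]
    rw [Finset.sum_comm]
    refine Finset.sum_congr rfl fun l _ => ?_
    rw [Finset.sum_comm]
    refine Finset.sum_congr rfl fun m _ => Finset.sum_congr rfl fun R _ => ?_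
    by_cases h : joinF (homPart f l) P R = 0
    · simp [h]
    · rw [← joinF_hom_size homPart_ne_zero h]; simp
  rw [h1]
  have h2 := Finset.sum_mul_sq_le_sq_mul_sq (Finset.Icc 1 N ×ˢ Finset.Icc 1 N) (fun _ => (1 : ℝ))
    (fun x => ((x.1 - size P : ℕ) : ℝ) * contr (homPart f x.1) (homPart f x.2) P S)
  simp only [one_mul, one_pow, Finset.sum_const, Finset.card_product, Nat.card_Icc,
    add_tsub_cancel_right, nsmul_eq_mul, mul_one] at h2
  refine h2.trans ?_
  rw [← Finset.sum_product', show (N : ℝ) ^ 4 = ((N * N : ℕ) : ℝ) * N ^ 2 by push_cast; ring,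
    mul_assoc]
  refine mul_le_mul_of_nonneg_left ?_ (Nat.cast_nonneg _)
  rw [Finset.mul_sum]
  refine Finset.sum_le_sum fun x hx => ?_
  have hx1 := (Finset.mem_Icc.1 (Finset.mem_product.1 hx).1).2
  split_ifs with h
  · rw [mul_pow]
    refine mul_le_mul_of_nonneg_right ?_ (sq_nonneg _)
    refine pow_le_pow_left₀ (Nat.cast_nonneg _) ?_ 2
    exact_mod_cast (Nat.sub_le _ _).trans hx1
  · rw [Nat.sub_eq_zero_of_le (not_lt.1 h)]; simp

theorem homPart_sq_le {n : ℕ} (f : (Fin n → Bool) → ℝ) {N : ℕ}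
    (hf : ∀ A, f A ≠ 0 → 1 ≤ size A ∧ size A ≤ N) :
    ∑ m ∈ Finset.Icc 1 N, ∑ A, homPart f m A ^ 2 = ∑ A, f A ^ 2 := by
  rw [Finset.sum_comm]
  refine Finset.sum_congr rfl fun A _ => ?_
  have : ∀ m, homPart f m A ^ 2 = if size A = m then f A ^ 2 else 0 := by
    intro m; unfold homPart; split_ifs <;> simp
  simp_rw [this]
  rw [Finset.sum_ite_eq]
  by_cases h : f A = 0
  · simp [h]
  · rw [if_pos (Finset.mem_Icc.2 (hf A h))]

/-- Apart from `P = S = ∅`, the constant term, every nonzero contraction occurring here is proper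
for at least one of its two homogeneous parts. The two cases are symmetric, whence the factor `2`.
-/
theorem sum_contr_homPart_le {n : ℕ} {f : (Fin n → Bool) → ℝ} {N : ℕ}
    (hf : ∀ A, f A ≠ 0 → 1 ≤ size A ∧ size A ≤ N) :
    ∑ P, ∑ S, (if P = (fun _ => false) ∧ S = (fun _ => false) then 0 else
      ∑ l ∈ Finset.Icc 1 N, ∑ m ∈ Finset.Icc 1 N,
        if size P < l then contr (homPart f l) (homPart f m) P S ^ 2 else 0)
      ≤ 2 * 2 ^ N * (∑ l ∈ Finset.Icc 1 N, √(contrSq (homPart f l) l)) * ∑ A, f A ^ 2 := by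
  have h1 : ∀ P S : Fin n → Bool, (if P = (fun _ => false) ∧ S = (fun _ => false) then 0 else
      ∑ l ∈ Finset.Icc 1 N, ∑ m ∈ Finset.Icc 1 N,
        if size P < l then contr (homPart f l) (homPart f m) P S ^ 2 else 0)
      ≤ ∑ l ∈ Finset.Icc 1 N, ∑ m ∈ Finset.Icc 1 N,
        ((if 0 < size P ∧ size P < l then contr (homPart f l) (homPart f m) P S ^ 2 else 0)
        + if 0 < size S ∧ size S < m then contr (homPart f m) (homPart f l) S P ^ 2 else 0) := by
    intro P S
    have hnn : ∀ (l m : ℕ), (0 : ℝ) ≤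
      ((if 0 < size P ∧ size P < l then contr (homPart f l) (homPart f m) P S ^ 2 else 0)
        + if 0 < size S ∧ size S < m then contr (homPart f m) (homPart f l) S P ^ 2 else 0) := by
      intro l m
      refine add_nonneg ?_ ?_ <;> split_ifs <;> first | exact sq_nonneg _ | exact le_rfl
    by_cases h0 : P = (fun _ => false) ∧ S = (fun _ => false)
    · rw [if_pos h0]
      exact Finset.sum_nonneg fun l _ => Finset.sum_nonneg fun m _ => hnn l m
    · rw [if_neg h0]
      refine Finset.sum_le_sum fun l _ => Finset.sum_le_sum fun m _ => ?_
      by_cases hPl : size P < l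
      swap
      · rw [if_neg hPl]; exact hnn l m
      rw [if_pos hPl]
      by_cases hP : 0 < size P
      · rw [if_pos ⟨hP, hPl⟩]
        refine le_add_of_nonneg_right ?_
        split_ifs <;> first | exact sq_nonneg _ | exact le_rfl
      -- With `P` empty, `R` has `l > 0` sites, so `0 < size S < m` and the contraction is proper
      -- for the part of degree `m`.
      · have hP0 := size_eq_zero (Nat.eq_zero_of_not_pos hP)
        have hS : 0 < size S := Nat.pos_of_ne_zero fun h => h0 ⟨hP0, size_eq_zero h⟩
        rw [contr_symm _ _ S P]
        by_cases hc : contr (homPart f l) (homPart f m) P S = 0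
        · simp [hc]
        · obtain ⟨R, -, hR⟩ := Finset.exists_ne_zero_of_sum_ne_zero hc
          have e1 := joinF_hom_size homPart_ne_zero (left_ne_zero_of_mul hR)
          have e2 := joinF_hom_size homPart_ne_zero (right_ne_zero_of_mul hR)
          rw [if_neg (by tauto), if_pos (by omega)]
          simp
  refine (Finset.sum_le_sum fun P _ => Finset.sum_le_sum fun S _ => h1 P S).trans ?_
  have h2 : ∀ l ∈ Finset.Icc 1 N, ∀ m ∈ Finset.Icc 1 N,
      ∑ P, ∑ S, (if 0 < size P ∧ size P < l
        then contr (homPart f l) (homPart f m) P S ^ 2 else 0)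
      ≤ √(contrSq (homPart f l) l) * (2 ^ N * ∑ A, homPart f m A ^ 2) := fun l _ m hm =>
    sum_contr_sq_le homPart_ne_zero
      (fun A hA => (homPart_ne_zero A hA).le.trans (Finset.mem_Icc.1 hm).2)
  have h3 : ∑ P : Fin n → Bool, ∑ S : Fin n → Bool, ∑ l ∈ Finset.Icc 1 N, ∑ m ∈ Finset.Icc 1 N,
        ((if 0 < size P ∧ size P < l then contr (homPart f l) (homPart f m) P S ^ 2 else 0)
        + if 0 < size S ∧ size S < m then contr (homPart f m) (homPart f l) S P ^ 2 else 0)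
      = ∑ l ∈ Finset.Icc 1 N, ∑ m ∈ Finset.Icc 1 N, 2 * ∑ P, ∑ S, (if 0 < size P ∧ size P < l
        then contr (homPart f l) (homPart f m) P S ^ 2 else 0) := by
    have c : ∀ G : (Fin n → Bool) → (Fin n → Bool) → ℕ → ℕ → ℝ,
        ∑ P, ∑ S, ∑ l ∈ Finset.Icc 1 N, ∑ m ∈ Finset.Icc 1 N, G P S l m
        = ∑ l ∈ Finset.Icc 1 N, ∑ m ∈ Finset.Icc 1 N, ∑ P, ∑ S, G P S l m := by
      intro G
      have c1 : ∀ P, ∑ S, ∑ l ∈ Finset.Icc 1 N, ∑ m ∈ Finset.Icc 1 N, G P S l m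
          = ∑ l ∈ Finset.Icc 1 N, ∑ m ∈ Finset.Icc 1 N, ∑ S, G P S l m := by
        intro P
        rw [Finset.sum_comm]
        exact Finset.sum_congr rfl fun l _ => Finset.sum_comm
      simp_rw [c1]
      rw [Finset.sum_comm]
      exact Finset.sum_congr rfl fun l _ => Finset.sum_comm
    rw [c]
    simp_rw [Finset.sum_add_distrib]
    simp_rw [two_mul, Finset.sum_add_distrib]
    congr 1
    rw [Finset.sum_comm]
    exact Finset.sum_congr rfl fun l _ => Finset.sum_congr rfl fun m _ => Finset.sum_comm
  rw [h3]
  calc _ ≤ ∑ l ∈ Finset.Icc 1 N, ∑ m ∈ Finset.Icc 1 N,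
        2 * (√(contrSq (homPart f l) l) * (2 ^ N * ∑ A, homPart f m A ^ 2)) :=
        Finset.sum_le_sum fun l hl => Finset.sum_le_sum fun m hm =>
          mul_le_mul_of_nonneg_left (h2 l hl m hm) zero_le_two
    _ = _ := by
        rw [← homPart_sq_le f hf, mul_assoc, Finset.sum_mul_sum, Finset.mul_sum]
        refine Finset.sum_congr rfl fun l _ => ?_
        rw [Finset.mul_sum]
        exact Finset.sum_congr rfl fun m _ => by ring

theorem typeWt_two_mul {L : ℝ} (t : Fin 4) :
    typeWt (2 * L) t = typeWt L t * typeWt 2 t := by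
  unfold typeWt; split_ifs <;> ring

theorem sum_split_le {n : ℕ} (τ : Fin n → Fin 4) :
    ∑ P : Fin n → Bool, ∑ S : Fin n → Bool, ∏ j, splitW (P j) (S j) (τ j)
      ≤ ∏ j, typeWt 2 (τ j) := by
  simp_rw [fun P : Fin n → Bool => sum_prod_eq (fun j s => splitW (P j) s (τ j))]
  rw [sum_prod_eq (fun j p => ∑ s, splitW p s (τ j))]
  refine Finset.prod_le_prod (fun j _ => Finset.sum_nonneg fun _ _ => Finset.sum_nonneg fun _ _ =>
    splitW_nonneg _ _ _) fun j _ => ?_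
  simp only [Fintype.sum_bool]
  generalize τ j = t
  fin_cases t <;> norm_num [splitW, typeWt]

theorem prod_typeWt_of_split {n : ℕ} {L : ℝ} {P S : Fin n → Bool} {τ : Fin n → Fin 4}
    (h : ∏ j, splitW (P j) (S j) (τ j) ≠ 0) :
    ∏ j, typeWt L (τ j) = L ^ (size P + size S) := by
  unfold size
  rw [← Finset.sum_add_distrib, ← Finset.prod_pow_eq_pow_sum]
  refine Finset.prod_congr rfl fun j _ => ?_
  have := Finset.prod_ne_zero_iff.1 h j (Finset.mem_univ j)
  revert this
  generalize P j = p; generalize S j = s; generalize τ j = t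
  cases p <;> cases s <;> fin_cases t <;> simp [splitW, typeWt]

/-- Cauchy–Schwarz over the splittings `(P, S)` of `τ` costs their number, two per site of type `1`,
which turns the weight `L` into `2 L`. The total weight is then `(2 L) ^ (|P| + |S|)`, and both sets
have at most `N` sites. -/
theorem sum_covCoeff_sq_le_of_split {L : ℝ} (hL : 1 ≤ L) {n : ℕ} {f : (Fin n → Bool) → ℝ} {N : ℕ}
    (hf : ∀ A, f A ≠ 0 → 1 ≤ size A ∧ size A ≤ N) :
    ∑ τ, (if (∀ j, τ j ≠ 2) ∧ τ ≠ (fun _ => 0) then (∏ j, typeWt L (τ j)) * covCoeff f τ ^ 2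
        else 0)
      ≤ (2 * L) ^ (2 * N) * N ^ 4 * (2 * 2 ^ N
        * (∑ l ∈ Finset.Icc 1 N, √(contrSq (homPart f l) l)) * ∑ A, f A ^ 2) := by
  have hL0 : 0 ≤ L := by linarith
  have hsp : ∀ (P S : Fin n → Bool) (τ : Fin n → Fin 4), 0 ≤ ∏ j, splitW (P j) (S j) (τ j) :=
    fun P S τ => Finset.prod_nonneg fun j _ => splitW_nonneg _ _ _
  set G : (Fin n → Bool) → (Fin n → Bool) → ℝ := fun P S =>
    ∑ R : Fin n → Bool, size R * (joinF f P R * joinF f S R) with hG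
  have hGsize : ∀ P S, G P S ≠ 0 → size P + size S ≤ 2 * N := by
    intro P S h
    obtain ⟨R, -, hR⟩ := Finset.exists_ne_zero_of_sum_ne_zero h
    obtain ⟨A, hA, e1⟩ := joinF_ne_zero (left_ne_zero_of_mul (right_ne_zero_of_mul hR))
    obtain ⟨B, hB, e2⟩ := joinF_ne_zero (right_ne_zero_of_mul (right_ne_zero_of_mul hR))
    have := (hf A hA).2
    have := (hf B hB).2
    omega
  have h1 : ∀ τ : Fin n → Fin 4,
      (if (∀ j, τ j ≠ 2) ∧ τ ≠ (fun _ => 0) then (∏ j, typeWt L (τ j)) * covCoeff f τ ^ 2 else 0)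
      ≤ (2 * L) ^ (2 * N) * ∑ P : Fin n → Bool, ∑ S : Fin n → Bool,
        (if P = (fun _ => false) ∧ S = (fun _ => false) then 0
        else G P S ^ 2) * ∏ j, splitW (P j) (S j) (τ j) := by
    intro τ
    split_ifs with h
    · rw [covCoeff_eq_sum_split f h.1]
      have h2 := Finset.sum_sq_le_sum_mul_sum_of_sq_le_mul
        (Finset.univ : Finset ((Fin n → Bool) × (Fin n → Bool)))
        (r := fun x => (∏ j, splitW (x.1 j) (x.2 j) (τ j)) * G x.1 x.2)
        (f := fun x => ∏ j, splitW (x.1 j) (x.2 j) (τ j))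
        (g := fun x => (∏ j, splitW (x.1 j) (x.2 j) (τ j)) * G x.1 x.2 ^ 2)
        (fun x _ => hsp _ _ _) (fun x _ => mul_nonneg (hsp _ _ _) (sq_nonneg _))
        (fun x _ => le_of_eq (by ring))
      simp only [Fintype.sum_prod_type] at h2
      have hS0 : 0 ≤ ∑ P : Fin n → Bool, ∑ S : Fin n → Bool,
          (∏ j, splitW (P j) (S j) (τ j)) * G P S ^ 2 :=
        Finset.sum_nonneg fun P _ => Finset.sum_nonneg fun S _ =>
          mul_nonneg (hsp _ _ _) (sq_nonneg _)
      have h3 := h2.trans (mul_le_mul_of_nonneg_right (sum_split_le τ) hS0)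
      have hw : 0 ≤ ∏ j, typeWt L (τ j) := Finset.prod_nonneg fun j _ => typeWt_nonneg hL0 _
      refine (mul_le_mul_of_nonneg_left h3 hw).trans ?_
      rw [← mul_assoc, ← Finset.prod_mul_distrib, Finset.prod_congr rfl fun j _ =>
        (typeWt_two_mul (L := L) (τ j)).symm, Finset.mul_sum, Finset.mul_sum]
      refine Finset.sum_le_sum fun P _ => ?_
      rw [Finset.mul_sum, Finset.mul_sum]
      refine Finset.sum_le_sum fun S _ => ?_
      by_cases hs : ∏ j, splitW (P j) (S j) (τ j) = 0
      · simp [hs]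
      rw [prod_typeWt_of_split hs]
      have hPS : ¬ (P = (fun _ => false) ∧ S = (fun _ => false)) := by
        rintro ⟨rfl, rfl⟩
        refine h.2 (funext fun j => ?_)
        have := Finset.prod_ne_zero_iff.1 hs j (Finset.mem_univ j)
        revert this
        generalize τ j = t
        fin_cases t <;> simp [splitW]
      rw [if_neg hPS]
      by_cases hg : G P S = 0
      · simp [hg]
      rw [mul_comm (G P S ^ 2)]
      refine mul_le_mul_of_nonneg_right ?_ (mul_nonneg (hsp _ _ _) (sq_nonneg _))
      exact pow_le_pow_right₀ (by linarith) (hGsize P S hg)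
    · refine mul_nonneg (by positivity) (Finset.sum_nonneg fun P _ => Finset.sum_nonneg fun S _ =>
        mul_nonneg ?_ (hsp _ _ _))
      split_ifs <;> positivity
  refine (Finset.sum_le_sum fun τ _ => h1 τ).trans ?_
  rw [← Finset.mul_sum, mul_assoc]
  refine mul_le_mul_of_nonneg_left ?_ (by positivity)
  refine le_trans ?_ (mul_le_mul_of_nonneg_left (sum_contr_homPart_le hf) (by positivity))
  rw [Finset.sum_comm, Finset.mul_sum]
  refine Finset.sum_le_sum fun P _ => ?_
  rw [Finset.sum_comm, Finset.mul_sum]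
  refine Finset.sum_le_sum fun S _ => ?_
  rw [← Finset.mul_sum, sum_prod_eq (fun j t => splitW (P j) (S j) t)]
  -- For given `P` and `S` at most one `τ` is compatible, so the sum over `τ` costs nothing.
  have hle : ∏ j, ∑ t, splitW (P j) (S j) t ≤ 1 := by
    refine Finset.prod_le_one (fun j _ => Finset.sum_nonneg fun _ _ => splitW_nonneg _ _ _)
      fun j _ => ?_
    rw [Fin.sum_univ_four]
    cases P j <;> cases S j <;> norm_num [splitW]
  have hnn : 0 ≤ (if P = (fun _ => false) ∧ S = (fun _ => false) then 0 else G P S ^ 2) := by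
    split_ifs <;> positivity
  refine (mul_le_of_le_one_right hnn hle).trans ?_
  split_ifs
  · simp
  · exact sum_size_mul_joinF_sq_le hf P S

theorem sum_covCoeff_sq_le {L : ℝ} (hL : 1 ≤ L) {n : ℕ} {f : (Fin n → Bool) → ℝ} {N : ℕ}
    (hf : ∀ A, f A ≠ 0 → 1 ≤ size A ∧ size A ≤ N) :
    ∑ τ, (if τ = (fun _ => 0) then 0 else (∏ j, typeWt L (τ j)) * covCoeff f τ ^ 2)
      ≤ N ^ 2 * ∑ j, wSq (2 * L + 1) (restr f j) ^ 2
        + (2 * L) ^ (2 * N) * N ^ 4 * (2 * 2 ^ N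
        * (∑ l ∈ Finset.Icc 1 N, √(contrSq (homPart f l) l)) * ∑ A, f A ^ 2) := by
  refine le_trans ?_ (add_le_add (sum_covCoeff_sq_le_of_two (by linarith) fun A hA => (hf A hA).2)
    (sum_covCoeff_sq_le_of_split hL hf))
  rw [← Finset.sum_add_distrib]
  refine Finset.sum_le_sum fun τ _ => ?_
  by_cases h0 : τ = fun _ => 0
  · rw [if_pos h0]
    have h : ¬ ∃ j, τ j = 2 := by rintro ⟨j, hj⟩; rw [h0] at hj; simp at hj
    simp [h0]
  · rw [if_neg h0]
    by_cases h : ∃ j, τ j = 2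
    · rw [if_pos h, if_neg (by push Not; intro h'; obtain ⟨j, hj⟩ := h; exact absurd hj (h' j))]
      simp
    · rw [if_neg h, if_pos ⟨by push Not at h; exact h, h0⟩]
      simp

theorem wSq_le {n : ℕ} {lam : ℝ} (hlam : 1 ≤ lam) {g : (Fin n → Bool) → ℝ} {N : ℕ}
    (hg : ∀ A, g A ≠ 0 → size A ≤ N) : wSq lam g ≤ lam ^ N * ∑ A, g A ^ 2 := by
  unfold wSq
  rw [Finset.mul_sum]
  refine Finset.sum_le_sum fun A _ => ?_
  by_cases h : g A = 0
  · simp [h]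
  refine mul_le_mul_of_nonneg_right ?_ (sq_nonneg _)
  have : ∏ j, (if A j = true then lam else 1) = lam ^ size A := by
    unfold size
    rw [← Finset.prod_pow_eq_pow_sum]
    refine Finset.prod_congr rfl fun j _ => ?_
    cases A j <;> simp
  rw [this]
  exact pow_le_pow_right₀ hlam (hg A h)

/-- At `τ = 0` only `A = B` contributes, once for each of its sites. This is the term that keeps the
covariance away from zero. -/
theorem covCoeff_zero {n : ℕ} (f : (Fin n → Bool) → ℝ) :
    covCoeff f (fun _ => 0) = ∑ A, size A * f A ^ 2 := by
  unfold covCoeff siteCoeff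
  simp only [if_true, linkForm_zero]
  rw [Finset.sum_comm]
  refine Finset.sum_congr rfl fun A _ => ?_
  unfold size restr
  push_cast
  rw [Finset.sum_mul]
  refine Finset.sum_congr rfl fun k _ => ?_
  cases A k <;> simp

/-! ### Two-smoothness of `L^q` and moments of polynomials in independent variables -/

/-- The constant in the pointwise two-smoothness inequality. -/
def smoothConst (q : ℝ) : ℝ := (1 + q) ^ q + q ^ 2

theorem one_le_smoothConst {q : ℝ} (hq : 2 ≤ q) : 1 ≤ smoothConst q := by
  have h1 : (1 : ℝ) ≤ (1 + q) ^ q := Real.one_le_rpow (by linarith) (by linarith)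
  unfold smoothConst; nlinarith

/-- For `|q t| ≤ 1` compare with `exp (q t)`, expanded to second order. For larger `t` both `1` and
`|t|` are at most a constant times `|t|`, and the negative part of `q t` is covered by `q ^ 2 t ^
2`. -/
theorem abs_one_add_rpow_le {q : ℝ} (hq : 2 ≤ q) (t : ℝ) :
    |1 + t| ^ q ≤ 1 + q * t + smoothConst q * (t ^ 2 + |t| ^ q) := by
  have hq0 : 0 ≤ q := by linarith
  have hA : (0 : ℝ) ≤ (1 + q) ^ q := Real.rpow_nonneg (by linarith) _
  have htq : 0 ≤ |t| ^ q := Real.rpow_nonneg (abs_nonneg _) _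
  unfold smoothConst
  by_cases h : |q * t| ≤ 1
  · have h1 : -1 ≤ q * t := by linarith [neg_abs_le (q * t)]
    have h2 : 0 ≤ 1 + t := by nlinarith
    have h3 : |1 + t| ^ q ≤ Real.exp (q * t) := by
      rw [abs_of_nonneg h2, mul_comm, Real.exp_mul]
      exact Real.rpow_le_rpow h2 (by linarith [Real.add_one_le_exp t]) hq0
    have h4 := (abs_le.1 (Real.abs_exp_sub_one_sub_id_le h)).2
    have h5 : 0 ≤ (1 + q) ^ q * (t ^ 2 + |t| ^ q) := by positivity
    have h6 : 0 ≤ q ^ 2 * |t| ^ q := by positivity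
    nlinarith
  · push Not at h
    rw [abs_mul, abs_of_nonneg hq0] at h
    have h1 : |1 + t| ≤ (1 + q) * |t| := by
      have := abs_add_le 1 t
      rw [abs_one] at this
      linarith
    have h2 : |1 + t| ^ q ≤ (1 + q) ^ q * |t| ^ q := by
      rw [← Real.mul_rpow (by linarith) (abs_nonneg _)]
      exact Real.rpow_le_rpow (abs_nonneg _) h1 hq0
    have h3 : -(q * t) ≤ q ^ 2 * t ^ 2 := by
      have h4 : -(q * t) ≤ q * |t| := by nlinarith [neg_abs_le t]
      have h5 : (q * |t|) ^ 2 = q ^ 2 * t ^ 2 := by rw [mul_pow, sq_abs]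
      nlinarith
    have h4 : 0 ≤ (1 + q) ^ q * t ^ 2 := by positivity
    have h5 : 0 ≤ q ^ 2 * |t| ^ q := by positivity
    nlinarith

theorem abs_add_rpow_le {q : ℝ} (hq : 2 ≤ q) (x y : ℝ) :
    |x + y| ^ q ≤ |x| ^ q + q * (|x| ^ (q - 2) * x * y)
      + smoothConst q * (|x| ^ (q - 2) * y ^ 2 + |y| ^ q) := by
  have hC := one_le_smoothConst hq
  by_cases hx : x = 0
  · subst hx
    have h0 : (0 : ℝ) ≤ |(0 : ℝ)| ^ (q - 2) * y ^ 2 :=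
      mul_nonneg (Real.rpow_nonneg (abs_nonneg _) _) (sq_nonneg _)
    have h1 : (0 : ℝ) ≤ |y| ^ q := Real.rpow_nonneg (abs_nonneg _) _
    have h2 : (0 : ℝ) ≤ |(0 : ℝ)| ^ q := Real.rpow_nonneg (abs_nonneg _) _
    rw [zero_add]
    nlinarith
  · have hpos : 0 < |x| := abs_pos.2 hx
    have h := mul_le_mul_of_nonneg_left (abs_one_add_rpow_le hq (y / x))
      (Real.rpow_nonneg (abs_nonneg x) q)
    have e1 : |x| ^ q * |1 + y / x| ^ q = |x + y| ^ q := by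
      rw [← Real.mul_rpow (abs_nonneg _) (abs_nonneg _), ← abs_mul]
      congr 2; field_simp
    have e2 : |x| ^ q * |y / x| ^ q = |y| ^ q := by
      rw [← Real.mul_rpow (abs_nonneg _) (abs_nonneg _), ← abs_mul]
      congr 2; field_simp
    have e3 : |x| ^ q = |x| ^ (q - 2) * x ^ 2 := by
      rw [← sq_abs x, ← Real.rpow_natCast |x| 2, ← Real.rpow_add hpos]
      congr 1; push_cast; ring
    have e4 : |x| ^ (q - 2) * x ^ 2 * (y / x) = |x| ^ (q - 2) * x * y := by field_simp
    have e5 : |x| ^ (q - 2) * x ^ 2 * (y / x) ^ 2 = |x| ^ (q - 2) * y ^ 2 := by field_simp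
    rw [e1] at h
    refine h.trans (le_of_eq ?_)
    have : |x| ^ q * (1 + q * (y / x) + smoothConst q * ((y / x) ^ 2 + |y / x| ^ q))
        = |x| ^ q + q * (|x| ^ q * (y / x)) + smoothConst q * (|x| ^ q * (y / x) ^ 2
          + |x| ^ q * |y / x| ^ q) := by ring
    rw [this, e2, e3, e4, e5]

/-- Weighted arithmetic-geometric mean inequality, used in place of Hölder. The normalization is
such that, when the moments of order `q` are at most `a ^ (q / 2)` and `b ^ (q / 2)`, integration
leaves `a ^ (q / 2 - 1) * b`. The case `q = 2` is included. -/
theorem rpow_mul_sq_le {q a b : ℝ} (hq : 2 ≤ q) (ha : 0 < a) (hb : 0 < b) (x y : ℝ) :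
    |x| ^ (q - 2) * y ^ 2 ≤ a ^ (q / 2 - 1) * b * ((q - 2) / q * (|x| ^ q / a ^ (q / 2))
      + 2 / q * (|y| ^ q / b ^ (q / 2))) := by
  have hq0 : 0 < q := by linarith
  have h := Real.geom_mean_le_arith_mean2_weighted (w₁ := (q - 2) / q) (w₂ := 2 / q)
    (p₁ := |x| ^ q / a ^ (q / 2)) (p₂ := |y| ^ q / b ^ (q / 2))
    (div_nonneg (by linarith) hq0.le) (by positivity) (by positivity) (by positivity)
    (by field_simp; ring)
  have e1 : (|x| ^ q / a ^ (q / 2)) ^ ((q - 2) / q) = |x| ^ (q - 2) / a ^ (q / 2 - 1) := by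
    rw [Real.div_rpow (by positivity) (by positivity), ← Real.rpow_mul (abs_nonneg _),
      ← Real.rpow_mul ha.le]
    congr 2 <;> field_simp
  have e2 : (|y| ^ q / b ^ (q / 2)) ^ (2 / q) = y ^ 2 / b := by
    rw [Real.div_rpow (by positivity) (by positivity), ← Real.rpow_mul (abs_nonneg _),
      ← Real.rpow_mul hb.le]
    have : q * (2 / q) = (2 : ℕ) := by push_cast; field_simp
    rw [this, Real.rpow_natCast, sq_abs]
    have : q / 2 * (2 / q) = 1 := by field_simp
    rw [this, Real.rpow_one]
  rw [e1, e2] at h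
  have h2 := mul_le_mul_of_nonneg_left h (mul_nonneg (Real.rpow_nonneg ha.le (q / 2 - 1)) hb.le)
  refine le_trans (le_of_eq ?_) h2
  have : a ^ (q / 2 - 1) ≠ 0 := (Real.rpow_pos_of_pos ha _).ne'
  field_simp

/-- Bernoulli's inequality absorbs the mixed term and superadditivity of `x ↦ x ^ s` the pure one;
the factor `4` leaves room to average the two bounds. -/
theorem rpow_add_le_of_smooth {s C a b : ℝ} (hs : 1 ≤ s) (hC : 1 ≤ C) (ha : 0 < a) (hb : 0 ≤ b) :
    a ^ s + C * (a ^ (s - 1) * b + b ^ s) ≤ (a + 4 * C * b) ^ s := by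
  have h4 : 0 ≤ 4 * C * b := by positivity
  have h1 : a ^ s + s * (a ^ (s - 1) * (4 * C * b)) ≤ (a + 4 * C * b) ^ s := by
    have h := one_add_mul_self_le_rpow_one_add (s := 4 * C * b / a)
      (by linarith [div_nonneg h4 ha.le]) hs
    have h2 := mul_le_mul_of_nonneg_left h (Real.rpow_nonneg ha.le s)
    rw [← Real.mul_rpow ha.le (by positivity)] at h2
    have e1 : a * (1 + 4 * C * b / a) = a + 4 * C * b := by field_simp
    have e2 : a ^ s = a ^ (s - 1) * a := by
      rw [← Real.rpow_add_one ha.ne']; congr 1; ring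
    rw [e1] at h2
    refine le_trans (le_of_eq ?_) h2
    rw [e2]; field_simp
  have h2 := Real.add_rpow_le_rpow_add ha.le h4 hs
  have h3 : C * b ^ s * 4 ≤ (4 * C * b) ^ s := by
    rw [Real.mul_rpow (by positivity) hb]
    have : 4 * C ≤ (4 * C) ^ s := by
      conv_lhs => rw [← Real.rpow_one (4 * C)]
      exact Real.rpow_le_rpow_of_exponent_le (by linarith) hs
    have hbs : 0 ≤ b ^ s := Real.rpow_nonneg hb s
    nlinarith
  have hbs : 0 ≤ b ^ s := Real.rpow_nonneg hb s
  have hab : 0 ≤ a ^ (s - 1) * b := mul_nonneg (Real.rpow_nonneg ha.le _) hb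
  have h5 : C * (a ^ (s - 1) * b) * 4 ≤ s * (a ^ (s - 1) * (4 * C * b)) := by
    have : s * (a ^ (s - 1) * (4 * C * b)) = s * (C * (a ^ (s - 1) * b) * 4) := by ring
    rw [this]
    exact le_mul_of_one_le_left (by positivity) hs
  have h6 : 0 ≤ C * (a ^ (s - 1) * b) := by positivity
  have h7 : 0 ≤ C * b ^ s := by positivity
  nlinarith

/-! ### Orthogonal increments in `L^q` and polynomials in independent variables -/

section Moments

variable {Ω : Type*} [MeasurableSpace Ω] {P : Measure Ω}

/-- `X` is in `L^q` with `‖X‖_q ^ 2 ≤ v`. -/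
def MomentBound (P : Measure Ω) (q : ℝ) (X : Ω → ℝ) (v : ℝ) : Prop :=
  MemLp X (ENNReal.ofReal q) P ∧ ∫ ω, |X ω| ^ q ∂P ≤ v ^ (q / 2)

theorem integrable_abs_rpow {q : ℝ} (hq : 0 < q) {X : Ω → ℝ} (h : MemLp X (ENNReal.ofReal q) P) :
    Integrable (fun ω => |X ω| ^ q) P := by
  have := h.integrable_norm_rpow (by simpa using hq) ENNReal.ofReal_ne_top
  rwa [ENNReal.toReal_ofReal hq.le] at this

theorem memLp_of_integrable_abs_rpow {q : ℝ} (hq : 0 < q) {X : Ω → ℝ}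
    (hX : AEStronglyMeasurable X P) (h : Integrable (fun ω => |X ω| ^ q) P) :
    MemLp X (ENNReal.ofReal q) P := by
  rw [← integrable_norm_rpow_iff hX (by simpa using hq) ENNReal.ofReal_ne_top,
    ENNReal.toReal_ofReal hq.le]
  exact h

theorem rpow_sub_two_mul_le {q : ℝ} (hq : 2 ≤ q) (x y : ℝ) :
    |(|x| ^ (q - 2) * x) * y| ≤ |x| ^ q + |y| ^ q := by
  have hq0 : 0 ≤ q := by linarith
  have e : ∀ z : ℝ, |z| ^ (q - 2) * |z| * |z| = |z| ^ q := by
    intro z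
    by_cases hz : z = 0
    · subst hz; simp [Real.zero_rpow (by linarith : q ≠ 0)]
    · rw [← Real.rpow_add_one (abs_pos.2 hz).ne', ← Real.rpow_add_one (abs_pos.2 hz).ne']
      congr 1; ring
  rw [abs_mul, abs_mul, abs_of_nonneg (Real.rpow_nonneg (abs_nonneg x) _)]
  have hx : 0 ≤ |x| ^ q := Real.rpow_nonneg (abs_nonneg _) _
  have hy : 0 ≤ |y| ^ q := Real.rpow_nonneg (abs_nonneg _) _
  rcases le_total |y| |x| with h | h
  · have := mul_le_mul_of_nonneg_left h
      (mul_nonneg (Real.rpow_nonneg (abs_nonneg x) (q - 2)) (abs_nonneg x))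
    rw [e] at this
    linarith
  · have h1 : |x| ^ (q - 2) * |x| * |y| ≤ |y| ^ (q - 2) * |y| * |y| := by
      have := Real.rpow_le_rpow (abs_nonneg x) h (by linarith : 0 ≤ q - 2)
      have h0 : 0 ≤ |y| ^ (q - 2) := Real.rpow_nonneg (abs_nonneg _) _
      gcongr
    rw [e] at h1
    linarith

/-- Orthogonality kills the linear term of `|X + Y| ^ q`, so the increase is of second order:
squared norms add up, with constant `1` on `X`. That constant is what allows the inequality to be
iterated over arbitrarily many sites. -/
theorem MomentBound.add_of_orthogonal {q : ℝ} (hq : 2 ≤ q) {X Y : Ω → ℝ} {a b : ℝ}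
    (ha : 0 ≤ a) (hb : 0 ≤ b) (hX : MomentBound P q X a) (hY : MomentBound P q Y b)
    (horth : ∫ ω, (|X ω| ^ (q - 2) * X ω) * Y ω ∂P = 0) :
    MomentBound P q (X + Y) (a + 4 * smoothConst q * b) := by
  have hq0 : 0 < q := by linarith
  have hC := one_le_smoothConst hq
  refine ⟨hX.1.add hY.1, ?_⟩
  have iX := integrable_abs_rpow hq0 hX.1
  have iY := integrable_abs_rpow hq0 hY.1
  have hmX := hX.1.aestronglyMeasurable
  have hmY := hY.1.aestronglyMeasurable
  have iXY := integrable_abs_rpow hq0 (hX.1.add hY.1)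
  have iO : Integrable (fun ω => (|X ω| ^ (q - 2) * X ω) * Y ω) P := by
    refine (iX.add iY).mono' ?_ (ae_of_all _ fun ω => rpow_sub_two_mul_le hq _ _)
    refine AEStronglyMeasurable.mul (AEStronglyMeasurable.mul ?_ hmX) hmY
    exact (hmX.aemeasurable.abs.pow_const _).aestronglyMeasurable
  -- `a` or `b` may vanish, whereas the mean inequality divides by powers of them. Both are enlarged
  -- by `δ`, which tends to `0` at the end.
  have main : ∀ δ : ℝ, 0 < δ → ∫ ω, |(X + Y) ω| ^ q ∂P
      ≤ ((a + δ) + 4 * smoothConst q * (b + δ)) ^ (q / 2) := by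
    intro δ hδ
    have ha' : 0 < a + δ := by linarith
    have hb' : 0 < b + δ := by linarith
    set A := (a + δ) ^ (q / 2)
    set B := (b + δ) ^ (q / 2)
    have hA : 0 < A := Real.rpow_pos_of_pos ha' _
    have hB : 0 < B := Real.rpow_pos_of_pos hb' _
    have hXA : ∫ ω, |X ω| ^ q ∂P ≤ A :=
      hX.2.trans (Real.rpow_le_rpow ha (by linarith) (by linarith))
    have hYB : ∫ ω, |Y ω| ^ q ∂P ≤ B :=
      hY.2.trans (Real.rpow_le_rpow hb (by linarith) (by linarith))
    set D := (a + δ) ^ (q / 2 - 1) * (b + δ)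
    have hD : 0 ≤ D := mul_nonneg (Real.rpow_nonneg ha'.le _) hb'.le
    have hpt : ∀ ω, |(X + Y) ω| ^ q ≤ |X ω| ^ q + q * ((|X ω| ^ (q - 2) * X ω) * Y ω)
        + smoothConst q * (D * ((q - 2) / q * (|X ω| ^ q / A) + 2 / q * (|Y ω| ^ q / B))
          + |Y ω| ^ q) := by
      intro ω
      refine (abs_add_rpow_le hq (X ω) (Y ω)).trans ?_
      have := rpow_mul_sq_le hq ha' hb' (X ω) (Y ω)
      have := mul_le_mul_of_nonneg_left this (by linarith : 0 ≤ smoothConst q)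
      linarith
    have i1 : Integrable (fun ω => (q - 2) / q * (|X ω| ^ q / A) + 2 / q * (|Y ω| ^ q / B)) P :=
      ((iX.div_const A).const_mul _).add ((iY.div_const B).const_mul _)
    have i2 : Integrable (fun ω => D * ((q - 2) / q * (|X ω| ^ q / A) + 2 / q * (|Y ω| ^ q / B))
          + |Y ω| ^ q) P := (i1.const_mul D).add iY
    have i3 : Integrable (fun ω => |X ω| ^ q + q * ((|X ω| ^ (q - 2) * X ω) * Y ω)) P :=
      iX.add (iO.const_mul q)
    refine (integral_mono iXY (i3.add (i2.const_mul (smoothConst q))) hpt).trans ?_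
    simp only [Pi.add_apply]
    rw [integral_add i3 (i2.const_mul _), integral_add iX (iO.const_mul q), integral_const_mul,
      horth, integral_const_mul, integral_add (i1.const_mul D) iY, integral_const_mul,
      integral_add ((iX.div_const A).const_mul _) ((iY.div_const B).const_mul _),
      integral_const_mul, integral_const_mul, integral_div, integral_div]
    have h1 : (q - 2) / q * ((∫ ω, |X ω| ^ q ∂P) / A) + 2 / q * ((∫ ω, |Y ω| ^ q ∂P) / B) ≤ 1 := by
      have e1 : (∫ ω, |X ω| ^ q ∂P) / A ≤ 1 := (div_le_one hA).2 hXA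
      have e2 : (∫ ω, |Y ω| ^ q ∂P) / B ≤ 1 := (div_le_one hB).2 hYB
      have e3 : (q - 2) / q + 2 / q = 1 := by field_simp; ring
      have e4 : 0 ≤ (q - 2) / q := div_nonneg (by linarith) hq0.le
      have e5 : 0 ≤ 2 / q := by positivity
      nlinarith
    have h2 := mul_le_mul_of_nonneg_left h1 hD
    have h3 := rpow_add_le_of_smooth (s := q / 2) (by linarith) hC ha' hb'.le
    refine le_trans ?_ h3
    have h4 := mul_le_mul_of_nonneg_left (add_le_add h2 hYB) (by linarith : 0 ≤ smoothConst q)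
    rw [mul_one] at h4
    simp only [mul_zero, add_zero]
    linarith
  have hcont : Tendsto (fun δ : ℝ => ((a + δ) + 4 * smoothConst q * (b + δ)) ^ (q / 2)) (𝓝[>] 0)
      (𝓝 (((a + 0) + 4 * smoothConst q * (b + 0)) ^ (q / 2))) := by
    refine Tendsto.mono_left ?_ nhdsWithin_le_nhds
    refine Continuous.tendsto (f := fun δ : ℝ =>
      ((a + δ) + 4 * smoothConst q * (b + δ)) ^ (q / 2)) ?_ 0
    exact Continuous.rpow_const (by fun_prop) fun _ => Or.inr (by linarith)
  rw [add_zero, add_zero] at hcont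
  exact ge_of_tendsto hcont (eventually_nhdsWithin_of_forall fun δ hδ => main δ hδ)

theorem MomentBound.mul_of_indepFun {q : ℝ} (hq : 2 ≤ q) {X Y : Ω → ℝ} {a b : ℝ}
    (ha : 0 ≤ a) (hb : 0 ≤ b) (hX : MomentBound P q X a) (hY : MomentBound P q Y b)
    (h : IndepFun X Y P) : MomentBound P q (fun ω => X ω * Y ω) (a * b) := by
  have hq0 : 0 < q := by linarith
  have iX := integrable_abs_rpow hq0 hX.1
  have iY := integrable_abs_rpow hq0 hY.1
  have hφ : Measurable (fun x : ℝ => |x| ^ q) := by fun_prop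
  have hi : IndepFun (fun ω => |X ω| ^ q) (fun ω => |Y ω| ^ q) P := h.comp hφ hφ
  have e : (fun ω => |X ω * Y ω| ^ q) = (fun ω => |X ω| ^ q) * (fun ω => |Y ω| ^ q) := by
    funext ω; simp only [Pi.mul_apply]
    rw [abs_mul, Real.mul_rpow (abs_nonneg _) (abs_nonneg _)]
  refine ⟨memLp_of_integrable_abs_rpow hq0 (hX.1.aestronglyMeasurable.mul
    hY.1.aestronglyMeasurable) ?_, ?_⟩
  · rw [e]; exact hi.integrable_mul iX iY
  · rw [e, hi.integral_mul_eq_mul_integral iX.aestronglyMeasurable iY.aestronglyMeasurable,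
      Real.mul_rpow ha hb]
    exact mul_le_mul hX.2 hY.2 (integral_nonneg fun ω => Real.rpow_nonneg (abs_nonneg _) _)
      (Real.rpow_nonneg ha _)

/-- A crude triangle inequality. It is used only to add the few types at one site, so the power of
the cardinality enters a constant and not a count of sites. -/
theorem MomentBound.sum {q : ℝ} (hq : 2 ≤ q) {ι : Type*} (s : Finset ι) {Y : ι → Ω → ℝ} {v : ι → ℝ}
    (hv : ∀ i ∈ s, 0 ≤ v i) (hY : ∀ i ∈ s, MomentBound P q (Y i) (v i)) :
    MomentBound P q (fun ω => ∑ i ∈ s, Y i ω) (s.card ^ 2 * ∑ i ∈ s, v i) := by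
  have hq0 : 0 < q := by linarith
  have hm : MemLp (fun ω => ∑ i ∈ s, Y i ω) (ENNReal.ofReal q) P :=
    memLp_finsetSum s fun i hi => (hY i hi).1
  refine ⟨hm, ?_⟩
  have hV : 0 ≤ ∑ i ∈ s, v i := Finset.sum_nonneg hv
  have i1 : ∀ i ∈ s, Integrable (fun ω => |Y i ω| ^ q) P :=
    fun i hi => integrable_abs_rpow hq0 (hY i hi).1
  have hpt : ∀ ω, |∑ i ∈ s, Y i ω| ^ q ≤ (s.card : ℝ) ^ (q - 1) * ∑ i ∈ s, |Y i ω| ^ q := fun ω =>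
    (Real.rpow_le_rpow (abs_nonneg _) (Finset.abs_sum_le_sum_abs _ _) hq0.le).trans
      (Real.rpow_sum_le_const_mul_sum_rpow s _ (by linarith))
  refine (integral_mono (integrable_abs_rpow hq0 hm)
    ((integrable_finsetSum s i1).const_mul _) hpt).trans ?_
  rw [integral_const_mul, integral_finsetSum s i1]
  have h1 : ∑ i ∈ s, ∫ ω, |Y i ω| ^ q ∂P ≤ s.card * (∑ i ∈ s, v i) ^ (q / 2) := by
    rw [← nsmul_eq_mul]
    refine Finset.sum_le_card_nsmul s _ _ fun i hi => (hY i hi).2.trans ?_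
    exact Real.rpow_le_rpow (hv i hi) (Finset.single_le_sum hv hi) (by linarith)
  refine (mul_le_mul_of_nonneg_left h1 (Real.rpow_nonneg (Nat.cast_nonneg _) _)).trans ?_
  rw [Real.mul_rpow (by positivity) hV, ← mul_assoc]
  refine mul_le_mul_of_nonneg_right (le_of_eq ?_) (Real.rpow_nonneg hV _)
  rw [← Real.rpow_natCast, ← Real.rpow_mul (Nat.cast_nonneg _)]
  rcases Nat.eq_zero_or_pos s.card with h | h
  · rw [h]
    rw [Nat.cast_zero, mul_zero, Real.zero_rpow (by push_cast; linarith)]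
  · rw [← Real.rpow_add_one (by positivity)]
    congr 1; push_cast; ring

theorem MomentBound.mono {q : ℝ} (hq : 0 ≤ q) {X : Ω → ℝ} {a b : ℝ} (ha : 0 ≤ a) (hab : a ≤ b)
    (hX : MomentBound P q X a) : MomentBound P q X b :=
  ⟨hX.1, hX.2.trans (Real.rpow_le_rpow ha hab (by linarith))⟩

/-- The polynomial with coefficients `a` in the site variables `X j t`. -/
def sitePoly {β : Type*} [Fintype β] (X : ℕ → β → Ω → ℝ) (n : ℕ) (a : (Fin n → β) → ℝ) (ω : Ω) :
    ℝ := ∑ τ, a τ * ∏ j : Fin n, X j (τ j) ω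

omit [MeasurableSpace Ω] in
theorem sitePoly_succ {β : Type*} [Fintype β] (X : ℕ → β → Ω → ℝ) (n : ℕ)
    (a : (Fin (n + 1) → β) → ℝ) (ω : Ω) :
    sitePoly X (n + 1) a ω = ∑ b, X n b ω
      * sitePoly X n (fun τ => a (Fin.snoc (α := fun _ => β) τ b)) ω := by
  unfold sitePoly
  rw [sum_fin_snoc]
  refine Finset.sum_congr rfl fun b _ => ?_
  rw [Finset.mul_sum]
  refine Finset.sum_congr rfl fun τ _ => ?_
  rw [Fin.prod_univ_castSucc]
  simp only [Fin.snoc_castSucc, Fin.snoc_last, Fin.val_castSucc, Fin.val_last]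
  ring

theorem measurable_sitePoly {β : Type*} [Fintype β] {X : ℕ → β → Ω → ℝ}
    (hX : ∀ j b, Measurable (X j b)) (n : ℕ) (a : (Fin n → β) → ℝ) :
    Measurable (sitePoly X n a) := by
  unfold sitePoly; fun_prop

theorem indepFun_sitePoly {β : Type*} [Fintype β] {X : ℕ → β → Ω → ℝ}
    (hX : ∀ j b, Measurable (X j b)) (hind : iIndepFun (fun j ω b => X j b ω) P) (n : ℕ) (b : β) :
    IndepFun (X n b) (fun ω (a : (Fin n → β) → ℝ) => sitePoly X n a ω) P := by
  have h := hind.indepFun_finset {n} (Finset.range n) (by simp)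
    (fun j => measurable_pi_lambda _ fun b => hX j b)
  have h2 := h.comp (φ := fun x : (({n} : Finset ℕ) → β → ℝ) => x ⟨n, by simp⟩ b)
    (ψ := fun (x : (Finset.range n → β → ℝ)) (a : (Fin n → β) → ℝ) =>
      ∑ τ, a τ * ∏ j : Fin n, x ⟨j, Finset.mem_range.2 j.2⟩ (τ j))
    (by fun_prop) (measurable_pi_lambda _ fun a => by fun_prop)
  exact h2

/-- Polynomials in independent centred site variables, with bounded moments of order `q`, have
moments of order `q` controlled by the weighted sum of squares of the coefficients. -/
theorem momentBound_sitePoly [IsProbabilityMeasure P] {β : Type*} [Fintype β] [DecidableEq β] (o : β)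
    {q m : ℝ} (hq : 2 ≤ q) (hm : 0 ≤ m) {X : ℕ → β → Ω → ℝ} (hX : ∀ j b, Measurable (X j b))
    (hind : iIndepFun (fun j ω b => X j b ω) P) (ho : ∀ j ω, X j o ω = 1)
    (hmean : ∀ j b, b ≠ o → ∫ ω, X j b ω ∂P = 0)
    (hmom : ∀ j b, b ≠ o → MomentBound P q (X j b) m) (n : ℕ) (a : (Fin n → β) → ℝ) :
    MomentBound P q (sitePoly X n a) (∑ τ, a τ ^ 2 * ∏ j : Fin n,
      if τ j = o then 1 else 4 * smoothConst q * ((Fintype.card β) ^ 2 * m)) := by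
  have hq0 : 0 < q := by linarith
  have hC := one_le_smoothConst hq
  set L := 4 * smoothConst q * ((Fintype.card β : ℝ) ^ 2 * m) with hL
  have hL0 : 0 ≤ L := by positivity
  have hwt : ∀ (n : ℕ) (a : (Fin n → β) → ℝ), 0 ≤ ∑ τ, a τ ^ 2 * ∏ j : Fin n,
      if τ j = o then 1 else L := fun n a => Finset.sum_nonneg fun τ _ =>
    mul_nonneg (sq_nonneg _) (Finset.prod_nonneg fun j _ => by split_ifs <;> linarith)
  induction n with
  | zero =>
    have : sitePoly X 0 a = fun _ : Ω => a Fin.elim0 := by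
      funext ω; unfold sitePoly; simp [Subsingleton.elim default (Fin.elim0 : Fin 0 → β)]
    rw [this]
    refine ⟨memLp_const _, ?_⟩
    simp [Subsingleton.elim default (Fin.elim0 : Fin 0 → β)]
    rw [← sq_abs, ← Real.rpow_natCast, ← Real.rpow_mul (abs_nonneg _)]
    apply le_of_eq; congr 1; push_cast; ring
  | succ n ih =>
    set F : β → Ω → ℝ := fun b => sitePoly X n (fun τ => a (Fin.snoc (α := fun _ => β) τ b)) with hF
    set v : β → ℝ := fun b => ∑ τ : Fin n → β, a (Fin.snoc (α := fun _ => β) τ b) ^ 2 *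
      ∏ j : Fin n, if τ j = o then 1 else L with hv
    have hv0 : ∀ b, 0 ≤ v b := fun b => hwt n _
    have hFb : ∀ b, MomentBound P q (F b) (v b) := fun b => ih _
    have hYb : ∀ b ∈ Finset.univ.erase o, MomentBound P q (fun ω => X n b ω * F b ω) (m * v b) := by
      intro b hb
      refine MomentBound.mul_of_indepFun hq hm (hv0 b) (hmom n b (Finset.ne_of_mem_erase hb)) (hFb b)
        ?_
      exact (indepFun_sitePoly hX hind n b).comp measurable_id (measurable_pi_apply _)
    have hY := MomentBound.sum hq (Finset.univ.erase o) (fun b _ => mul_nonneg hm (hv0 b)) hYb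
    have hY' : MomentBound P q (fun ω => ∑ b ∈ Finset.univ.erase o, X n b ω * F b ω)
        ((Fintype.card β) ^ 2 * ∑ b ∈ Finset.univ.erase o, m * v b) := by
      refine hY.mono hq0.le (mul_nonneg (sq_nonneg _) (Finset.sum_nonneg fun b _ =>
        mul_nonneg hm (hv0 b))) (mul_le_mul_of_nonneg_right ?_ (Finset.sum_nonneg fun b _ =>
        mul_nonneg hm (hv0 b)))
      refine pow_le_pow_left₀ (Nat.cast_nonneg _) ?_ 2
      exact_mod_cast Finset.card_le_univ _
    -- The variables of the last site are independent of all functions of the earlier sites, and `X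
    -- n b` is centred for `b ≠ o`.
    have horth : ∫ ω, (|F o ω| ^ (q - 2) * F o ω) * (∑ b ∈ Finset.univ.erase o, X n b ω * F b ω) ∂P
        = 0 := by
      simp_rw [Finset.mul_sum]
      rw [integral_finsetSum]
      · refine Finset.sum_eq_zero fun b hb => ?_
        have hi : IndepFun (X n b) (fun ω => (|F o ω| ^ (q - 2) * F o ω) * F b ω) P := by
          refine (indepFun_sitePoly hX hind n b).comp measurable_id
            (ψ := fun y => (|y (fun τ => a (Fin.snoc (α := fun _ => β) τ o))| ^ (q - 2)
              * y (fun τ => a (Fin.snoc (α := fun _ => β) τ o)))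
              * y (fun τ => a (Fin.snoc (α := fun _ => β) τ b))) ?_
          fun_prop
        have e := hi.integral_fun_mul_eq_mul_integral (hX n b).aestronglyMeasurable (by
          refine Measurable.aestronglyMeasurable ?_
          have := measurable_sitePoly hX n (fun τ => a (Fin.snoc (α := fun _ => β) τ o))
          have := measurable_sitePoly hX n (fun τ => a (Fin.snoc (α := fun _ => β) τ b))
          simp only [hF]; fun_prop)
        rw [hmean n b (Finset.ne_of_mem_erase hb), zero_mul] at e
        rw [← e]
        exact integral_congr_ae (ae_of_all _ fun ω => by ring)
      · intro b hb
        refine ((integrable_abs_rpow hq0 (hFb o).1).add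
          (integrable_abs_rpow hq0 (hYb b hb).1)).mono' ?_
          (ae_of_all _ fun ω => rpow_sub_two_mul_le hq _ _)
        have h1 := measurable_sitePoly hX n (fun τ => a (Fin.snoc (α := fun _ => β) τ o))
        have h2 := measurable_sitePoly hX n (fun τ => a (Fin.snoc (α := fun _ => β) τ b))
        have h3 := hX n b
        refine Measurable.aestronglyMeasurable ?_
        simp only [hF]; fun_prop
    have key := MomentBound.add_of_orthogonal hq (hv0 o) (mul_nonneg (sq_nonneg _)
      (Finset.sum_nonneg fun b _ => mul_nonneg hm (hv0 b))) (hFb o) hY' horth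
    have e1 : sitePoly X (n + 1) a = F o + fun ω => ∑ b ∈ Finset.univ.erase o, X n b ω * F b ω := by
      funext ω
      rw [sitePoly_succ, Pi.add_apply, ← Finset.add_sum_erase _ _ (Finset.mem_univ o), ho, one_mul]
    have e2 : ∑ τ, a τ ^ 2 * ∏ j : Fin (n + 1), (if τ j = o then 1 else L)
        = v o + 4 * smoothConst q * ((Fintype.card β) ^ 2 * ∑ b ∈ Finset.univ.erase o, m * v b) := by
      rw [sum_fin_snoc]
      simp only [Fin.prod_univ_castSucc, Fin.snoc_castSucc, Fin.snoc_last]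
      rw [← Finset.add_sum_erase _ _ (Finset.mem_univ o)]
      congr 1
      · simp [hv]
      · have e3 : 4 * smoothConst q * ((Fintype.card β) ^ 2 * ∑ b ∈ Finset.univ.erase o, m * v b)
            = L * ∑ b ∈ Finset.univ.erase o, v b := by
          rw [← Finset.mul_sum, hL]; ring
        rw [e3, Finset.mul_sum]
        refine Finset.sum_congr rfl fun b hb => ?_
        rw [if_neg (Finset.ne_of_mem_erase hb), Finset.mul_sum]
        exact Finset.sum_congr rfl fun τ _ => by ring
    rw [e1, e2]
    exact key

end Moments

/-! ### Expansion of the covariance in the site variables -/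

section Sites

variable {Ω : Type*} [MeasurableSpace Ω] {P : Measure Ω}

/-- The variables `1, Z_j, Z_j ^ 2 - 1, ξ_j` at the site `j`. -/
def siteVar (Z ξ : ℕ → Ω → ℝ) (j : ℕ) (t : Fin 4) (ω : Ω) : ℝ :=
  ![1, Z j ω, Z j ω ^ 2 - 1, ξ j ω] t

/-- The multilinear polynomial with coefficients `f`. -/
def mlin (Z : ℕ → Ω → ℝ) (n : ℕ) (f : (Fin n → Bool) → ℝ) (ω : Ω) : ℝ :=
  ∑ A, f A * ∏ j : Fin n, if A j then Z j ω else 1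

/-- The partial derivative of `mlin Z n f` at the site `k`. -/
def dlin (Z : ℕ → Ω → ℝ) (n : ℕ) (f : (Fin n → Bool) → ℝ) (k : Fin n) (ω : Ω) : ℝ :=
  ∑ A, restr f k A * ∏ j : Fin n, if A j = true ∧ j ≠ k then Z j ω else 1

omit [MeasurableSpace Ω] in
theorem mul_eq_sum_linkW (Z ξ : ℕ → Ω → ℝ) (j : ℕ) (x y : Bool) (ω : Ω) :
    (if x then Z j ω else 1) * (if y then Z j ω else 1)
      = ∑ t, linkW x y t * siteVar Z ξ j t ω := by
  rw [Fin.sum_univ_four]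
  cases x <;> cases y <;> simp [linkW, siteVar]
  ring

omit [MeasurableSpace Ω] in
theorem mlin_sq (Z ξ : ℕ → Ω → ℝ) (n : ℕ) (f : (Fin n → Bool) → ℝ) (ω : Ω) :
    mlin Z n f ω ^ 2 = sitePoly (siteVar Z ξ) n (linkForm f f) ω := by
  unfold mlin sitePoly linkForm
  rw [sq, Finset.sum_mul_sum]
  simp_rw [Finset.sum_mul]
  rw [Finset.sum_comm (s := Finset.univ (α := Fin n → Fin 4))]
  refine Finset.sum_congr rfl fun A _ => ?_
  rw [Finset.sum_comm (s := Finset.univ (α := Fin n → Fin 4))]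
  refine Finset.sum_congr rfl fun B _ => ?_
  have h : (∏ j : Fin n, if A j = true then Z j ω else 1)
      * (∏ j : Fin n, if B j = true then Z j ω else 1)
      = ∑ τ : Fin n → Fin 4, ∏ j, linkW (A j) (B j) (τ j) * siteVar Z ξ j (τ j) ω := by
    rw [sum_prod_eq (fun j t => linkW (A j) (B j) t * siteVar Z ξ j t ω),
      ← Finset.prod_mul_distrib]
    exact Finset.prod_congr rfl fun j _ => mul_eq_sum_linkW Z ξ j _ _ ω
  rw [mul_mul_mul_comm, h, Finset.mul_sum]
  refine Finset.sum_congr rfl fun τ _ => ?_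
  rw [Finset.prod_mul_distrib]; ring

omit [MeasurableSpace Ω] in
theorem dlin_sq (Z ξ : ℕ → Ω → ℝ) (n : ℕ) (f : (Fin n → Bool) → ℝ) (k : Fin n) (ω : Ω) :
    dlin Z n f k ω ^ 2 = sitePoly (siteVar Z ξ) n (siteCoeff f k) ω := by
  unfold dlin sitePoly
  simp_rw [siteCoeff_eq_sum]
  rw [sq, Finset.sum_mul_sum]
  simp_rw [Finset.sum_mul]
  rw [Finset.sum_comm (s := Finset.univ (α := Fin n → Fin 4))]
  refine Finset.sum_congr rfl fun A _ => ?_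
  rw [Finset.sum_comm (s := Finset.univ (α := Fin n → Fin 4))]
  refine Finset.sum_congr rfl fun B _ => ?_
  by_cases hAB : A k = true ∧ B k = true
  swap
  · have : restr f k A * restr f k B = 0 := by
      unfold restr
      by_cases hA : A k = true
      · have hB : ¬ B k = true := fun h => hAB ⟨hA, h⟩
        simp [hB]
      · simp [hA]
    rw [mul_mul_mul_comm, this, zero_mul]
    symm
    refine Finset.sum_eq_zero fun τ _ => ?_
    rw [if_neg (by tauto)]; ring
  have h : (∏ j : Fin n, if A j = true ∧ j ≠ k then Z j ω else 1)
      * (∏ j : Fin n, if B j = true ∧ j ≠ k then Z j ω else 1)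
      = ∑ τ : Fin n → Fin 4, ∏ j, (if j = k then (if τ j = 0 then 1 else 0)
        else linkW (A j) (B j) (τ j)) * siteVar Z ξ j (τ j) ω := by
    rw [sum_prod_eq (fun j t => (if j = k then (if t = 0 then 1 else 0)
        else linkW (A j) (B j) t) * siteVar Z ξ j t ω),
      ← Finset.prod_mul_distrib]
    refine Finset.prod_congr rfl fun j _ => ?_
    by_cases hj : j = k
    · simp [hj, siteVar]
    · simp only [hj, ne_eq, not_false_eq_true, and_true, if_false]
      exact mul_eq_sum_linkW Z ξ j _ _ ω
  rw [mul_mul_mul_comm, h, Finset.mul_sum]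
  refine Finset.sum_congr rfl fun τ _ => ?_
  rw [Finset.prod_mul_distrib]
  have e : ∏ j, (if j = k then (if τ j = 0 then (1 : ℝ) else 0) else linkW (A j) (B j) (τ j))
      = (if A k = true ∧ B k = true ∧ τ k = 0 then 1 else 0) * ∏ j, linkW (A j) (B j) (τ j) := by
    by_cases hτ : τ k = 0
    · rw [if_pos ⟨hAB.1, hAB.2, hτ⟩, one_mul]
      refine Finset.prod_congr rfl fun j _ => ?_
      by_cases hj : j = k
      · subst hj; simp [hτ, hAB.1, hAB.2, linkW]
      · simp [hj]
    · rw [if_neg (by tauto), zero_mul]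
      exact Finset.prod_eq_zero (Finset.mem_univ k) (by simp [hτ])
  rw [e]
  simp only [restr, hAB.1, hAB.2, if_true]
  ring

omit [MeasurableSpace Ω] in
theorem sum_dlin_sq (Z ξ : ℕ → Ω → ℝ) (n : ℕ) (f : (Fin n → Bool) → ℝ) (ω : Ω) :
    ∑ k, dlin Z n f k ω ^ 2 = sitePoly (siteVar Z ξ) n (covCoeff f) ω := by
  simp_rw [dlin_sq Z ξ]
  unfold sitePoly covCoeff
  rw [Finset.sum_comm]
  exact Finset.sum_congr rfl fun τ _ => by rw [Finset.sum_mul]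

/-- The coefficients of `∑ k, ξ_k (∑ A ∋ k, f(A) Z_{A - k}) ^ 2`. -/
def chiCoeff {n : ℕ} (f : (Fin n → Bool) → ℝ) (τ : Fin n → Fin 4) : ℝ :=
  ∑ k, if τ k = 3 then siteCoeff f k (Function.update τ k 0) else 0

/-- A change of variables at the single site `k`. It trades the type of `ξ_k` for the trivial type,
and later a site of a set for its absence. -/
theorem sum_update_eq {n : ℕ} {β : Type*} [Fintype β] [DecidableEq β] (k : Fin n) (b o : β)
    (G : (Fin n → β) → ℝ) :
    ∑ τ : Fin n → β, (if τ k = b then G (Function.update τ k o) else 0)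
      = ∑ τ : Fin n → β, if τ k = o then G τ else 0 := by
  rw [← Finset.sum_filter, ← Finset.sum_filter]
  refine Finset.sum_bij' (fun τ _ => Function.update τ k o) (fun τ _ => Function.update τ k b)
    (by simp) (by simp) ?_ ?_ (by simp)
  · intro τ hτ
    simp only [Finset.mem_filter, Finset.mem_univ, true_and] at hτ
    simp [← hτ]
  · intro τ hτ
    simp only [Finset.mem_filter, Finset.mem_univ, true_and] at hτ
    simp [← hτ]

omit [MeasurableSpace Ω] in
theorem sum_chi_dlin_sq (Z ξ : ℕ → Ω → ℝ) (n : ℕ) (f : (Fin n → Bool) → ℝ) (ω : Ω) :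
    ∑ k : Fin n, ξ k ω * dlin Z n f k ω ^ 2 = sitePoly (siteVar Z ξ) n (chiCoeff f) ω := by
  simp_rw [dlin_sq Z ξ]
  unfold sitePoly chiCoeff
  simp_rw [Finset.sum_mul]
  rw [Finset.sum_comm]
  refine Finset.sum_congr rfl fun k _ => ?_
  have h := sum_update_eq (n := n) k (3 : Fin 4) 0 (fun τ => siteCoeff f k τ
    * ∏ j : Fin n, siteVar Z ξ j (Function.update τ k 3 j) ω)
  have e1 : ∀ τ : Fin n → Fin 4, (if τ k = 3 then siteCoeff f k (Function.update τ k 0) *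
      ∏ j : Fin n, siteVar Z ξ j (Function.update (Function.update τ k 0) k 3 j) ω else 0)
      = (if τ k = 3 then siteCoeff f k (Function.update τ k 0) else 0)
        * ∏ j : Fin n, siteVar Z ξ j (τ j) ω := by
    intro τ
    by_cases hτ : τ k = 3
    · simp only [hτ, if_true]
      congr 1
      rw [Function.update_idem, ← hτ, Function.update_eq_self]
    · simp [hτ]
  rw [Finset.sum_congr rfl fun τ _ => e1 τ] at h
  rw [h, Finset.mul_sum]
  refine Finset.sum_congr rfl fun τ _ => ?_
  by_cases hτ : τ k = 0
  · rw [if_pos hτ, ← Finset.mul_prod_erase _ _ (Finset.mem_univ k),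
      ← Finset.mul_prod_erase _ _ (Finset.mem_univ k)]
    have : ∏ x ∈ Finset.univ.erase k, siteVar Z ξ x (Function.update τ k 3 x) ω
        = ∏ x ∈ Finset.univ.erase k, siteVar Z ξ x (τ x) ω :=
      Finset.prod_congr rfl fun x hx => by
        rw [Function.update_of_ne (Finset.ne_of_mem_erase hx)]
    rw [this, Function.update_self, hτ]
    simp [siteVar]; ring
  · simp [hτ, siteCoeff]

theorem sum_chiCoeff_sq_le {L : ℝ} (hL : 0 ≤ L) {n : ℕ} (f : (Fin n → Bool) → ℝ) :
    ∑ τ, (∏ j, typeWt L (τ j)) * chiCoeff f τ ^ 2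
      ≤ L * ∑ k, wSq (2 * L + 1) (restr f k) ^ 2 := by
  have hw : ∀ τ : Fin n → Fin 4, 0 ≤ ∏ j, typeWt L (τ j) :=
    fun τ => Finset.prod_nonneg fun j _ => typeWt_nonneg hL _
  have h1 : ∀ τ : Fin n → Fin 4, chiCoeff f τ ^ 2
      ≤ ∑ k, if τ k = 3 then siteCoeff f k (Function.update τ k 0) ^ 2 else 0 := by
    intro τ
    have hnn : ∀ k ∈ Finset.univ,
        (0 : ℝ) ≤ if τ k = 3 then siteCoeff f k (Function.update τ k 0) ^ 2 else 0 :=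
      fun k _ => by split_ifs <;> positivity
    by_cases hz : chiCoeff f τ = 0
    · rw [hz]; simpa using Finset.sum_nonneg hnn
    obtain ⟨k, -, hk⟩ := Finset.exists_ne_zero_of_sum_ne_zero hz
    have hk3 : τ k = 3 := by by_contra h; simp [h] at hk
    have hk0 : siteCoeff f k (Function.update τ k 0) ≠ 0 := by simpa [hk3] using hk
    -- `siteCoeff` vanishes as soon as a type `3` remains, so at most one term of `chiCoeff` is
    -- nonzero and squaring creates no cross terms.
    have huniq : ∀ i, i ≠ k → τ i ≠ 3 := by
      intro i hi h3
      exact hk0 (siteCoeff_eq_zero (j := i) (by rw [Function.update_of_ne hi]; exact h3))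
    have e : chiCoeff f τ = siteCoeff f k (Function.update τ k 0) := by
      unfold chiCoeff
      rw [Finset.sum_eq_single k (fun i _ hi => by simp [huniq i hi]) (by simp)]
      simp [hk3]
    rw [e]
    have := Finset.single_le_sum hnn (Finset.mem_univ k)
    simpa [hk3] using this
  calc _ ≤ ∑ τ : Fin n → Fin 4, ∑ k, (if τ k = 3 then L * ((∏ j, typeWt L
          (Function.update τ k 0 j)) * siteCoeff f k (Function.update τ k 0) ^ 2) else 0) := by
        refine Finset.sum_le_sum fun τ _ => ?_
        refine (mul_le_mul_of_nonneg_left (h1 τ) (hw τ)).trans (le_of_eq ?_)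
        rw [Finset.mul_sum]
        refine Finset.sum_congr rfl fun k _ => ?_
        split_ifs with hk
        · rw [← Finset.mul_prod_erase _ _ (Finset.mem_univ k),
            ← Finset.mul_prod_erase _ (fun j => typeWt L (Function.update τ k 0 j))
              (Finset.mem_univ k)]
          have : ∏ x ∈ Finset.univ.erase k, typeWt L (Function.update τ k 0 x)
              = ∏ x ∈ Finset.univ.erase k, typeWt L (τ x) :=
            Finset.prod_congr rfl fun x hx => by
              rw [Function.update_of_ne (Finset.ne_of_mem_erase hx)]
          rw [this, Function.update_self, hk]
          simp [typeWt]; ring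
        · simp
    _ = ∑ k, ∑ τ : Fin n → Fin 4, (if τ k = 0 then L * ((∏ j, typeWt L (τ j))
          * siteCoeff f k τ ^ 2) else 0) := by
        rw [Finset.sum_comm]
        exact Finset.sum_congr rfl fun k _ => sum_update_eq k (3 : Fin 4) 0
          (fun τ => L * ((∏ j, typeWt L (τ j)) * siteCoeff f k τ ^ 2))
    _ ≤ _ := by
        rw [Finset.mul_sum]
        refine Finset.sum_le_sum fun k _ => ?_
        refine le_trans (Finset.sum_le_sum fun τ _ => ?_)
          (mul_le_mul_of_nonneg_left (sum_siteCoeff_sq_le hL f k) hL |>.trans' (le_of_eq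
            (Finset.mul_sum _ _ _).symm))
        split_ifs
        · rfl
        · exact mul_nonneg hL (mul_nonneg (hw τ) (sq_nonneg _))

/-- The hypotheses on the site variables: independence of the pairs `(Z_j, ξ_j)`, centring, and
bounds on the moments of order `q`. -/
structure IsSite (P : Measure Ω) (q m : ℝ) (Z ξ : ℕ → Ω → ℝ) : Prop where
  meas_Z : ∀ j, Measurable (Z j)
  meas_ξ : ∀ j, Measurable (ξ j)
  indep : iIndepFun (fun j ω => (Z j ω, ξ j ω)) P
  mean_Z : ∀ j, ∫ ω, Z j ω ∂P = 0
  mean_sq : ∀ j, ∫ ω, (Z j ω ^ 2 - 1) ∂P = 0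
  mean_ξ : ∀ j, ∫ ω, ξ j ω ∂P = 0
  mom_Z : ∀ j, MomentBound P q (Z j) m
  mom_sq : ∀ j, MomentBound P q (fun ω => Z j ω ^ 2 - 1) m
  mom_ξ : ∀ j, MomentBound P q (ξ j) m

theorem IsSite.measurable_siteVar {q m : ℝ} {Z ξ : ℕ → Ω → ℝ} (h : IsSite P q m Z ξ) (j : ℕ)
    (t : Fin 4) : Measurable (siteVar Z ξ j t) := by
  have h1 := h.meas_Z j
  have h2 := h.meas_ξ j
  unfold siteVar
  fin_cases t <;> simp <;> fun_prop

theorem IsSite.indep_siteVar {q m : ℝ} {Z ξ : ℕ → Ω → ℝ} (h : IsSite P q m Z ξ) :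
    iIndepFun (fun j ω t => siteVar Z ξ j t ω) P := by
  refine h.indep.comp (fun _ (x : ℝ × ℝ) (t : Fin 4) => ![1, x.1, x.1 ^ 2 - 1, x.2] t) fun _ => ?_
  refine measurable_pi_lambda _ fun t => ?_
  fin_cases t <;> simp <;> fun_prop

/-- The weight constant of the moment bound for polynomials in the site variables. -/
def siteConst (q m : ℝ) : ℝ := 4 * smoothConst q * (4 ^ 2 * m)

theorem IsSite.momentBound [IsProbabilityMeasure P] {q m : ℝ} (hq : 2 ≤ q) (hm : 0 ≤ m)
    {Z ξ : ℕ → Ω → ℝ} (h : IsSite P q m Z ξ) (n : ℕ) (a : (Fin n → Fin 4) → ℝ) :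
    MomentBound P q (sitePoly (siteVar Z ξ) n a)
      (∑ τ, (∏ j, typeWt (siteConst q m) (τ j)) * a τ ^ 2) := by
  have := momentBound_sitePoly (P := P) (0 : Fin 4) hq hm (fun j b => h.measurable_siteVar j b)
    h.indep_siteVar (fun j ω => by simp [siteVar])
    (fun j b hb => by
      fin_cases b
      · simp at hb
      · simpa [siteVar] using h.mean_Z j
      · simpa [siteVar] using h.mean_sq j
      · simpa [siteVar] using h.mean_ξ j)
    (fun j b hb => by
      fin_cases b
      · simp at hb
      · exact h.mom_Z j
      · exact h.mom_sq j
      · exact h.mom_ξ j) n a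
  simp only [Fintype.card_fin, Nat.cast_ofNat] at this
  refine this.mono (by linarith) ?_ (le_of_eq (Finset.sum_congr rfl fun τ _ => ?_))
  swap
  · rw [mul_comm]
    rfl
  · have hC := one_le_smoothConst hq
    exact Finset.sum_nonneg fun τ _ => mul_nonneg (sq_nonneg _)
      (Finset.prod_nonneg fun j _ => by split_ifs <;> positivity)

omit [MeasurableSpace Ω] in
-- The mean `p₀` of `χ_k` produces `covCoeff` and its fluctuation `ξ_k` produces `chiCoeff`. Only
-- the former has a constant term, and that is what is subtracted.
theorem cov_sub_eq (Z ξ χ : ℕ → Ω → ℝ) (p₀ : ℝ) (hχ : ∀ k ω, χ k ω = p₀ + ξ k ω) (n : ℕ)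
    (f : (Fin n → Bool) → ℝ) (ω : Ω) :
    (∑ k : Fin n, χ k ω * dlin Z n f k ω ^ 2) - p₀ * covCoeff f (fun _ => 0)
      = sitePoly (siteVar Z ξ) n (fun τ => p₀ * (if τ = (fun _ => 0) then 0 else covCoeff f τ)
        + chiCoeff f τ) ω := by
  simp_rw [hχ, add_mul, Finset.sum_add_distrib, sum_chi_dlin_sq]
  rw [← Finset.mul_sum, sum_dlin_sq Z ξ]
  unfold sitePoly
  simp_rw [add_mul, Finset.sum_add_distrib]
  have e : ∑ τ, covCoeff f τ * ∏ j : Fin n, siteVar Z ξ j (τ j) ω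
      = covCoeff f (fun _ => 0) + ∑ τ, (if τ = (fun _ => 0) then 0 else covCoeff f τ)
        * ∏ j : Fin n, siteVar Z ξ j (τ j) ω := by
    rw [← Finset.add_sum_erase _ _ (Finset.mem_univ (fun _ : Fin n => (0 : Fin 4)))]
    rw [← Finset.add_sum_erase (a := fun _ : Fin n => (0 : Fin 4)) (f := fun τ => (if τ = (fun _ => 0)
      then 0 else covCoeff f τ) * ∏ j : Fin n, siteVar Z ξ j (τ j) ω) _ (Finset.mem_univ _)]
    simp only [if_true, zero_mul, zero_add]
    congr 1
    · simp [siteVar]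
    · exact Finset.sum_congr rfl fun τ hτ => by rw [if_neg (Finset.ne_of_mem_erase hτ)]
  rw [e, mul_add]
  simp_rw [Finset.mul_sum, mul_assoc]
  ring

/-- The moment bound for the centred covariance of a multilinear polynomial. -/
theorem IsSite.momentBound_cov [IsProbabilityMeasure P] {q m : ℝ} (hq : 2 ≤ q) (hm : 1 ≤ m)
    {Z ξ χ : ℕ → Ω → ℝ} (h : IsSite P q m Z ξ) {p₀ : ℝ} (h0 : 0 ≤ p₀) (h1 : p₀ ≤ 1)
    (hχ : ∀ k ω, χ k ω = p₀ + ξ k ω) {n N : ℕ}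
    {f : (Fin n → Bool) → ℝ} (hf : ∀ A, f A ≠ 0 → 1 ≤ size A ∧ size A ≤ N) {L : ℝ}
    (hL : L = siteConst q m) :
    MomentBound P q (fun ω => (∑ k : Fin n, χ k ω * dlin Z n f k ω ^ 2)
        - p₀ * covCoeff f (fun _ => 0))
      (2 * (N ^ 2 * ∑ j, wSq (2 * L + 1) (restr f j) ^ 2
        + (2 * L) ^ (2 * N) * N ^ 4 * (2 * 2 ^ N
        * (∑ l ∈ Finset.Icc 1 N, √(contrSq (homPart f l) l)) * ∑ A, f A ^ 2))
        + 2 * (L * ∑ k, wSq (2 * L + 1) (restr f k) ^ 2)) := by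
  have hC := one_le_smoothConst hq
  have hL1 : 1 ≤ L := by rw [hL, siteConst]; nlinarith
  have hL0 : 0 ≤ L := by linarith
  have hw : ∀ τ : Fin n → Fin 4, 0 ≤ ∏ j, typeWt L (τ j) :=
    fun τ => Finset.prod_nonneg fun j _ => typeWt_nonneg hL0 _
  have e : (fun ω => (∑ k : Fin n, χ k ω * dlin Z n f k ω ^ 2) - p₀ * covCoeff f (fun _ => 0))
      = sitePoly (siteVar Z ξ) n (fun τ => p₀ * (if τ = (fun _ => 0) then 0 else covCoeff f τ)
        + chiCoeff f τ) := funext fun ω => cov_sub_eq Z ξ χ p₀ hχ n f ω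
  rw [e]
  refine (h.momentBound hq (by linarith) n _).mono (by linarith) ?_ ?_
  · rw [← hL]
    exact Finset.sum_nonneg fun τ _ => mul_nonneg (hw τ) (sq_nonneg _)
  · rw [← hL]
    refine le_trans ?_ (add_le_add (mul_le_mul_of_nonneg_left (sum_covCoeff_sq_le hL1 hf)
      zero_le_two) (mul_le_mul_of_nonneg_left (sum_chiCoeff_sq_le hL0 f) zero_le_two))
    rw [Finset.mul_sum, Finset.mul_sum, ← Finset.sum_add_distrib]
    refine Finset.sum_le_sum fun τ _ => ?_
    have key : ∀ x : ℝ, (∏ j, typeWt L (τ j)) * (p₀ * x + chiCoeff f τ) ^ 2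
        ≤ 2 * ((∏ j, typeWt L (τ j)) * x ^ 2) + 2 * ((∏ j, typeWt L (τ j)) * chiCoeff f τ ^ 2) := by
      intro x
      have : (p₀ * x + chiCoeff f τ) ^ 2 ≤ 2 * x ^ 2 + 2 * chiCoeff f τ ^ 2 := by
        have h2 : (p₀ * x) ^ 2 ≤ x ^ 2 := by
          rw [mul_pow]
          exact mul_le_of_le_one_left (sq_nonneg _) (pow_le_one₀ h0 h1)
        nlinarith [sq_nonneg (p₀ * x - chiCoeff f τ)]
      have := mul_le_mul_of_nonneg_left this (hw τ)
      linarith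
    have := key (if τ = (fun _ => 0) then 0 else covCoeff f τ)
    refine this.trans (le_of_eq ?_)
    split_ifs <;> ring

end Sites

/-! ### Multilinear polynomials in Gaussian variables -/

section Gaussian

variable {Ω : Type*} [MeasurableSpace Ω] {P : Measure Ω}

omit [MeasurableSpace Ω] in
theorem mlin_eq_sitePoly (Z : ℕ → Ω → ℝ) (n : ℕ) (f : (Fin n → Bool) → ℝ) :
    mlin Z n f = sitePoly (fun j (b : Bool) ω => if b then Z j ω else 1) n f := rfl

/-- The constant in the moment bound for multilinear polynomials. -/
def mlinConst (q m : ℝ) : ℝ := 4 * smoothConst q * (2 ^ 2 * m)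

theorem one_le_mlinConst {q m : ℝ} (hq : 2 ≤ q) (hm : 1 ≤ m) : 1 ≤ mlinConst q m := by
  have := one_le_smoothConst hq
  unfold mlinConst; nlinarith

/-- Two types per site suffice here, and only moments of `Z` itself enter. This bound makes the
series, and their derivatives, converge. -/
theorem momentBound_mlin [IsProbabilityMeasure P] {q m : ℝ} (hq : 2 ≤ q) (hm : 1 ≤ m)
    {Z : ℕ → Ω → ℝ} (hZ : ∀ j, Measurable (Z j)) (hind : iIndepFun Z P)
    (hmean : ∀ j, ∫ ω, Z j ω ∂P = 0) (hmom : ∀ j, MomentBound P q (Z j) m) {n N : ℕ}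
    {f : (Fin n → Bool) → ℝ} (hf : ∀ A, f A ≠ 0 → size A ≤ N) :
    MomentBound P q (mlin Z n f) (mlinConst q m ^ N * ∑ A, f A ^ 2) := by
  have h := momentBound_sitePoly (P := P) false hq (by linarith : 0 ≤ m)
    (X := fun j (b : Bool) ω => if b then Z j ω else 1)
    (fun j b => by cases b <;> simp <;> fun_prop)
    (hind.comp (fun _ x (b : Bool) => if b then x else 1) fun _ =>
      measurable_pi_lambda _ fun b => by cases b <;> simp <;> fun_prop)
    (fun j ω => by simp)
    (fun j b hb => by cases b <;> simp_all)
    (fun j b hb => by cases b <;> simp_all) n f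
  rw [mlin_eq_sitePoly]
  have hL := one_le_mlinConst hq hm
  refine h.mono (by linarith) (Finset.sum_nonneg fun τ _ => mul_nonneg (sq_nonneg _)
    (Finset.prod_nonneg fun j _ => ?_)) ?_
  · have := one_le_smoothConst hq
    split_ifs <;> positivity
  · have := wSq_le hL hf
    refine le_trans (le_of_eq ?_) this
    refine Finset.sum_congr rfl fun A _ => ?_
    rw [mul_comm]
    congr 1
    refine Finset.prod_congr rfl fun j _ => ?_
    cases A j <;> simp [mlinConst]

theorem exists_momentBound {q : ℝ} (hq : 2 ≤ q) {X : Ω → ℝ} (hX : MemLp X (ENNReal.ofReal q) P) :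
    ∃ m, 1 ≤ m ∧ MomentBound P q X m := by
  have h0 : 0 ≤ ∫ ω, |X ω| ^ q ∂P := integral_nonneg fun ω => Real.rpow_nonneg (abs_nonneg _) _
  refine ⟨1 + ∫ ω, |X ω| ^ q ∂P, by linarith, hX, ?_⟩
  have : (1 + ∫ ω, |X ω| ^ q ∂P) ^ (1 : ℝ) ≤ (1 + ∫ ω, |X ω| ^ q ∂P) ^ (q / 2) :=
    Real.rpow_le_rpow_of_exponent_le (by linarith) (by linarith)
  rw [Real.rpow_one] at this
  linarith

theorem integral_sitePoly_sq [IsProbabilityMeasure P] {q m : ℝ} (hq : 2 ≤ q) (hm : 0 ≤ m)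
    {Z ξ : ℕ → Ω → ℝ} (h : IsSite P q m Z ξ) {ν : Fin 4 → ℝ}
    (hν : ∀ j t u, ∫ ω, siteVar Z ξ j t ω * siteVar Z ξ j u ω ∂P = if t = u then ν t else 0)
    (n : ℕ) (a : (Fin n → Fin 4) → ℝ) :
    ∫ ω, sitePoly (siteVar Z ξ) n a ω ^ 2 ∂P = ∑ τ, (∏ j, ν (τ j)) * a τ ^ 2 := by
  have hmon : ∀ τ : Fin n → Fin 4, MemLp (fun ω => ∏ j : Fin n, siteVar Z ξ j (τ j) ω) 2 P := by
    intro τ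
    have h1 := (h.momentBound hq hm n (Pi.single τ 1)).1
    have h2 : sitePoly (siteVar Z ξ) n (Pi.single τ 1)
        = fun ω => ∏ j : Fin n, siteVar Z ξ j (τ j) ω := by
      funext ω
      unfold sitePoly
      rw [Finset.sum_eq_single τ (fun σ _ hσ => by simp [hσ]) (by simp)]
      simp
    rw [h2] at h1
    refine h1.mono_exponent ?_
    rw [← ENNReal.ofReal_ofNat]
    exact ENNReal.ofReal_le_ofReal hq
  have hint : ∀ τ σ : Fin n → Fin 4, Integrable (fun ω => a τ * a σ *
      ((∏ j : Fin n, siteVar Z ξ j (τ j) ω) * ∏ j : Fin n, siteVar Z ξ j (σ j) ω)) P :=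
    fun τ σ => ((hmon τ).integrable_mul (hmon σ)).const_mul _
  have hE : ∀ τ σ : Fin n → Fin 4, ∫ ω, (∏ j : Fin n, siteVar Z ξ j (τ j) ω)
      * ∏ j : Fin n, siteVar Z ξ j (σ j) ω ∂P = if τ = σ then ∏ j, ν (τ j) else 0 := by
    intro τ σ
    simp_rw [← Finset.prod_mul_distrib]
    have hi := h.indep_siteVar.precomp (g := fun j : Fin n => (j : ℕ)) Fin.val_injective
    have e := hi.integral_fun_prod_comp (f := fun j x => x (τ j) * x (σ j))
      (fun j => (measurable_pi_lambda _ fun t => h.measurable_siteVar j t).aemeasurable)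
      (fun j => by
        refine Measurable.aestronglyMeasurable ?_
        fun_prop)
    refine e.trans ?_
    rw [Finset.prod_congr rfl fun (j : Fin n) _ => hν j (τ j) (σ j)]
    split_ifs with hτ
    · subst hτ; simp
    · obtain ⟨j, hj⟩ := Function.ne_iff.1 hτ
      exact Finset.prod_eq_zero (Finset.mem_univ j) (by simp [hj])
  have e1 : ∀ ω, sitePoly (siteVar Z ξ) n a ω ^ 2 = ∑ τ, ∑ σ, a τ * a σ *
      ((∏ j : Fin n, siteVar Z ξ j (τ j) ω) * ∏ j : Fin n, siteVar Z ξ j (σ j) ω) := by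
    intro ω
    unfold sitePoly
    rw [sq, Finset.sum_mul_sum]
    exact Finset.sum_congr rfl fun τ _ => Finset.sum_congr rfl fun σ _ => by ring
  simp_rw [e1]
  rw [integral_finsetSum _ fun τ _ => integrable_finsetSum _ fun σ _ => hint τ σ]
  refine Finset.sum_congr rfl fun τ _ => ?_
  rw [integral_finsetSum _ fun σ _ => hint τ σ]
  simp_rw [integral_const_mul, hE]
  simp; ring

theorem integral_sitePoly [IsProbabilityMeasure P] {q m : ℝ} (hq : 2 ≤ q) (hm : 0 ≤ m)
    {Z ξ : ℕ → Ω → ℝ} (h : IsSite P q m Z ξ) (n : ℕ) (a : (Fin n → Fin 4) → ℝ) :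
    ∫ ω, sitePoly (siteVar Z ξ) n a ω ∂P = a (fun _ => 0) := by
  have hmon : ∀ τ : Fin n → Fin 4,
      Integrable (fun ω => a τ * ∏ j : Fin n, siteVar Z ξ j (τ j) ω) P := by
    intro τ
    have h1 := (h.momentBound hq hm n (Pi.single τ (a τ))).1
    have h2 : sitePoly (siteVar Z ξ) n (Pi.single τ (a τ))
        = fun ω => a τ * ∏ j : Fin n, siteVar Z ξ j (τ j) ω := by
      funext ω
      unfold sitePoly
      rw [Finset.sum_eq_single τ (fun σ _ hσ => by simp [hσ]) (by simp)]
      simp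
    rw [h2] at h1
    refine h1.integrable ?_
    rw [← ENNReal.ofReal_one]
    exact ENNReal.ofReal_le_ofReal (by linarith)
  unfold sitePoly
  rw [integral_finsetSum _ fun τ _ => hmon τ]
  rw [Finset.sum_eq_single (fun _ => 0)]
  · simp [siteVar]
  · intro τ _ hτ
    obtain ⟨j, hj⟩ := Function.ne_iff.1 hτ
    rw [integral_const_mul]
    have hi := h.indep_siteVar.precomp (g := fun j : Fin n => (j : ℕ)) Fin.val_injective
    have e := hi.integral_fun_prod_comp (f := fun j x => x (τ j))
      (fun j => (measurable_pi_lambda _ fun t => h.measurable_siteVar j t).aemeasurable)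
      (fun j => by
        refine Measurable.aestronglyMeasurable ?_
        fun_prop)
    have e' : ∫ ω, ∏ j : Fin n, siteVar Z ξ j (τ j) ω ∂P
        = ∏ j : Fin n, ∫ ω, siteVar Z ξ j (τ j) ω ∂P := e
    rw [e', Finset.prod_eq_zero (Finset.mem_univ j), mul_zero]
    generalize hs : τ j = t at hj
    fin_cases t
    · simp at hj
    · exact h.mean_Z j
    · exact h.mean_sq j
    · exact h.mean_ξ j
  · simp

/-! ### Moments of the standard normal law and Gaussian sites -/

theorem iteratedDeriv_mgf_gaussian :
    iteratedDeriv 3 (fun t : ℝ => Real.exp (t ^ 2 / 2)) 0 = 0 ∧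
      iteratedDeriv 4 (fun t : ℝ => Real.exp (t ^ 2 / 2)) 0 = 3 := by
  have e : ∀ t : ℝ, HasDerivAt (fun t : ℝ => Real.exp (t ^ 2 / 2)) (t * Real.exp (t ^ 2 / 2)) t := by
    intro t
    have h := ((hasDerivAt_pow 2 t).div_const 2).exp
    convert! h using 1
    push_cast; ring
  have d1 : deriv (fun t : ℝ => Real.exp (t ^ 2 / 2)) = fun t => t * Real.exp (t ^ 2 / 2) :=
    funext fun t => (e t).deriv
  have d2 : deriv (fun t : ℝ => t * Real.exp (t ^ 2 / 2))
      = fun t => (1 + t ^ 2) * Real.exp (t ^ 2 / 2) := by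
    funext t
    refine (((hasDerivAt_id t).mul (e t)).congr_deriv ?_).deriv
    simp; ring
  have d3 : deriv (fun t : ℝ => (1 + t ^ 2) * Real.exp (t ^ 2 / 2))
      = fun t => (3 * t + t ^ 3) * Real.exp (t ^ 2 / 2) := by
    funext t
    refine ((((hasDerivAt_pow 2 t).const_add 1).mul (e t)).congr_deriv ?_).deriv
    push_cast; ring
  have d4 : deriv (fun t : ℝ => (3 * t + t ^ 3) * Real.exp (t ^ 2 / 2))
      = fun t => (3 + 6 * t ^ 2 + t ^ 4) * Real.exp (t ^ 2 / 2) := by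
    funext t
    refine (((((hasDerivAt_id t).const_mul 3).add (hasDerivAt_pow 3 t)).mul
      (e t)).congr_deriv ?_).deriv
    simp; ring
  simp only [iteratedDeriv_succ', iteratedDeriv_zero, d1, d2, d3, d4]
  norm_num

theorem integral_pow_gaussian :
    ∫ x, x ^ 3 ∂(gaussianReal 0 1) = 0 ∧ ∫ x, x ^ 4 ∂(gaussianReal 0 1) = 3 ∧
      ∫ x, x ^ 2 ∂(gaussianReal 0 1) = 1 := by
  have hmgf : mgf id (gaussianReal 0 1) = fun t : ℝ => Real.exp (t ^ 2 / 2) := by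
    rw [mgf_id_gaussianReal]; funext t; simp
  have h0 : (0 : ℝ) ∈ interior (integrableExpSet id (gaussianReal 0 1)) := by simp
  have h := fun n => iteratedDeriv_mgf_zero h0 n
  rw [hmgf] at h
  refine ⟨?_, ?_, ?_⟩
  · have := h 3
    rw [iteratedDeriv_mgf_gaussian.1] at this
    simpa using this.symm
  · have := h 4
    rw [iteratedDeriv_mgf_gaussian.2] at this
    simpa using this.symm
  · have := variance_fun_id_gaussianReal (μ := 0) (v := 1)
    rw [variance_eq_integral (by fun_prop)] at this
    simpa [integral_id_gaussianReal] using this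

instance : IsProbabilityMeasure gaussSeq := by unfold gaussSeq; infer_instance

/-- The sequence of the coordinates. -/
def coordSeq (k : ℕ) (ω : ℕ → ℝ) : ℝ := ω k

theorem measurable_coordSeq (k : ℕ) : Measurable (coordSeq k) := measurable_pi_apply k

theorem map_coordSeq (k : ℕ) : gaussSeq.map (coordSeq k) = gaussianReal 0 1 := by
  unfold gaussSeq coordSeq
  exact Measure.infinitePi_map_eval _ k

theorem iIndepFun_coordSeq : iIndepFun coordSeq gaussSeq := by
  have := iIndepFun_infinitePi (P := fun _ : ℕ => gaussianReal 0 1) (X := fun _ => id)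
    (fun _ => measurable_id)
  exact this

theorem integral_comp_coordSeq (k : ℕ) {φ : ℝ → ℝ} (hφ : Measurable φ) :
    ∫ ω, φ (coordSeq k ω) ∂gaussSeq = ∫ x, φ x ∂(gaussianReal 0 1) := by
  rw [← map_coordSeq k, integral_map (measurable_coordSeq k).aemeasurable
    hφ.aestronglyMeasurable]

theorem momentBound_comp_coordSeq {q m : ℝ} {φ : ℝ → ℝ} (hφ : Measurable φ)
    (h : MomentBound (gaussianReal 0 1) q φ m) (k : ℕ) :
    MomentBound gaussSeq q (fun ω => φ (coordSeq k ω)) m := by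
  refine ⟨?_, ?_⟩
  · have := h.1
    rw [← map_coordSeq k] at this
    exact this.comp_of_map (measurable_coordSeq k).aemeasurable
  · rw [integral_comp_coordSeq k (φ := fun x => |φ x| ^ q) (by fun_prop)]
    exact h.2

theorem memLp_pow_gaussian (n : ℕ) {q : ENNReal} (hq : q ≠ ⊤) :
    MemLp (fun x : ℝ => x ^ n) q (gaussianReal 0 1) := by
  rcases Nat.eq_zero_or_pos n with rfl | hn
  · simpa using memLp_const (1 : ℝ)
  · have h : MemLp (fun x : ℝ => x) (q * n) (gaussianReal 0 1) :=
      memLp_id_gaussianReal' _ (ENNReal.mul_ne_top hq (ENNReal.natCast_ne_top n))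
    have h2 := h.norm_rpow_div (n : ENNReal)
    have hn0 : (n : ENNReal) ≠ 0 := by exact_mod_cast hn.ne'
    rw [ENNReal.mul_div_cancel_right hn0 (ENNReal.natCast_ne_top n)] at h2
    refine (memLp_congr_norm h2.aestronglyMeasurable (by fun_prop) (ae_of_all _ fun x => ?_)).1 h2
    simp

/-- Gaussian variables fit the site framework with `ξ = 0`, so the expansion of squares and the
convergence results apply to them as well. -/
theorem exists_isSite_gauss {q : ℝ} (hq : 2 ≤ q) :
    ∃ m, 1 ≤ m ∧ IsSite gaussSeq q m coordSeq (fun _ _ => 0) := by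
  have hz := memLp_pow_gaussian 1 (q := ENNReal.ofReal q) ENNReal.ofReal_ne_top
  have hs : MemLp (fun x : ℝ => x ^ 2 - 1) (ENNReal.ofReal q) (gaussianReal 0 1) :=
    (memLp_pow_gaussian 2 ENNReal.ofReal_ne_top).sub (memLp_const 1)
  obtain ⟨m₁, h₁, b₁⟩ := exists_momentBound hq hz
  obtain ⟨m₂, h₂, b₂⟩ := exists_momentBound hq hs
  obtain ⟨-, -, e2⟩ := integral_pow_gaussian
  refine ⟨max m₁ m₂, le_max_of_le_left h₁, ?_⟩
  constructor
  · exact measurable_coordSeq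
  · exact fun j => measurable_const
  · exact iIndepFun_coordSeq.comp (fun _ x => (x, (0 : ℝ))) fun _ => by fun_prop
  · intro j
    rw [integral_comp_coordSeq j (φ := fun x => x) measurable_id]
    exact integral_id_gaussianReal
  · intro j
    rw [integral_comp_coordSeq j (φ := fun x => x ^ 2 - 1) (by fun_prop), integral_sub, e2]
    · simp
    · exact (memLp_pow_gaussian 2 (q := 1) ENNReal.one_ne_top).integrable le_rfl
    · exact integrable_const _
  · simp
  · intro j
    have := momentBound_comp_coordSeq (φ := fun x => x ^ 1) (by fun_prop) b₁ j
    simp only [pow_one] at this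
    exact this.mono (by linarith) (by linarith) (le_max_left _ _)
  · intro j
    exact (momentBound_comp_coordSeq (φ := fun x => x ^ 2 - 1) (by fun_prop) b₂ j).mono
      (by linarith) (by linarith) (le_max_right _ _)
  · intro j
    refine ⟨by simp, ?_⟩
    have : (0 : ℝ) ^ q = 0 := Real.zero_rpow (by linarith)
    simp only [abs_zero, this, integral_zero]
    exact Real.rpow_nonneg (le_max_of_le_left (by linarith)) _

/-- The second moments of the Gaussian site variables. -/
def gaussNu (t : Fin 4) : ℝ := ![1, 1, 2, 0] t

theorem integral_siteVar_mul_gauss (j : ℕ) (t u : Fin 4) :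
    ∫ ω, siteVar coordSeq (fun _ _ => 0) j t ω * siteVar coordSeq (fun _ _ => 0) j u ω ∂gaussSeq
      = if t = u then gaussNu t else 0 := by
  obtain ⟨e3, e4, e2⟩ := integral_pow_gaussian
  have e1 : ∫ x, x ∂(gaussianReal 0 1) = 0 := integral_id_gaussianReal
  have i : ∀ n, Integrable (fun x : ℝ => x ^ n) (gaussianReal 0 1) := fun n =>
    (memLp_pow_gaussian n (q := 1) ENNReal.one_ne_top).integrable le_rfl
  have i1 : Integrable (fun x : ℝ => x) (gaussianReal 0 1) := by simpa using i 1
  have key := integral_comp_coordSeq j (φ := fun x => ![1, x, x ^ 2 - 1, 0] t *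
    ![1, x, x ^ 2 - 1, 0] u) (by fin_cases t <;> fin_cases u <;> simp <;> fun_prop)
  refine Eq.trans key ?_
  have f2 : ∫ x : ℝ, (x ^ 2 - 1) ∂(gaussianReal 0 1) = 0 := by
    rw [integral_sub (i 2) (integrable_const _), e2]; simp
  have f3 : ∫ x : ℝ, x * (x ^ 2 - 1) ∂(gaussianReal 0 1) = 0 := by
    have : ∀ x : ℝ, x * (x ^ 2 - 1) = x ^ 3 - x := fun x => by ring
    simp_rw [this]
    rw [integral_sub (i 3) i1, e3, e1]; simp
  have f3' : ∫ x : ℝ, (x ^ 2 - 1) * x ∂(gaussianReal 0 1) = 0 := by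
    simp_rw [mul_comm _ (_ : ℝ)] at f3 ⊢
    simpa [mul_comm] using f3
  have f4 : ∫ x : ℝ, (x ^ 2 - 1) * (x ^ 2 - 1) ∂(gaussianReal 0 1) = 2 := by
    have : ∀ x : ℝ, (x ^ 2 - 1) * (x ^ 2 - 1) = x ^ 4 - 2 * x ^ 2 + 1 := fun x => by ring
    simp_rw [this]
    have i42 : Integrable (fun x : ℝ => x ^ 4 - 2 * x ^ 2) (gaussianReal 0 1) :=
      (i 4).sub ((i 2).const_mul 2)
    rw [integral_add i42 (integrable_const _), integral_sub (i 4) ((i 2).const_mul 2), integral_const_mul, e4, e2]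
    simp; norm_num
  have f1 : ∫ x : ℝ, x * x ∂(gaussianReal 0 1) = 1 := by
    simp_rw [← sq]; exact e2
  fin_cases t <;> fin_cases u <;> simp [gaussNu, e1, f1, f2, f3, f3', f4]

/-- The second and the fourth moments of a multilinear polynomial in Gaussian variables. -/
theorem integral_mlin_gauss (n : ℕ) (f : (Fin n → Bool) → ℝ) :
    ∫ ω, mlin coordSeq n f ω ^ 2 ∂gaussSeq = ∑ A, f A ^ 2 ∧
      ∫ ω, mlin coordSeq n f ω ^ 4 ∂gaussSeq
        = ∑ τ, (∏ j, typeNu (τ j)) * linkForm f f τ ^ 2 := by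
  obtain ⟨m, hm, h⟩ := exists_isSite_gauss le_rfl
  constructor
  · simp_rw [mlin_sq coordSeq (fun _ _ => 0)]
    rw [integral_sitePoly le_rfl (by linarith) h, linkForm_zero]
  -- The square is expanded first and its second moment taken next. For Gaussian sites `1, Z, Z ^ 2
  -- - 1` are orthogonal, because `E Z ^ 3 = 0`.
  · have : ∀ ω, mlin coordSeq n f ω ^ 4 = (mlin coordSeq n f ω ^ 2) ^ 2 := fun ω => by ring
    simp_rw [this, mlin_sq coordSeq (fun _ _ => 0)]
    rw [integral_sitePoly_sq le_rfl (by linarith) h integral_siteVar_mul_gauss]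
    refine Finset.sum_congr rfl fun τ _ => ?_
    -- `gaussNu` and `typeNu` differ only at type `3`, where `linkForm` vanishes.
    by_cases h3 : ∃ j, τ j = 3
    · obtain ⟨j, hj⟩ := h3
      have : linkForm f f τ = 0 := by
        refine Finset.sum_eq_zero fun A _ => Finset.sum_eq_zero fun B _ => ?_
        rw [Finset.prod_eq_zero (Finset.mem_univ j), mul_zero]
        rw [hj]
        cases A j <;> cases B j <;> simp [linkW]
      simp [this]
    · push Not at h3
      congr 1
      refine Finset.prod_congr rfl fun j _ => ?_
      have := h3 j
      revert this
      generalize τ j = t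
      fin_cases t <;> simp [gaussNu, typeNu]

theorem contrSq_le_cumulant {n : ℕ} {f : (Fin n → Bool) → ℝ} {l : ℕ} (hl : 1 ≤ l)
    (hf : ∀ A, f A ≠ 0 → size A = l) :
    contrSq f l ≤ cumulant4 gaussSeq (mlin coordSeq n f) := by
  unfold cumulant4
  rw [(integral_mlin_gauss n f).1, (integral_mlin_gauss n f).2]
  linarith [contrSq_add_le hl hf]

end Gaussian

/-! ### Symmetric coefficients as functions of finite sets -/

/-- The set of the sites in a configuration. -/
def supp {n : ℕ} (a : Fin n → Bool) : Finset ℕ :=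
  (Finset.univ.filter fun j => a j = true).map Fin.valEmbedding

theorem mem_supp {n : ℕ} {a : Fin n → Bool} {k : Fin n} : (k : ℕ) ∈ supp a ↔ a k = true := by
  simp [supp, Fin.val_inj]

theorem card_supp {n : ℕ} (a : Fin n → Bool) : (supp a).card = size a := by
  unfold supp size
  rw [Finset.card_map, Finset.card_filter]
  refine Finset.sum_congr rfl fun j _ => ?_
  cases a j <;> simp

theorem supp_subset {n : ℕ} (a : Fin n → Bool) : supp a ⊆ Finset.range n := by
  intro x hx
  simp only [supp, Finset.mem_map, Fin.valEmbedding_apply] at hx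
  obtain ⟨j, -, rfl⟩ := hx
  exact Finset.mem_range.2 j.2

theorem sum_supp {n : ℕ} (G : Finset ℕ → ℝ) :
    ∑ a : Fin n → Bool, G (supp a) = ∑ A ∈ (Finset.range n).powerset, G A := by
  refine Finset.sum_bij' (fun a _ => supp a) (fun A _ j => decide ((j : ℕ) ∈ A))
    (fun a _ => Finset.mem_powerset.2 (supp_subset a)) (fun _ _ => Finset.mem_univ _) ?_ ?_
    (fun _ _ => rfl)
  · intro a _
    funext j
    simp [mem_supp]
  · intro A hA
    ext x
    simp only [supp, decide_eq_true_eq, Finset.mem_map, Finset.mem_filter, Finset.mem_univ,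
      true_and, Fin.valEmbedding_apply]
    constructor
    · rintro ⟨j, hj, rfl⟩; exact hj
    · intro hx
      exact ⟨⟨x, Finset.mem_range.1 (Finset.mem_powerset.1 hA hx)⟩, hx, rfl⟩

theorem prod_supp {n : ℕ} (a : Fin n → Bool) (z : ℕ → ℝ) :
    ∏ j : Fin n, (if a j then z j else 1) = ∏ j ∈ supp a, z j := by
  rw [supp, Finset.prod_map, Finset.prod_filter]
  rfl

theorem exists_perm_comp {m : ℕ} {β : Type*} [DecidableEq β] {α α' : Fin m → β}
    (h : Function.Injective α)
    (him : Finset.univ.image α = Finset.univ.image α') : ∃ π : Equiv.Perm (Fin m), α = α' ∘ π := by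
  have hr : ∀ i, ∃ j, α' j = α i := by
    intro i
    have : α i ∈ Finset.univ.image α' := him ▸ Finset.mem_image_of_mem _ (Finset.mem_univ i)
    simpa using this
  choose g hg using hr
  have hinj : Function.Injective g := by
    intro i j hij
    apply h
    rw [← hg i, ← hg j, hij]
  exact ⟨Equiv.ofBijective g (Finite.injective_iff_bijective.1 hinj), funext fun i => (hg i).symm⟩

/-- An injective multi-index is an ordering of its image, so each set of cardinality `m` is met `m!`
times. -/
theorem sum_symm {m J : ℕ} (F : (Fin m → ℕ) → ℝ) (G : Finset ℕ → ℝ)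
    (hG : ∀ α, Function.Injective α → F α = G (Finset.univ.image α))
    (hF : ∀ α, ¬ Function.Injective α → F α = 0) :
    ∑ α : Fin m → Fin J, F (fun i => (α i : ℕ))
      = ∑ A ∈ (Finset.range J).powersetCard m, (m.factorial : ℝ) * G A := by
  classical
  set S : Finset (Fin m → Fin J) := Finset.univ.filter fun α => Function.Injective α with hS
  have h1 : ∑ α : Fin m → Fin J, F (fun i => (α i : ℕ)) = ∑ α ∈ S, F (fun i => (α i : ℕ)) := by
    symm
    refine Finset.sum_subset (Finset.subset_univ _) fun α _ hα => hF _ fun h => hα ?_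
    simp only [hS, Finset.mem_filter, Finset.mem_univ, true_and]
    intro i j hij
    exact h (by simp [hij])
  have hinj : ∀ {α : Fin m → Fin J}, Function.Injective α →
      Function.Injective (fun i => (α i : ℕ)) := fun h i j hij => h (Fin.ext hij)
  have hmap : ∀ α ∈ S, Finset.univ.image (fun i => (α i : ℕ)) ∈ (Finset.range J).powersetCard m := by
    intro α hα
    simp only [hS, Finset.mem_filter, Finset.mem_univ, true_and] at hα
    rw [Finset.mem_powersetCard]
    constructor
    · intro x hx
      simp only [Finset.mem_image, Finset.mem_univ, true_and] at hx
      obtain ⟨i, rfl⟩ := hx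
      exact Finset.mem_range.2 (α i).2
    · rw [Finset.card_image_of_injective _ (hinj hα)]; simp
  rw [h1, ← Finset.sum_fiberwise_of_maps_to hmap]
  refine Finset.sum_congr rfl fun A hA => ?_
  obtain ⟨hAJ, hAm⟩ := Finset.mem_powersetCard.1 hA
  have hc : ∑ α ∈ S with Finset.univ.image (fun i => (α i : ℕ)) = A, F (fun i => (α i : ℕ))
      = ∑ α ∈ S with Finset.univ.image (fun i => (α i : ℕ)) = A, G A := by
    refine Finset.sum_congr rfl fun α hα => ?_
    simp only [hS, Finset.mem_filter, Finset.mem_univ, true_and] at hα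
    rw [hG _ (hinj hα.1), hα.2]
  rw [hc, Finset.sum_const, nsmul_eq_mul]
  congr 2
  set e : Fin m → Fin J := fun i =>
    ⟨A.orderEmbOfFin hAm i, Finset.mem_range.1 (hAJ (Finset.orderEmbOfFin_mem A hAm i))⟩ with he
  have heinj : Function.Injective e := by
    intro i j hij
    have := congrArg Fin.val hij
    exact (A.orderEmbOfFin hAm).injective this
  have heim : Finset.univ.image (fun i => (e i : ℕ)) = A := by
    ext x
    simp only [he, Finset.mem_image, Finset.mem_univ, true_and]
    have := Finset.range_orderEmbOfFin A hAm
    rw [← Finset.mem_coe, ← this]; rfl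
  have hbij : (Finset.univ : Finset (Equiv.Perm (Fin m))).card
      = (S.filter fun α => Finset.univ.image (fun i => (α i : ℕ)) = A).card := by
    refine Finset.card_bij (fun π _ => e ∘ π) ?_ ?_ ?_
    · intro π _
      simp only [hS, Finset.mem_filter, Finset.mem_univ, true_and]
      refine ⟨heinj.comp π.injective, ?_⟩
      conv_rhs => rw [← heim]
      ext x
      simp only [Finset.mem_image, Finset.mem_univ, true_and, Function.comp_apply]
      exact ⟨fun ⟨i, hi⟩ => ⟨π i, hi⟩, fun ⟨i, hi⟩ => ⟨π.symm i, by simpa using hi⟩⟩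
    · intro π _ π' _ h
      ext i
      have := congrFun h i
      exact congrArg Fin.val (heinj this)
    · intro α hα
      simp only [hS, Finset.mem_filter, Finset.mem_univ, true_and] at hα
      obtain ⟨π, hπ⟩ := exists_perm_comp (hinj hα.1) (hα.2.trans heim.symm)
      refine ⟨π, Finset.mem_univ _, funext fun i => Fin.ext ?_⟩
      exact (congrFun hπ i).symm
  rw [← hbij, Finset.card_univ, Fintype.card_perm, Fintype.card_fin]

/-- The coefficient of a finite set. -/
def cSet (c : Coeff) (A : Finset ℕ) : ℝ := c A.card (A.orderEmbOfFin rfl)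

theorem cSet_image {c : Coeff} (hc : c.Admissible) {m : ℕ} {α : Fin m → ℕ}
    (hα : Function.Injective α) : c m α = cSet c (Finset.univ.image α) := by
  have hcard : (Finset.univ.image α).card = m := by
    rw [Finset.card_image_of_injective _ hα]; simp
  have key : ∀ (A : Finset ℕ) (h : A.card = m), A = Finset.univ.image α → c m α = cSet c A := by
    intro A h hA
    subst h
    have him : Finset.univ.image α = Finset.univ.image (A.orderEmbOfFin rfl) := by
      rw [← hA]
      ext x
      have := Finset.range_orderEmbOfFin A rfl
      simp only [Finset.mem_image, Finset.mem_univ, true_and]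
      rw [← Finset.mem_coe, ← this]; rfl
    obtain ⟨π, hπ⟩ := exists_perm_comp hα him
    rw [hπ, hc.symm]
    rfl
  exact key _ hcard rfl

theorem coeff_eq_zero {c : Coeff} (hc : c.Admissible) {m : ℕ} {α : Fin m → ℕ}
    (hα : ¬ Function.Injective α) : c m α = 0 := by
  unfold Function.Injective at hα
  push Not at hα
  obtain ⟨i, j, hij, hne⟩ := hα
  exact hc.diag m α i j hne hij

/-- The coefficient of `Z_A` in `Φ_m(c, Z)`. -/
def phiCoeff (c : Coeff) (m : ℕ) (A : Finset ℕ) : ℝ :=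
  if A.card = m then (m.factorial : ℝ) * cSet c A else 0

/-- The coefficient of `Z_A` in `S_N(c, Z)`. -/
def totCoeff (c : Coeff) (N : ℕ) (A : Finset ℕ) : ℝ := ∑ m ∈ Finset.Icc 1 N, phiCoeff c m A

theorem totCoeff_eq (c : Coeff) (N : ℕ) (A : Finset ℕ) :
    totCoeff c N A = if 1 ≤ A.card ∧ A.card ≤ N then (A.card.factorial : ℝ) * cSet c A else 0 := by
  unfold totCoeff phiCoeff
  rw [Finset.sum_ite_eq]
  simp [Finset.mem_Icc]

/-- The multilinear polynomial with coefficients `φ` in the first `n` variables. -/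
def setPoly (Z : ℕ → ℝ) (n : ℕ) (φ : Finset ℕ → ℝ) : ℝ :=
  ∑ A ∈ (Finset.range n).powerset, φ A * ∏ j ∈ A, Z j

theorem setPoly_eq_mlin {Ω : Type*} (Z : ℕ → Ω → ℝ) (n : ℕ) (φ : Finset ℕ → ℝ) (ω : Ω) :
    setPoly (fun k => Z k ω) n φ = mlin Z n (fun a => φ (supp a)) ω := by
  unfold setPoly mlin
  rw [← sum_supp (fun A => φ A * ∏ j ∈ A, Z j ω)]
  refine Finset.sum_congr rfl fun a _ => ?_
  rw [prod_supp a (fun j => Z j ω)]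

theorem sum_powersetCard_eq (n m : ℕ) (G : Finset ℕ → ℝ) :
    ∑ A ∈ (Finset.range n).powersetCard m, G A
      = ∑ A ∈ (Finset.range n).powerset, if A.card = m then G A else 0 := by
  rw [← Finset.sum_filter, ← Finset.powersetCard_eq_filter]

theorem partialPhi_eq {Ω : Type*} {c : Coeff} (hc : c.Admissible) (Z : ℕ → Ω → ℝ)
    (m J : ℕ) (ω : Ω) : partialPhi c Z m J ω = setPoly (fun k => Z k ω) J (phiCoeff c m) := by
  unfold partialPhi setPoly
  rw [sum_symm (F := fun α : Fin m → ℕ => c m α * ∏ i, Z (α i) ω)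
    (G := fun A => cSet c A * ∏ j ∈ A, Z j ω)]
  · rw [sum_powersetCard_eq]
    refine Finset.sum_congr rfl fun A _ => ?_
    unfold phiCoeff
    split_ifs <;> ring
  · intro α hα
    rw [cSet_image hc hα, Finset.prod_image fun i _ j _ h => hα h]
  · intro α hα
    rw [coeff_eq_zero hc hα, zero_mul]

/-- The partial sums of `∑ φ(A) ^ 2`. -/
def sqSum (φ : Finset ℕ → ℝ) (n : ℕ) : ℝ := ∑ A ∈ (Finset.range n).powerset, φ A ^ 2

theorem sqSum_phiCoeff {c : Coeff} (hc : c.Admissible) (m J : ℕ) :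
    sqSum (phiCoeff c m) J
      = m.factorial * ∑ α : Fin m → Fin J, c m (fun i => (α i : ℕ)) ^ 2 := by
  unfold sqSum
  rw [sum_symm (F := fun α : Fin m → ℕ => c m α ^ 2) (G := fun A => cSet c A ^ 2),
    sum_powersetCard_eq, Finset.mul_sum]
  · refine Finset.sum_congr rfl fun A _ => ?_
    unfold phiCoeff
    split_ifs
    · ring
    · simp
  · intro α hα; rw [cSet_image hc hα]
  · intro α hα; rw [coeff_eq_zero hc hα]; simp

theorem phiCoeff_ne_zero {c : Coeff} {m : ℕ} {A : Finset ℕ} (h : phiCoeff c m A ≠ 0) :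
    A.card = m := by
  unfold phiCoeff at h; by_contra h'; simp [h'] at h

theorem totCoeff_sq (c : Coeff) (N : ℕ) (A : Finset ℕ) :
    totCoeff c N A ^ 2 = ∑ m ∈ Finset.Icc 1 N, phiCoeff c m A ^ 2 := by
  rw [totCoeff_eq]
  have : ∀ m, phiCoeff c m A ^ 2
      = if A.card = m then ((A.card.factorial : ℝ) * cSet c A) ^ 2 else 0 := by
    intro m; unfold phiCoeff
    split_ifs with h
    · rw [h]
    · simp
  simp_rw [this]
  rw [Finset.sum_ite_eq]
  simp only [Finset.mem_Icc]
  split_ifs <;> simp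

theorem sqSum_totCoeff (c : Coeff) (N J : ℕ) :
    sqSum (totCoeff c N) J = ∑ m ∈ Finset.Icc 1 N, sqSum (phiCoeff c m) J := by
  unfold sqSum
  simp_rw [totCoeff_sq]
  exact Finset.sum_comm

/-- The inclusion of the truncated multi-indices. -/
def truncEmb (m J : ℕ) : (Fin m → Fin J) ↪ (Fin m → ℕ) :=
  ⟨fun α i => (α i : ℕ), fun _ _ h => funext fun i => Fin.ext (congrFun h i)⟩

theorem sum_trunc_le {m J : ℕ} {h : (Fin m → ℕ) → ℝ} (h0 : ∀ α, 0 ≤ h α) (hs : Summable h) :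
    ∑ α : Fin m → Fin J, h (fun i => (α i : ℕ)) ≤ ∑' α, h α := by
  have := hs.sum_le_tsum (Finset.univ.map (truncEmb m J)) (fun α _ => h0 α)
  rwa [Finset.sum_map] at this

theorem tendsto_sum_trunc {m : ℕ} {h : (Fin m → ℕ) → ℝ} (hs : Summable h) :
    Tendsto (fun J => ∑ α : Fin m → Fin J, h (fun i => (α i : ℕ))) atTop (𝓝 (∑' α, h α)) := by
  have h1 : Tendsto (fun J => (Finset.univ : Finset (Fin m → Fin J)).map (truncEmb m J)) atTop
      atTop := by
    refine tendsto_atTop_finset_of_monotone ?_ ?_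
    · intro I J hIJ α hα
      simp only [Finset.mem_map, Finset.mem_univ, true_and] at hα ⊢
      obtain ⟨a, rfl⟩ := hα
      exact ⟨fun i => ⟨a i, (a i).2.trans_le hIJ⟩, rfl⟩
    · intro α
      refine ⟨∑ i, (α i + 1), ?_⟩
      simp only [Finset.mem_map, Finset.mem_univ, true_and]
      refine ⟨fun i => ⟨α i, ?_⟩, rfl⟩
      have := Finset.single_le_sum (f := fun i => α i + 1) (fun i _ => Nat.zero_le _)
        (Finset.mem_univ i)
      exact this
  have h2 := hs.hasSum.comp h1
  refine h2.congr fun J => ?_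
  simp only [Function.comp_apply, Finset.sum_map]
  rfl

theorem tendsto_sqSum_phiCoeff {c : Coeff} (hc : c.Admissible) {m : ℕ}
    (hs : Summable fun α : Fin m → ℕ => c m α ^ 2) :
    Tendsto (sqSum (phiCoeff c m)) atTop (𝓝 (m.factorial * normSq c m)) := by
  simp_rw [funext fun J => sqSum_phiCoeff hc m J]
  exact (tendsto_sum_trunc hs).const_mul _

theorem tendsto_sqSum_totCoeff {c : Coeff} (hc : c.Admissible) {N : ℕ}
    (hs : ∀ m, 1 ≤ m → m ≤ N → Summable fun α : Fin m → ℕ => c m α ^ 2) :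
    Tendsto (sqSum (totCoeff c N)) atTop (𝓝 (iN c N)) := by
  simp_rw [funext fun J => sqSum_totCoeff c N J]
  unfold iN
  exact tendsto_finsetSum _ fun m hm => tendsto_sqSum_phiCoeff hc
    (hs m (Finset.mem_Icc.1 hm).1 (Finset.mem_Icc.1 hm).2)

theorem sqSum_mono (φ : Finset ℕ → ℝ) : Monotone (sqSum φ) := fun _ _ h =>
  Finset.sum_le_sum_of_subset_of_nonneg
    (Finset.powerset_mono.2 (Finset.range_subset_range.2 h)) fun _ _ _ => sq_nonneg _

theorem sqSum_tail (φ : Finset ℕ → ℝ) {I J : ℕ} (h : J ≤ I) :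
    sqSum (fun A => if A ⊆ Finset.range J then 0 else φ A) I = sqSum φ I - sqSum φ J := by
  unfold sqSum
  have hsub : (Finset.range J).powerset ⊆ (Finset.range I).powerset :=
    Finset.powerset_mono.2 (Finset.range_subset_range.2 h)
  rw [← Finset.sum_sdiff hsub, ← Finset.sum_sdiff hsub (f := fun A => φ A ^ 2)]
  have e1 : ∑ A ∈ (Finset.range J).powerset, (if A ⊆ Finset.range J then 0 else φ A) ^ 2 = 0 :=
    Finset.sum_eq_zero fun A hA => by simp [Finset.mem_powerset.1 hA]
  rw [e1, add_zero, add_sub_cancel_right]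
  refine Finset.sum_congr rfl fun A hA => ?_
  beta_reduce
  rw [if_neg fun h' => (Finset.mem_sdiff.1 hA).2 (Finset.mem_powerset.2 h')]

/-- The difference of two truncations is again a multilinear polynomial, whose squared coefficients
form a tail of a convergent series; the moment bound then yields the Cauchy property. -/
theorem setPoly_sub (Z : ℕ → ℝ) (φ : Finset ℕ → ℝ) {I J : ℕ} (h : J ≤ I) :
    setPoly Z I φ - setPoly Z J φ
      = setPoly Z I (fun A => if A ⊆ Finset.range J then 0 else φ A) := by
  unfold setPoly
  have hsub : (Finset.range J).powerset ⊆ (Finset.range I).powerset :=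
    Finset.powerset_mono.2 (Finset.range_subset_range.2 h)
  rw [← Finset.sum_sdiff hsub, ← Finset.sum_sdiff hsub
    (f := fun A => (if A ⊆ Finset.range J then 0 else φ A) * ∏ j ∈ A, Z j)]
  have e1 : ∑ A ∈ (Finset.range J).powerset,
      (if A ⊆ Finset.range J then 0 else φ A) * ∏ j ∈ A, Z j = 0 :=
    Finset.sum_eq_zero fun A hA => by simp [Finset.mem_powerset.1 hA]
  rw [e1, add_zero, add_sub_cancel_right]
  refine Finset.sum_congr rfl fun A hA => ?_
  rw [if_neg fun h' => (Finset.mem_sdiff.1 hA).2 (Finset.mem_powerset.2 h')]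

/-! ### Influence factors -/

theorem supp_update {n : ℕ} (a : Fin n → Bool) (k : Fin n) :
    supp (Function.update a k true) = insert (k : ℕ) (supp a) := by
  ext x
  simp only [supp, Finset.mem_map, Finset.mem_filter, Finset.mem_univ, true_and,
    Fin.valEmbedding_apply, Finset.mem_insert]
  constructor
  · rintro ⟨j, hj, rfl⟩
    by_cases h : j = k
    · left; rw [h]
    · right; rw [Function.update_of_ne h] at hj; exact ⟨j, hj, rfl⟩
  · rintro (rfl | ⟨j, hj, rfl⟩)
    · exact ⟨k, by simp, rfl⟩
    · refine ⟨j, ?_, rfl⟩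
      by_cases h : j = k
      · subst h; simp
      · rw [Function.update_of_ne h]; exact hj

theorem cons_injective_iff {n k : ℕ} {α : Fin n → ℕ} (hα : Function.Injective α) :
    Function.Injective (Fin.cons k α : Fin (n + 1) → ℕ) ↔ k ∉ Finset.univ.image α := by
  rw [Fin.cons_injective_iff]
  simp [hα]

theorem image_cons {n k : ℕ} (α : Fin n → ℕ) :
    Finset.univ.image (Fin.cons k α : Fin (n + 1) → ℕ) = insert k (Finset.univ.image α) := by
  ext x
  simp only [Finset.mem_image, Finset.mem_univ, true_and, Finset.mem_insert, Fin.exists_fin_succ,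
    Fin.cons_zero, Fin.cons_succ]
  tauto

/-- A set containing `k` carries `(n + 1)! ^ 2` times a squared coefficient on the left, and is met
`n!` times on the right: `(n + 1)! ^ 2 = (n + 1) (n + 1)! n!`. -/
theorem sum_restr_sq_eq {c : Coeff} (hc : c.Admissible) (n J : ℕ) (k : Fin J) :
    ∑ a : Fin J → Bool, restr (fun a => phiCoeff c (n + 1) (supp a)) k a ^ 2
      = (n + 1) * (n + 1).factorial
        * ∑ α : Fin n → Fin J, c (n + 1) (Fin.cons (k : ℕ) fun i => (α i : ℕ)) ^ 2 := by
  rw [sum_symm (F := fun α : Fin n → ℕ => c (n + 1) (Fin.cons (k : ℕ) α) ^ 2)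
    (G := fun B => if (k : ℕ) ∈ B then 0 else cSet c (insert (k : ℕ) B) ^ 2)]
  · rw [sum_powersetCard_eq, ← sum_supp (n := J)
      (fun A => if A.card = n then (n.factorial : ℝ) *
        (if (k : ℕ) ∈ A then 0 else cSet c (insert (k : ℕ) A) ^ 2) else 0), Finset.mul_sum]
    have h := sum_update_eq (n := J) k false true
      (fun a => phiCoeff c (n + 1) (supp a) ^ 2)
    have e1 : ∀ a : Fin J → Bool, restr (fun a => phiCoeff c (n + 1) (supp a)) k a ^ 2
        = if a k = true then phiCoeff c (n + 1) (supp a) ^ 2 else 0 := by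
      intro a; unfold restr; split_ifs <;> simp
    simp_rw [e1]
    rw [← h]
    refine Finset.sum_congr rfl fun a _ => ?_
    by_cases hk : a k = true
    · have : (k : ℕ) ∈ supp a := mem_supp.2 hk
      simp [hk, this]
    · have hk' : (k : ℕ) ∉ supp a := fun h => hk (mem_supp.1 h)
      have hkf : a k = false := by simpa using hk
      rw [if_pos hkf, if_neg hk', supp_update, phiCoeff, Finset.card_insert_of_notMem hk']
      simp only [Nat.add_right_cancel_iff]
      split_ifs
      · rw [mul_pow, Nat.factorial_succ]; push_cast; ring
      · simp
  · intro α hα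
    by_cases hk : (k : ℕ) ∈ Finset.univ.image α
    · rw [if_pos hk, coeff_eq_zero hc (fun h => (cons_injective_iff hα).1 h hk)]; simp
    · rw [if_neg hk, cSet_image hc ((cons_injective_iff hα).2 hk), image_cons]
  · intro α hα
    rw [coeff_eq_zero hc]
    · simp
    · intro h; exact hα ((Fin.cons_injective_iff.1 h).2)

theorem summable_cons {c : Coeff} {n : ℕ} (hs : Summable fun α : Fin (n + 1) → ℕ => c (n + 1) α ^ 2)
    (k : ℕ) : Summable fun α : Fin n → ℕ => c (n + 1) (Fin.cons k α) ^ 2 :=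
  hs.comp_injective (i := fun α : Fin n → ℕ => (Fin.cons k α : Fin (n + 1) → ℕ))
    (Fin.cons_right_injective (α := fun _ => ℕ) k)

theorem delta_nonneg (c : Coeff) (l : ℕ) : 0 ≤ delta c l := by
  cases l with
  | zero => exact le_rfl
  | succ n => exact Real.iSup_nonneg fun k => Real.sqrt_nonneg _

theorem tsum_cons_le_delta {c : Coeff} {n : ℕ}
    (hs : Summable fun α : Fin (n + 1) → ℕ => c (n + 1) α ^ 2) (k : ℕ) :
    ∑' α : Fin n → ℕ, c (n + 1) (Fin.cons k α) ^ 2 ≤ delta c (n + 1) ^ 2 := by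
  have hb : BddAbove (Set.range fun k : ℕ =>
      Real.sqrt (∑' α : Fin n → ℕ, c (n + 1) (Fin.cons k α) ^ 2)) := by
    refine ⟨Real.sqrt (∑' α, c (n + 1) α ^ 2), ?_⟩
    rintro _ ⟨k, rfl⟩
    refine Real.sqrt_le_sqrt ?_
    exact (tsum_comp_le_tsum_of_inj hs (fun α => sq_nonneg _)
      (Fin.cons_right_injective (α := fun _ => ℕ) k))
  have h := le_ciSup hb k
  have h0 : 0 ≤ ∑' α : Fin n → ℕ, c (n + 1) (Fin.cons k α) ^ 2 := tsum_nonneg fun _ => sq_nonneg _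
  calc _ = Real.sqrt (∑' α : Fin n → ℕ, c (n + 1) (Fin.cons k α) ^ 2) ^ 2 := (Real.sq_sqrt h0).symm
    _ ≤ _ := pow_le_pow_left₀ (Real.sqrt_nonneg _) h 2

theorem sum_restr_phi_sq_le {c : Coeff} (hc : c.Admissible) {l : ℕ} (hl : 1 ≤ l)
    (hs : Summable fun α : Fin l → ℕ => c l α ^ 2) (J : ℕ) (k : Fin J) :
    ∑ a : Fin J → Bool, restr (fun a => phiCoeff c l (supp a)) k a ^ 2
      ≤ l * l.factorial * delta c l ^ 2 := by
  obtain ⟨n, rfl⟩ : ∃ n, l = n + 1 := ⟨l - 1, by omega⟩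
  rw [sum_restr_sq_eq hc]
  push_cast
  refine mul_le_mul_of_nonneg_left ?_ (by positivity)
  exact (sum_trunc_le (h := fun α : Fin n → ℕ => c (n + 1) (Fin.cons (k : ℕ) α) ^ 2)
    (fun _ => sq_nonneg _) (summable_cons hs k)).trans (tsum_cons_le_delta hs k)

theorem sum_restr_tot_sq_le {c : Coeff} (hc : c.Admissible) {N : ℕ}
    (hs : ∀ m, 1 ≤ m → m ≤ N → Summable fun α : Fin m → ℕ => c m α ^ 2) (J : ℕ) (k : Fin J) :
    ∑ a : Fin J → Bool, restr (fun a => totCoeff c N (supp a)) k a ^ 2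
      ≤ N * N.factorial * deltaBar c N ^ 2 := by
  have e : ∀ a : Fin J → Bool, restr (fun a => totCoeff c N (supp a)) k a ^ 2
      = ∑ l ∈ Finset.Icc 1 N, restr (fun a => phiCoeff c l (supp a)) k a ^ 2 := by
    intro a
    unfold restr
    split_ifs
    · exact totCoeff_sq c N _
    · simp
  simp_rw [e]
  rw [Finset.sum_comm]
  calc _ ≤ ∑ l ∈ Finset.Icc 1 N, (N * N.factorial : ℝ) * delta c l ^ 2 := by
        refine Finset.sum_le_sum fun l hl => ?_
        obtain ⟨h1, h2⟩ := Finset.mem_Icc.1 hl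
        refine (sum_restr_phi_sq_le hc h1 (hs l h1 h2) J k).trans ?_
        refine mul_le_mul_of_nonneg_right ?_ (sq_nonneg _)
        have := Nat.factorial_le h2
        gcongr
    _ ≤ _ := by
        rw [← Finset.mul_sum]
        refine mul_le_mul_of_nonneg_left ?_ (by positivity)
        exact Finset.sum_sq_le_sq_sum_of_nonneg fun l _ => delta_nonneg c l

theorem homPart_totCoeff (c : Coeff) {N l : ℕ} (hl : l ∈ Finset.Icc 1 N) {J : ℕ} :
    homPart (fun a : Fin J → Bool => totCoeff c N (supp a)) l
      = fun a => phiCoeff c l (supp a) := by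
  funext a
  unfold homPart
  beta_reduce
  rw [← card_supp, totCoeff_eq]
  unfold phiCoeff
  split_ifs with h1 h2
  · rw [h1]
  · rw [h1] at h2; exact absurd (Finset.mem_Icc.1 hl) h2
  · rfl

/-! ### Limits in `L^q` -/

section Limits

variable {Ω : Type*} [MeasurableSpace Ω] {P : Measure Ω}

theorem MomentBound.eLpNorm_le {q v : ℝ} (hq : 0 < q) (hv : 0 ≤ v) {X : Ω → ℝ}
    (h : MomentBound P q X v) : eLpNorm X (ENNReal.ofReal q) P ≤ ENNReal.ofReal (√v) := by
  rw [h.1.eLpNorm_eq_integral_rpow_norm (by simpa using hq) ENNReal.ofReal_ne_top,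
    ENNReal.toReal_ofReal hq.le]
  refine ENNReal.ofReal_le_ofReal ?_
  have h0 : 0 ≤ ∫ ω, |X ω| ^ q ∂P := integral_nonneg fun ω => Real.rpow_nonneg (abs_nonneg _) _
  refine (Real.rpow_le_rpow h0 h.2 (inv_nonneg.2 hq.le)).trans (le_of_eq ?_)
  rw [← Real.rpow_mul hv, Real.sqrt_eq_rpow]
  congr 1
  field_simp

/-- The increments are dominated by those of the monotone convergent sequence `t`, here the partial
sums of squared coefficients, so the sequence is Cauchy and completeness applies. -/
theorem exists_limit_of_eLpNorm_le {p : ENNReal} [Fact (1 ≤ p)] {X : ℕ → Ω → ℝ}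
    (hX : ∀ n, MemLp (X n) p P) {K T : ℝ} (hK : 0 ≤ K) {t : ℕ → ℝ} (ht : Monotone t)
    (hT : Tendsto t atTop (𝓝 T))
    (h : ∀ J I, J ≤ I → eLpNorm (X I - X J) p P ≤ ENNReal.ofReal (√(K * (t I - t J)))) :
    ∃ F : Ω → ℝ, MemLp F p P ∧ Tendsto (fun n => eLpNorm (X n - F) p P) atTop (𝓝 0) := by
  have htT : ∀ n, t n ≤ T := fun n => ht.ge_of_tendsto hT n
  have hb : Tendsto (fun n => √(K * (T - t n))) atTop (𝓝 0) := by
    have h1 : Tendsto (fun n => √(K * (T - t n))) atTop (𝓝 (√(K * (T - T)))) :=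
      ((tendsto_const_nhds.sub hT).const_mul K).sqrt
    simpa using h1
  have hd : ∀ N J I, N ≤ J → J ≤ I →
      dist ((hX I).toLp (X I)) ((hX J).toLp (X J)) ≤ √(K * (T - t N)) := by
    intro N J I hNJ hJI
    rw [dist_edist, Lp.edist_toLp_toLp]
    refine ENNReal.toReal_le_of_le_ofReal (Real.sqrt_nonneg _) ((h J I hJI).trans ?_)
    refine ENNReal.ofReal_le_ofReal (Real.sqrt_le_sqrt (mul_le_mul_of_nonneg_left ?_ hK))
    linarith [htT I, ht hNJ]
  have hc : CauchySeq fun n => (hX n).toLp (X n) := by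
    refine cauchySeq_of_le_tendsto_0 (fun n => √(K * (T - t n))) (fun n m N hn hm => ?_) hb
    rcases le_total n m with hnm | hnm
    · rw [dist_comm]; exact hd N n m hn hnm
    · exact hd N m n hm hnm
  obtain ⟨G, hG⟩ := cauchySeq_tendsto_of_complete hc
  have hG' := hG
  rw [← Lp.toLp_coeFn G (Lp.memLp G)] at hG'
  exact ⟨G, Lp.memLp G, (Lp.tendsto_Lp_iff_tendsto_eLpNorm'' X hX G (Lp.memLp G)).1 hG'⟩

theorem tendsto_integral_pow {k : ℕ} (hk : Even k) (hk0 : 1 ≤ k) {X : ℕ → Ω → ℝ} {F : Ω → ℝ}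
    (hX : ∀ n, MemLp (X n) k P) (hF : MemLp F k P)
    (h : Tendsto (fun n => eLpNorm (X n - F) k P) atTop (𝓝 0)) :
    Tendsto (fun n => ∫ ω, X n ω ^ k ∂P) atTop (𝓝 (∫ ω, F ω ^ k ∂P)) := by
  have : Fact (1 ≤ (k : ENNReal)) := ⟨by exact_mod_cast hk0⟩
  have e : ∀ G : Ω → ℝ, MemLp G k P → ∫ ω, G ω ^ k ∂P = (eLpNorm G k P).toReal ^ k := by
    intro G hG
    have h0 : 0 ≤ ∫ ω, ‖G ω‖ ^ (k : ENNReal).toReal ∂P :=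
      integral_nonneg fun ω => Real.rpow_nonneg (norm_nonneg _) _
    rw [hG.eLpNorm_eq_integral_rpow_norm (by exact_mod_cast (by omega : k ≠ 0))
      (ENNReal.natCast_ne_top k), ENNReal.toReal_ofReal (Real.rpow_nonneg h0 _),
      ← Real.rpow_natCast (_ ^ _), ← Real.rpow_mul h0]
    simp only [ENNReal.toReal_natCast]
    rw [inv_mul_cancel₀ (by exact_mod_cast (by omega : k ≠ 0)), Real.rpow_one]
    refine integral_congr_ae (ae_of_all _ fun ω => ?_)
    simp only [Real.rpow_natCast, Real.norm_eq_abs]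
    rw [hk.pow_abs]
  have h1 := (Lp.tendsto_Lp_iff_tendsto_eLpNorm'' X hX F hF).2 h
  have h2 := h1.norm.pow k
  simp_rw [Lp.norm_toLp] at h2
  rw [e F hF]
  exact h2.congr fun n => (e _ (hX n)).symm

theorem l2Lim_spec {X : ℕ → Ω → ℝ} (h : ∃ F : Ω → ℝ, MemLp F 2 P ∧
      Tendsto (fun J => eLpNorm (fun ω => X J ω - F ω) 2 P) atTop (𝓝 0)) :
    MemLp (l2Lim P X) 2 P ∧
      Tendsto (fun J => eLpNorm (fun ω => X J ω - l2Lim P X ω) 2 P) atTop (𝓝 0) := by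
  unfold l2Lim
  rw [dif_pos h]
  exact h.choose_spec

theorem ae_eq_of_tendsto_eLpNorm {p : ENNReal} (hp : 1 ≤ p) {X : ℕ → Ω → ℝ} {F G : Ω → ℝ}
    (hX : ∀ n, AEStronglyMeasurable (X n) P) (hF : AEStronglyMeasurable F P)
    (hG : AEStronglyMeasurable G P)
    (h : Tendsto (fun n => eLpNorm (X n - F) p P) atTop (𝓝 0))
    (h' : Tendsto (fun n => eLpNorm (X n - G) p P) atTop (𝓝 0)) : F =ᵐ[P] G := by
  have h0 : eLpNorm (F - G) p P = 0 := by
    refine le_antisymm ?_ bot_le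
    refine ge_of_tendsto' (by simpa using h.add h') fun n => ?_
    have e : F - G = (X n - G) - (X n - F) := by abel
    rw [e, add_comm]
    exact eLpNorm_sub_le ((hX n).sub hG) ((hX n).sub hF) hp
  rw [eLpNorm_eq_zero_iff (hF.sub hG) (by positivity)] at h0
  filter_upwards [h0] with ω hω
  simpa [sub_eq_zero] using hω

/-- The variables of a homogeneous stochastic series: independent and centred, with bounded moments
of order `q`. -/
structure IsSeq (P : Measure Ω) (q m : ℝ) (Z : ℕ → Ω → ℝ) : Prop where
  meas : ∀ j, Measurable (Z j)
  indep : iIndepFun Z P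
  mean : ∀ j, ∫ ω, Z j ω ∂P = 0
  mom : ∀ j, MomentBound P q (Z j) m

theorem IsSite.isSeq {q m : ℝ} {Z ξ : ℕ → Ω → ℝ} (h : IsSite P q m Z ξ) : IsSeq P q m Z :=
  ⟨h.meas_Z, h.indep.comp (fun _ x => x.1) fun _ => measurable_fst, h.mean_Z, h.mom_Z⟩

theorem sum_supp_sq (φ : Finset ℕ → ℝ) (n : ℕ) :
    ∑ a : Fin n → Bool, φ (supp a) ^ 2 = sqSum φ n := sum_supp fun A => φ A ^ 2

theorem IsSeq.momentBound_setPoly [IsProbabilityMeasure P] {q m : ℝ} (hq : 2 ≤ q) (hm : 1 ≤ m)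
    {Z : ℕ → Ω → ℝ} (h : IsSeq P q m Z) {N : ℕ} {φ : Finset ℕ → ℝ}
    (hφ : ∀ A, φ A ≠ 0 → A.card ≤ N) (n : ℕ) :
    MomentBound P q (fun ω => setPoly (fun k => Z k ω) n φ) (mlinConst q m ^ N * sqSum φ n) := by
  have := momentBound_mlin hq hm h.meas h.indep h.mean h.mom (n := n) (N := N)
    (f := fun a => φ (supp a)) (fun A hA => by rw [← card_supp]; exact hφ _ hA)
  rw [sum_supp_sq] at this
  have e : (fun ω => setPoly (fun k => Z k ω) n φ) = mlin Z n fun a => φ (supp a) :=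
    funext fun ω => setPoly_eq_mlin Z n φ ω
  rw [e]; exact this

theorem IsSeq.eLpNorm_setPoly_sub_le [IsProbabilityMeasure P] {q m : ℝ} (hq : 2 ≤ q) (hm : 1 ≤ m)
    {Z : ℕ → Ω → ℝ} (h : IsSeq P q m Z) {N : ℕ} {φ : Finset ℕ → ℝ}
    (hφ : ∀ A, φ A ≠ 0 → A.card ≤ N) {J I : ℕ} (hJI : J ≤ I) :
    eLpNorm ((fun ω => setPoly (fun k => Z k ω) I φ) - fun ω => setPoly (fun k => Z k ω) J φ)
      (ENNReal.ofReal q) P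
      ≤ ENNReal.ofReal (√(mlinConst q m ^ N * (sqSum φ I - sqSum φ J))) := by
  have e : (fun ω => setPoly (fun k => Z k ω) I φ) - (fun ω => setPoly (fun k => Z k ω) J φ)
      = fun ω => setPoly (fun k => Z k ω) I (fun A => if A ⊆ Finset.range J then 0 else φ A) :=
    funext fun ω => setPoly_sub _ φ hJI
  rw [e, ← sqSum_tail φ hJI]
  have hL := one_le_mlinConst hq hm
  refine (h.momentBound_setPoly hq hm (N := N) (fun A hA => hφ A ?_) I).eLpNorm_le (by linarith) ?_
  · intro h0; simp [h0] at hA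
  · exact mul_nonneg (by positivity) (Finset.sum_nonneg fun _ _ => sq_nonneg _)

theorem IsSeq.exists_limit_setPoly [IsProbabilityMeasure P] {q m : ℝ} (hq : 2 ≤ q) (hm : 1 ≤ m)
    {Z : ℕ → Ω → ℝ} (h : IsSeq P q m Z) {N : ℕ} {φ : Finset ℕ → ℝ}
    (hφ : ∀ A, φ A ≠ 0 → A.card ≤ N) {T : ℝ} (hT : Tendsto (sqSum φ) atTop (𝓝 T)) :
    ∃ F : Ω → ℝ, MemLp F (ENNReal.ofReal q) P ∧ Tendsto (fun n => eLpNorm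
      ((fun ω => setPoly (fun k => Z k ω) n φ) - F) (ENNReal.ofReal q) P) atTop (𝓝 0) := by
  have : Fact (1 ≤ ENNReal.ofReal q) := ⟨by
    rw [← ENNReal.ofReal_one]; exact ENNReal.ofReal_le_ofReal (by linarith)⟩
  have hL := one_le_mlinConst hq hm
  exact exists_limit_of_eLpNorm_le (fun n => (h.momentBound_setPoly hq hm hφ n).1)
    (by positivity) (sqSum_mono φ) hT fun J I hJI => h.eLpNorm_setPoly_sub_le hq hm hφ hJI

omit [MeasurableSpace Ω] in
theorem partialPhi_eq_setPoly {c : Coeff} (hc : c.Admissible) (Z : ℕ → Ω → ℝ) (m J : ℕ) :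
    partialPhi c Z m J = fun ω => setPoly (fun k => Z k ω) J (phiCoeff c m) :=
  funext fun ω => partialPhi_eq hc Z m J ω

theorem tendsto_eLpNorm_two {q : ℝ} (hq : 2 ≤ q) [IsProbabilityMeasure P] {X : ℕ → Ω → ℝ}
    (hX : ∀ n, AEStronglyMeasurable (X n) P)
    (h : Tendsto (fun n => eLpNorm (X n) (ENNReal.ofReal q) P) atTop (𝓝 0)) :
    Tendsto (fun n => eLpNorm (X n) 2 P) atTop (𝓝 0) := by
  refine tendsto_of_tendsto_of_tendsto_of_le_of_le tendsto_const_nhds h (fun _ => bot_le) fun n => ?_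
  refine eLpNorm_le_eLpNorm_of_exponent_le ?_ (hX n)
  rw [← ENNReal.ofReal_ofNat]
  exact ENNReal.ofReal_le_ofReal hq

/-- The homogeneous series converges in `L^q`. -/
theorem IsSeq.tendsto_Phi [IsProbabilityMeasure P] {q m : ℝ} (hq : 2 ≤ q) (hm : 1 ≤ m)
    {Z : ℕ → Ω → ℝ} (h : IsSeq P q m Z) {c : Coeff} (hc : c.Admissible) {l : ℕ}
    (hs : Summable fun α : Fin l → ℕ => c l α ^ 2) :
    MemLp (Phi P c Z l) (ENNReal.ofReal q) P ∧ Tendsto (fun n => eLpNorm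
      ((fun ω => setPoly (fun k => Z k ω) n (phiCoeff c l)) - Phi P c Z l) (ENNReal.ofReal q) P)
      atTop (𝓝 0) := by
  have hφ : ∀ A, phiCoeff c l A ≠ 0 → A.card ≤ l := fun A hA => (phiCoeff_ne_zero hA).le
  obtain ⟨F, hF, hlim⟩ := h.exists_limit_setPoly hq hm hφ (tendsto_sqSum_phiCoeff hc hs)
  have hq2 : (2 : ENNReal) ≤ ENNReal.ofReal q := by
    rw [← ENNReal.ofReal_ofNat]; exact ENNReal.ofReal_le_ofReal hq
  have hX : ∀ n, MemLp (fun ω => setPoly (fun k => Z k ω) n (phiCoeff c l)) (ENNReal.ofReal q) P :=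
    fun n => (h.momentBound_setPoly hq hm hφ n).1
  have hlim2 := tendsto_eLpNorm_two hq (fun n => ((hX n).sub hF).aestronglyMeasurable) hlim
  have hF2 : MemLp F 2 P := hF.mono_exponent hq2
  have hex : ∃ F : Ω → ℝ, MemLp F 2 P ∧
      Tendsto (fun J => eLpNorm (fun ω => partialPhi c Z l J ω - F ω) 2 P) atTop (𝓝 0) := by
    refine ⟨F, hF2, ?_⟩
    simp_rw [partialPhi_eq_setPoly hc]
    exact hlim2
  obtain ⟨h1, h2⟩ := l2Lim_spec hex
  -- `Phi` is an arbitrary choice among the `L²` limits. The `L^q` limit is one of them, so the two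
  -- agree almost surely and the convergence holds in `L^q` towards `Phi`.
  have hae : F =ᵐ[P] Phi P c Z l := by
    refine ae_eq_of_tendsto_eLpNorm one_le_two (fun n => (hX n).aestronglyMeasurable)
      hF.aestronglyMeasurable h1.aestronglyMeasurable hlim2 (h2.congr fun n => ?_)
    rw [partialPhi_eq_setPoly hc]
    rfl
  refine ⟨(memLp_congr_ae hae).1 hF, hlim.congr fun n => eLpNorm_congr_ae ?_⟩
  filter_upwards [hae] with ω hω
  simp [hω]

/-- The Gaussian series converges in `L^4`, so the second and fourth moments pass to the limit. The
contraction bound for truncations is thereby transferred to `κ_{4,l}(c)`. -/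
theorem tendsto_cumulant4 {c : Coeff} (hc : c.Admissible) {l : ℕ}
    (hs : Summable fun α : Fin l → ℕ => c l α ^ 2) :
    Tendsto (fun n => cumulant4 gaussSeq (mlin coordSeq n fun a => phiCoeff c l (supp a))) atTop
      (𝓝 (kappa4 c l)) := by
  obtain ⟨m, hm, h⟩ := exists_isSite_gauss (q := 4) (by norm_num)
  have hS := h.isSeq
  obtain ⟨h1, h2⟩ := hS.tendsto_Phi (by norm_num) hm hc hs
  have e : ∀ n, (fun ω => setPoly (fun k => coordSeq k ω) n (phiCoeff c l))
      = mlin coordSeq n fun a => phiCoeff c l (supp a) :=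
    fun n => funext fun ω => setPoly_eq_mlin coordSeq n _ ω
  have hφ : ∀ A, phiCoeff c l A ≠ 0 → A.card ≤ l := fun A hA => (phiCoeff_ne_zero hA).le
  have hX : ∀ n, MemLp (mlin coordSeq n fun a => phiCoeff c l (supp a)) (ENNReal.ofReal 4)
      gaussSeq := fun n => e n ▸ (hS.momentBound_setPoly (by norm_num) hm hφ n).1
  replace h2 := h2.congr fun n => by rw [e n]
  have h3 := tendsto_eLpNorm_two (by norm_num)
    (fun n => ((hX n).sub h1).aestronglyMeasurable) h2
  have e4 : ENNReal.ofReal 4 = ((4 : ℕ) : ENNReal) := by norm_num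
  have e2 : (2 : ENNReal) = ((2 : ℕ) : ENNReal) := by norm_num
  have h24 : ((2 : ℕ) : ENNReal) ≤ ENNReal.ofReal 4 := by
    rw [e4]; exact_mod_cast (by norm_num : 2 ≤ 4)
  have t2 := tendsto_integral_pow (k := 2) (by decide) (by norm_num)
    (fun n => (hX n).mono_exponent h24) (h1.mono_exponent h24) (by rw [← e2]; exact h3)
  rw [e4] at h1 h2
  simp_rw [e4] at hX
  have t4 := tendsto_integral_pow (k := 4) (by decide) (by norm_num) hX h1 h2
  unfold kappa4 cumulant4
  exact t4.sub ((t2.pow 2).const_mul 3)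

theorem contrSq_nonneg {n : ℕ} (f : (Fin n → Bool) → ℝ) (l : ℕ) : 0 ≤ contrSq f l :=
  Finset.sum_nonneg fun _ _ => Finset.sum_nonneg fun _ _ => by split_ifs <;> positivity

theorem contrSq_phiCoeff_le (c : Coeff) {l : ℕ} (hl : 1 ≤ l) (n : ℕ) :
    contrSq (fun a : Fin n → Bool => phiCoeff c l (supp a)) l
      ≤ cumulant4 gaussSeq (mlin coordSeq n fun a => phiCoeff c l (supp a)) :=
  contrSq_le_cumulant hl fun A hA => by rw [← card_supp]; exact phiCoeff_ne_zero hA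

theorem kappa4_nonneg {c : Coeff} (hc : c.Admissible) {l : ℕ} (hl : 1 ≤ l)
    (hs : Summable fun α : Fin l → ℕ => c l α ^ 2) : 0 ≤ kappa4 c l :=
  ge_of_tendsto' (tendsto_cumulant4 hc hs) fun n =>
    (contrSq_nonneg _ _).trans (contrSq_phiCoeff_le c hl n)

end Limits

/-! ### Closability in one variable -/

/-- From `|f| ≤ t + t⁻¹ f ^ 2` and the lower bound of the weight on `K`: a weighted `L²` norm at
most `t` gives an `L¹` norm on `K` of order `t`. -/
theorem integrableOn_of_weighted_sq {w f : ℝ → ℝ} (hw : Measurable w) (hf : Measurable f)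
    {K : Set ℝ} (hK : IsCompact K) {c t : ℝ} (hc : 0 < c) (hcw : ∀ x ∈ K, c ≤ w x) (ht : 0 < t)
    (h : ∫⁻ x, ENNReal.ofReal (f x ^ 2) ∂volume.withDensity (fun x => ENNReal.ofReal (w x))
      ≤ ENNReal.ofReal (t ^ 2)) :
    IntegrableOn f K ∧ ∫ x in K, |f x| ≤ t * (volume.real K + c⁻¹) := by
  have hKm := hK.measurableSet
  have h1 : ∫⁻ x in K, ‖f x‖ₑ ≤ ENNReal.ofReal (t * (volume.real K + c⁻¹)) := by
    have e1 : ∫⁻ x in K, ‖f x‖ₑ ≤ ∫⁻ x in K, (ENNReal.ofReal t + ENNReal.ofReal (t⁻¹ * c⁻¹) *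
        (ENNReal.ofReal (w x) * ENNReal.ofReal (f x ^ 2))) := by
      refine setLIntegral_mono' hKm fun x hx => ?_
      have hwx := hcw x hx
      have hw0 : 0 ≤ w x := hc.le.trans hwx
      rw [← ENNReal.ofReal_mul hw0, ← ENNReal.ofReal_mul (by positivity),
        ← ENNReal.ofReal_add ht.le (by positivity), ← ofReal_norm, Real.norm_eq_abs]
      refine ENNReal.ofReal_le_ofReal ?_
      have e2 : t⁻¹ * f x ^ 2 ≤ t⁻¹ * c⁻¹ * (w x * f x ^ 2) := by
        have : 1 ≤ c⁻¹ * w x := by rw [inv_mul_eq_div, one_le_div hc]; exact hwx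
        have h0 : 0 ≤ t⁻¹ * f x ^ 2 := by positivity
        nlinarith [mul_le_mul_of_nonneg_left this h0]
      have e3 : |f x| ≤ t + t⁻¹ * f x ^ 2 := by
        have : |f x| * t ≤ (t + t⁻¹ * f x ^ 2) * t := by
          have : (t + t⁻¹ * f x ^ 2) * t = t ^ 2 + f x ^ 2 := by field_simp
          rw [this, ← sq_abs (f x)]
          nlinarith [sq_nonneg (|f x| - t), abs_nonneg (f x), mul_nonneg (abs_nonneg (f x)) ht.le]
        exact le_of_mul_le_mul_right this ht
      linarith
    refine e1.trans ?_
    rw [lintegral_add_left measurable_const, lintegral_const_mul _ (by fun_prop)]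
    rw [lintegral_withDensity_eq_lintegral_mul _ (by fun_prop) (by fun_prop)] at h
    have e4 := (setLIntegral_le_lintegral K
      (fun x => ENNReal.ofReal (w x) * ENNReal.ofReal (f x ^ 2))).trans h
    rw [setLIntegral_const, ← ofReal_measureReal hK.measure_lt_top.ne, ← ENNReal.ofReal_mul ht.le]
    refine (add_le_add_right (mul_le_mul_right e4 _) _).trans ?_
    rw [← ENNReal.ofReal_mul (by positivity), ← ENNReal.ofReal_add (by positivity) (by positivity)]
    refine ENNReal.ofReal_le_ofReal (le_of_eq ?_)
    field_simp
  refine ⟨⟨hf.aestronglyMeasurable, h1.trans_lt ENNReal.ofReal_lt_top⟩, ?_⟩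
  have : ∫ x in K, |f x| = (∫⁻ x in K, ‖f x‖ₑ).toReal :=
    integral_norm_eq_lintegral_enorm hf.aestronglyMeasurable
  rw [this]
  exact ENNReal.toReal_le_of_le_ofReal (by positivity) h1

/-- A derivative operator on a weighted `L²` space over an open set is closable. -/
theorem ae_eq_zero_of_approx_deriv {w h : ℝ → ℝ} (hw : Measurable w) (hh : Measurable h)
    {S : Set ℝ} (hS : IsOpen S) (hwS : ∀ x, x ∉ S → w x = 0)
    (hwK : ∀ K, IsCompact K → K ⊆ S → ∃ c : ℝ, 0 < c ∧ ∀ x ∈ K, c ≤ w x)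
    (H : ∀ t : ℝ, 0 < t → ∃ g g' : ℝ → ℝ, (∀ x, HasDerivAt g (g' x) x) ∧ Continuous g' ∧
      ∫⁻ x, ENNReal.ofReal (g x ^ 2) ∂volume.withDensity (fun x => ENNReal.ofReal (w x))
        ≤ ENNReal.ofReal (t ^ 2) ∧
      ∫⁻ x, ENNReal.ofReal ((g' x - h x) ^ 2) ∂volume.withDensity (fun x => ENNReal.ofReal (w x))
        ≤ ENNReal.ofReal (t ^ 2)) :
    ∀ᵐ x ∂volume.withDensity (fun x => ENNReal.ofReal (w x)), h x = 0 := by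
  have hloc : ∀ K, IsCompact K → K ⊆ S → IntegrableOn h K := by
    intro K hK hKS
    obtain ⟨c, hc, hcw⟩ := hwK K hK hKS
    obtain ⟨g, g', hg, hg', -, h2⟩ := H 1 one_pos
    have := (integrableOn_of_weighted_sq hw (hg'.measurable.sub hh) hK hc hcw one_pos h2).1
    have h3 : IntegrableOn g' K := hg'.continuousOn.integrableOn_compact hK
    exact (h3.sub this).congr (ae_of_all _ fun x => by simp)
  have key : ∀ᵐ x, x ∈ S → h x = 0 := by
    refine hS.ae_eq_zero_of_integral_contDiff_smul_eq_zero
      ((locallyIntegrableOn_iff hS.isLocallyClosed).2 fun K hKS hK => hloc K hK hKS)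
      fun φ hφ hφc hφS => ?_
    set K := tsupport φ with hKdef
    have hK : IsCompact K := hφc
    obtain ⟨c, hc, hcw⟩ := hwK K hK hφS
    have hφ' : Continuous (deriv φ) := hφ.continuous_deriv (by simp)
    obtain ⟨B, hB⟩ := hφ.continuous.bounded_above_of_compact_support hφc
    obtain ⟨B', hB'⟩ := hφ'.bounded_above_of_compact_support hφc.deriv
    have hB0 : 0 ≤ B := (norm_nonneg _).trans (hB 0)
    have hB0' : 0 ≤ B' := (norm_nonneg _).trans (hB' 0)
    have hz : ∀ x, x ∉ K → φ x = 0 := fun x hx => image_eq_zero_of_notMem_tsupport hx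
    have hz' : ∀ x, x ∉ K → deriv φ x = 0 := fun x hx =>
      Function.notMem_support.1 fun h0 => hx (support_deriv_subset h0)
    have hbd : ∀ (ψ f : ℝ → ℝ) (b : ℝ), 0 ≤ b → (∀ x, ‖ψ x‖ ≤ b) → (∀ x, x ∉ K → ψ x = 0) →
        IntegrableOn f K → |∫ x, ψ x * f x| ≤ b * ∫ x in K, |f x| := by
      intro ψ f b hb hψ hψ0 hf
      rw [← setIntegral_eq_integral_of_forall_compl_eq_zero (s := K)
        (fun x hx => by rw [hψ0 x hx, zero_mul]), ← integral_const_mul]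
      refine (norm_integral_le_integral_norm fun x => ψ x * f x).trans ?_
      refine integral_mono_of_nonneg (ae_of_all _ fun _ => norm_nonneg _)
        (hf.abs.const_mul b) (ae_of_all _ fun x => ?_)
      simp only [norm_mul, Real.norm_eq_abs]
      exact mul_le_mul_of_nonneg_right (hψ x) (abs_nonneg _)
    set D := volume.real K + c⁻¹ with hD
    have hD0 : 0 ≤ D := by positivity
    -- Integration by parts gives `∫ φ h = -∫ φ' g - ∫ φ (g' - h)`, and both terms are of order `t`
    -- on the support of `φ`.
    have main : ∀ t : ℝ, 0 < t → |∫ x, φ x • h x| ≤ t * ((B + B') * D) := by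
      intro t ht
      obtain ⟨g, g', hg, hg', h1, h2⟩ := H t ht
      have hgc : Continuous g := continuous_iff_continuousAt.2 fun x => (hg x).continuousAt
      obtain ⟨i1, j1⟩ := integrableOn_of_weighted_sq hw hgc.measurable hK hc hcw ht h1
      obtain ⟨i2, j2⟩ := integrableOn_of_weighted_sq hw (hg'.measurable.sub hh) hK hc hcw ht h2
      have c1 : Integrable (fun x => φ x * g' x) :=
        (hφ.continuous.mul hg').integrable_of_hasCompactSupport hφc.mul_right
      have c2 : Integrable (deriv φ * g) :=
        (hφ'.mul hgc).integrable_of_hasCompactSupport hφc.deriv.mul_right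
      have c3 : Integrable (φ * g) :=
        (hφ.continuous.mul hgc).integrable_of_hasCompactSupport hφc.mul_right
      have ibp := integral_mul_deriv_eq_deriv_mul_of_integrable (u := φ) (v := g) (u' := deriv φ)
        (v' := g') (fun x _ => (hφ.differentiable (by simp) x).hasDerivAt) (fun x _ => hg x)
        c1 c2 c3
      have c4 : Integrable (fun x => φ x * (g' x - h x)) := by
        have : IntegrableOn (fun x => φ x * (g' x - h x)) K :=
          i2.continuousOn_mul hφ.continuous.continuousOn hK
        exact this.integrable_of_forall_notMem_eq_zero fun x hx => by rw [hz x hx, zero_mul]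
      have e : ∫ x, φ x • h x = -(∫ x, deriv φ x * g x) - ∫ x, φ x * (g' x - h x) := by
        rw [← ibp, ← integral_sub c1 c4]
        refine integral_congr_ae (ae_of_all _ fun x => ?_)
        simp only [smul_eq_mul]
        ring
      rw [e]
      have b1 := hbd _ _ B' hB0' hB' hz' i1
      have b2 := hbd _ _ B hB0 hB hz i2
      have b3 := mul_le_mul_of_nonneg_left j1 hB0'
      have b4 := mul_le_mul_of_nonneg_left j2 hB0
      simp only [Pi.sub_apply] at b2 b4
      refine (abs_sub _ _).trans ?_
      rw [abs_neg]
      nlinarith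
    have h0 : Tendsto (fun t : ℝ => t * ((B + B') * D)) (𝓝[>] 0) (𝓝 0) := by
      have : Tendsto (fun t : ℝ => t * ((B + B') * D)) (𝓝 0) (𝓝 (0 * ((B + B') * D))) :=
        tendsto_id.mul_const _
      rw [zero_mul] at this
      exact this.mono_left nhdsWithin_le_nhds
    have := ge_of_tendsto h0 (eventually_mem_nhdsWithin.mono fun t ht => main t ht)
    exact abs_nonpos_iff.1 this
  rw [ae_withDensity_iff (by fun_prop)]
  filter_upwards [key] with x hx hne
  by_cases hxS : x ∈ S
  · exact hx hxS
  · exact absurd (by simp [hwS x hxS]) hne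

/-! ### The cut-off `ψ_r` -/

theorem measurable_psi (r : ℝ) : Measurable (psi r) := by
  unfold psi theta
  refine Measurable.ite (measurableSet_le (by fun_prop) (by fun_prop)) measurable_const
    (Measurable.ite (measurableSet_lt (by fun_prop) (by fun_prop)) ?_ measurable_const)
  fun_prop

theorem psi_nonneg (r t : ℝ) : 0 ≤ psi r t := by
  unfold psi
  split_ifs <;> positivity

theorem psi_eq_zero {r t : ℝ} (hr : 0 < r) (ht : 2 * r ≤ t) : psi r t = 0 := by
  unfold psi
  rw [abs_of_nonneg (by linarith), if_neg (by linarith), if_neg (by linarith)]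

/-- `θ_r` is nonpositive and nonincreasing on `[r, 2 r)`. The resulting bound keeps the density of
`V_k` away from zero on compact subsets of `{(ξ - z_k)^2 < 2 r}`. -/
theorem psi_lower {r T t : ℝ} (hr : 0 < r) (hT : r ≤ T) (hT2 : T < 2 * r) (ht0 : 0 ≤ t)
    (ht : t ≤ T) : Real.exp (theta r T) ≤ psi r t := by
  have hx : 0 ≤ T / r - 1 := by rw [sub_nonneg, one_le_div hr]; exact hT
  have hx1 : T / r - 1 < 1 := by
    have : T / r < 2 := by rw [div_lt_iff₀ hr]; exact hT2
    linarith
  have hd : 0 < 1 - (T / r - 1) ^ 2 := by nlinarith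
  unfold psi
  rw [abs_of_nonneg ht0]
  split_ifs with h1 h2
  · rw [Real.exp_le_one_iff]
    unfold theta
    rw [sub_nonpos, one_le_div hd]
    nlinarith [sq_nonneg (T / r - 1)]
  · refine Real.exp_le_exp.2 ?_
    unfold theta
    have hy : 0 ≤ t / r - 1 := by rw [sub_nonneg, one_le_div hr]; linarith
    have hyx : t / r - 1 ≤ T / r - 1 := by gcongr
    have : (t / r - 1) ^ 2 ≤ (T / r - 1) ^ 2 := by gcongr
    have := one_div_le_one_div_of_le hd (by linarith : 1 - (T / r - 1) ^ 2 ≤ 1 - (t / r - 1) ^ 2)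
    linarith
  · linarith

/-! ### Closability of the derivative -/

section Closable

variable {Ω : Type*} [MeasurableSpace Ω] {P : Measure Ω}

theorem eLpNorm_two_eq (f : Ω → ℝ) :
    eLpNorm f 2 P = (∫⁻ ω, ENNReal.ofReal (f ω ^ 2) ∂P) ^ (1 / 2 : ℝ) := by
  rw [eLpNorm_eq_lintegral_rpow_enorm_toReal (by norm_num) (by norm_num)]
  simp only [ENNReal.toReal_ofNat, ENNReal.rpow_ofNat]
  congr 2 with ω
  rw [← ofReal_norm, ← ENNReal.ofReal_pow (norm_nonneg _), Real.norm_eq_abs, sq_abs]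

theorem tendsto_eLpNorm_two_iff {f : ℕ → Ω → ℝ} :
    Tendsto (fun n => eLpNorm (f n) 2 P) atTop (𝓝 0) ↔
      Tendsto (fun n => ∫⁻ ω, ENNReal.ofReal (f n ω ^ 2) ∂P) atTop (𝓝 0) := by
  simp_rw [eLpNorm_two_eq]
  constructor <;> intro h
  · have := h.ennrpow_const 2
    rw [ENNReal.zero_rpow_of_pos two_pos] at this
    refine this.congr fun n => ?_
    rw [← ENNReal.rpow_mul, one_div, inv_mul_cancel₀ two_ne_zero, ENNReal.rpow_one]
  · have := h.ennrpow_const (1 / 2)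
    rwa [ENNReal.zero_rpow_of_pos one_half_pos] at this

theorem hasDerivAt_eval_mvPolynomial {ζ : ℝ → ℕ → ℝ} {k : ℕ} {a v : ℝ}
    (hζ : HasDerivAt (fun v => ζ v k) a v) (hj : ∀ j, j ≠ k → ∀ v', ζ v' j = ζ v j)
    (Q : MvPolynomial ℕ ℝ) :
    HasDerivAt (fun v => MvPolynomial.eval (ζ v) Q)
      (a * MvPolynomial.eval (ζ v) (MvPolynomial.pderiv k Q)) v := by
  induction Q using MvPolynomial.induction_on with
  | C c => simpa using hasDerivAt_const v c
  | add p q hp hq =>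
    simp only [map_add, mul_add]
    exact hp.add hq
  | mul_X p j hp =>
    have hX : HasDerivAt (fun v => ζ v j) (if j = k then a else 0) v := by
      split_ifs with h
      · rw [h]; exact hζ
      · simp_rw [hj j h]; exact hasDerivAt_const _ _
    simp only [map_mul, MvPolynomial.eval_X, Derivation.leibniz, MvPolynomial.pderiv_X,
      smul_eq_mul, map_add]
    refine (hp.mul hX).congr_deriv ?_
    by_cases h : j = k
    · subst h; simp; ring
    · simp [h]; ring

/-- The values of the splitting variables, `V_k` being given separately. -/
def glue (k : ℕ) (y : {i : ℕ × Fin 3 // i ≠ (k, 1)} → ℝ) (v : ℝ) (i : ℕ × Fin 3) : ℝ :=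
  if h : i = (k, 1) then v else y ⟨i, h⟩

/-- The sequence made of its splitting. -/
def splitSeq (x : ℕ × Fin 3 → ℝ) (j : ℕ) : ℝ := x (j, 0) * x (j, 1) + (1 - x (j, 0)) * x (j, 2)

theorem measurable_glue (k : ℕ) (i : ℕ × Fin 3) :
    Measurable fun p : ({i : ℕ × Fin 3 // i ≠ (k, 1)} → ℝ) × ℝ => glue k p.1 p.2 i := by
  unfold glue
  split_ifs <;> fun_prop

theorem measurable_eval_splitSeq (k : ℕ) (Q : MvPolynomial ℕ ℝ) :
    Measurable fun p : ({i : ℕ × Fin 3 // i ≠ (k, 1)} → ℝ) × ℝ =>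
      MvPolynomial.eval (splitSeq (glue k p.1 p.2)) Q := by
  refine (MvPolynomial.continuous_eval Q).measurable.comp (measurable_pi_lambda _ fun j => ?_)
  unfold splitSeq
  have := measurable_glue k
  exact ((this _).mul (this _)).add ((measurable_const.sub (this _)).mul (this _))

theorem splitSeq_glue_of_ne {k j : ℕ} (h : j ≠ k) (y : {i : ℕ × Fin 3 // i ≠ (k, 1)} → ℝ)
    (v v' : ℝ) : splitSeq (glue k y v) j = splitSeq (glue k y v') j := by
  simp [splitSeq, glue, h]

theorem hasDerivAt_splitSeq_glue (k : ℕ) (y : {i : ℕ × Fin 3 // i ≠ (k, 1)} → ℝ) (v : ℝ) :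
    HasDerivAt (fun v => splitSeq (glue k y v) k) (glue k y v (k, 0)) v := by
  have h1 : ∀ v, splitSeq (glue k y v) k
      = y ⟨(k, 0), by simp⟩ * v + (1 - y ⟨(k, 0), by simp⟩) * y ⟨(k, 2), by simp⟩ := by
    intro v; simp [splitSeq, glue]
  have h2 : glue k y v (k, 0) = y ⟨(k, 0), by simp⟩ := by simp [glue]
  simp_rw [h1, h2]
  exact (((hasDerivAt_id' v).const_mul _).add_const _).congr_deriv (mul_one _)

variable {r ε : ℝ} {z : ℕ → ℝ} {Z χ V U : ℕ → Ω → ℝ}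

/-- The splitting variables as a single family. -/
def splitVar (χ V U : ℕ → Ω → ℝ) (i : ℕ × Fin 3) : Ω → ℝ := ![χ i.1, V i.1, U i.1] i.2

theorem IsSplitting.measurable_splitVar (h : IsSplitting P r ε z Z χ V U) (i : ℕ × Fin 3) :
    Measurable (splitVar χ V U i) := by
  obtain ⟨j, i⟩ := i
  fin_cases i
  · exact h.measurable_chi j
  · exact h.measurable_V j
  · exact h.measurable_U j

theorem IsSplitting.map_prod [IsProbabilityMeasure P] (h : IsSplitting P r ε z Z χ V U) (k : ℕ) :
    P.map (fun ω => ((fun i : {i : ℕ × Fin 3 // i ≠ (k, 1)} => splitVar χ V U i ω), V k ω))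
      = (P.map fun ω (i : {i : ℕ × Fin 3 // i ≠ (k, 1)}) => splitVar χ V U i ω).prod
        (P.map (V k)) := by
  have hm := h.measurable_splitVar
  refine (indepFun_iff_map_prod_eq_prod_map_map (μ := P)
    (measurable_pi_lambda _ fun i : {i : ℕ × Fin 3 // i ≠ (k, 1)} => hm i).aemeasurable
    (h.measurable_V k).aemeasurable).1 ?_
  refine IndepFun.process_indepFun (fun i => hm i) (h.measurable_V k) fun I => ?_
  have hi : iIndepFun (splitVar χ V U) P := h.indep
  classical
  have hd : Disjoint (I.map (Function.Embedding.subtype _)) {(k, (1 : Fin 3))} := by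
    rw [Finset.disjoint_singleton_right]; simp
  have h1 := hi.indepFun_finset _ _ hd hm
  exact h1.comp
    (φ := fun x (i : I) => x ⟨i.1.1, Finset.mem_map_of_mem (Function.Embedding.subtype _) i.2⟩)
    (ψ := fun x => x ⟨(k, 1), Finset.mem_singleton_self _⟩)
    (measurable_pi_lambda _ fun i => measurable_pi_apply _)
    (measurable_pi_apply (X := fun _ : ({(k, 1)} : Finset (ℕ × Fin 3)) => ℝ)
      ⟨(k, 1), Finset.mem_singleton_self _⟩)

/-- `Ω` may carry more randomness than the splitting variables. A limit in `L²` of functions of `W`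
is an almost sure limit along a subsequence, hence itself a function of `W`, to which Fubini can be
applied. -/
theorem exists_measurable_factor {E : Type*} [MeasurableSpace E] {W : Ω → E} (hW : Measurable W)
    {f : ℕ → E → ℝ} (hf : ∀ n, Measurable (f n)) {H : Ω → ℝ} (hH : AEStronglyMeasurable H P)
    (h : Tendsto (fun n => ∫⁻ ω, ENNReal.ofReal ((f n (W ω) - H ω) ^ 2) ∂P) atTop (𝓝 0)) :
    ∃ g : E → ℝ, Measurable g ∧ H =ᵐ[P] g ∘ W := by
  have h1 : Tendsto (fun n => eLpNorm ((f n ∘ W) - H) 2 P) atTop (𝓝 0) :=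
    tendsto_eLpNorm_two_iff.2 h
  obtain ⟨ns, -, hns⟩ := (tendstoInMeasure_of_tendsto_eLpNorm two_ne_zero
    (fun n => ((hf n).comp hW).aestronglyMeasurable) hH h1).exists_seq_tendsto_ae
  have h2 : ∀ᵐ x ∂P.map W, ∃ l : ℝ, Tendsto (fun i => f (ns i) x) atTop (𝓝 l) := by
    rw [ae_map_iff hW.aemeasurable
      (measurableSet_exists_tendsto fun i => hf (ns i))]
    filter_upwards [hns] with ω hω
    exact ⟨_, hω⟩
  obtain ⟨g, hg, hlim⟩ := measurable_limit_of_tendsto_metrizable_ae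
    (fun i => (hf (ns i)).aemeasurable) h2
  refine ⟨g, hg, ?_⟩
  filter_upwards [hns, ae_of_ae_map hW.aemeasurable hlim] with ω h3 h4
  exact tendsto_nhds_unique h3 h4

/-- Closability of `D_k`. With all splitting variables but `V_k` frozen, `Z_k` is affine in `V_k`
with slope `χ_k` and the other `Z_j` are constant, so `D_k` is the ordinary derivative in `V_k`. The
one-variable statement applies for almost every value of the frozen variables. -/
theorem IsSplitting.ae_eq_zero_of_tendsto [IsProbabilityMeasure P] (hr : 0 < r)
    (h : IsSplitting P r ε z Z χ V U) (hmass : 0 < mass r) {R : ℕ → MvPolynomial ℕ ℝ} {k : ℕ}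
    {H : Ω → ℝ} (hH : AEStronglyMeasurable H P)
    (h1 : Tendsto (fun n => ∫⁻ ω, ENNReal.ofReal (simpleFunctional Z (R n) ω ^ 2) ∂P)
      atTop (𝓝 0))
    (h2 : Tendsto (fun n => ∫⁻ ω, ENNReal.ofReal ((simpleDeriv χ Z (R n) k ω - H ω) ^ 2) ∂P)
      atTop (𝓝 0)) :
    H =ᵐ[P] 0 := by
  set Y : Ω → {i : ℕ × Fin 3 // i ≠ (k, 1)} → ℝ := fun ω i => splitVar χ V U i ω with hY
  have hYm : Measurable Y := measurable_pi_lambda _ fun i => h.measurable_splitVar i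
  set W : Ω → ({i : ℕ × Fin 3 // i ≠ (k, 1)} → ℝ) × ℝ := fun ω => (Y ω, V k ω) with hWdef
  have hW : Measurable W := hYm.prodMk (h.measurable_V k)
  have hglue : ∀ ω i, glue k (W ω).1 (W ω).2 i = splitVar χ V U i ω := by
    intro ω i
    unfold glue
    split_ifs with hi
    · subst hi; rfl
    · rfl
  set g : ℕ → ({i : ℕ × Fin 3 // i ≠ (k, 1)} → ℝ) × ℝ → ℝ :=
    fun n p => MvPolynomial.eval (splitSeq (glue k p.1 p.2)) (R n) with hg
  set g' : ℕ → ({i : ℕ × Fin 3 // i ≠ (k, 1)} → ℝ) × ℝ → ℝ := fun n p => glue k p.1 p.2 (k, 0) *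
    MvPolynomial.eval (splitSeq (glue k p.1 p.2)) (MvPolynomial.pderiv k (R n)) with hg'
  have hgm : ∀ n, Measurable (g n) := fun n => measurable_eval_splitSeq k _
  have hgm' : ∀ n, Measurable (g' n) := fun n =>
    (measurable_glue k _).mul (measurable_eval_splitSeq k _)
  have hZ : ∀ᵐ ω ∂P, splitSeq (glue k (W ω).1 (W ω).2) = fun j => Z j ω := by
    filter_upwards [ae_all_iff.2 h.eq_split] with ω hω
    funext j
    rw [hω j]
    simp [splitSeq, hglue, splitVar]
  have e1 : ∀ n, ∫⁻ ω, ENNReal.ofReal (simpleFunctional Z (R n) ω ^ 2) ∂P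
      = ∫⁻ p, ENNReal.ofReal (g n p ^ 2) ∂P.map W := by
    intro n
    rw [lintegral_map (by fun_prop) hW]
    refine lintegral_congr_ae ?_
    filter_upwards [hZ] with ω hω
    simp only [hg, hω, simpleFunctional]
  have e2 : ∀ᵐ ω ∂P, ∀ n, simpleDeriv χ Z (R n) k ω = g' n (W ω) := by
    filter_upwards [hZ] with ω hω n
    simp only [hg', hω, simpleDeriv, hglue, splitVar]
    rfl
  have e3 : ∀ n, ∫⁻ ω, ENNReal.ofReal ((simpleDeriv χ Z (R n) k ω - H ω) ^ 2) ∂P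
      = ∫⁻ ω, ENNReal.ofReal ((g' n (W ω) - H ω) ^ 2) ∂P := by
    intro n
    refine lintegral_congr_ae ?_
    filter_upwards [e2] with ω hω
    rw [hω n]
  simp_rw [e3] at h2
  obtain ⟨h', hm', hHh⟩ := exists_measurable_factor hW hgm' hH h2
  have e4 : ∀ n, ∫⁻ ω, ENNReal.ofReal ((g' n (W ω) - H ω) ^ 2) ∂P
      = ∫⁻ p, ENNReal.ofReal ((g' n p - h' p) ^ 2) ∂P.map W := by
    intro n
    rw [lintegral_map (by fun_prop) hW]
    refine lintegral_congr_ae ?_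
    filter_upwards [hHh] with ω hω
    rw [hω]; rfl
  simp_rw [e4] at h2
  simp_rw [e1] at h1
  rw [h.map_prod k, ← hY] at h1 h2
  have hνp : IsProbabilityMeasure (P.map (V k)) :=
    Measure.isProbabilityMeasure_map (h.measurable_V k).aemeasurable
  set a : ℕ → ({i : ℕ × Fin 3 // i ≠ (k, 1)} → ℝ) → ENNReal := fun n y =>
    ∫⁻ v, (ENNReal.ofReal (g n (y, v) ^ 2) + ENNReal.ofReal ((g' n (y, v) - h' (y, v)) ^ 2))
      ∂P.map (V k) with ha
  have ham : ∀ n, Measurable (a n) := fun n => by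
    refine Measurable.lintegral_prod_right' (f := fun p : ({i : ℕ × Fin 3 // i ≠ (k, 1)} → ℝ) × ℝ =>
      ENNReal.ofReal (g n p ^ 2) + ENNReal.ofReal ((g' n p - h' p) ^ 2)) ?_
    fun_prop
  have hlim : Tendsto (fun n => ∫⁻ y, a n y ∂P.map Y) atTop (𝓝 0) := by
    have := h1.add h2
    rw [add_zero] at this
    refine this.congr fun n => ?_
    rw [← lintegral_add_left (by fun_prop), lintegral_prod _ (by fun_prop)]
  -- By Fatou's lemma the conditional errors have lower limit zero for almost every `y`. This
  -- suffices, since the one-variable statement asks for a single good index for each tolerance `t`.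
  have hliminf : ∀ᵐ y ∂P.map Y, liminf (fun n => a n y) atTop = 0 := by
    have h3 : ∫⁻ y, liminf (fun n => a n y) atTop ∂P.map Y ≤ 0 := by
      refine (lintegral_liminf_le ham).trans ?_
      rw [hlim.liminf_eq]
    have := (lintegral_eq_zero_iff (Measurable.liminf ham)).1 (le_antisymm h3 bot_le)
    filter_upwards [this] with y hy using hy
  have hsec : ∀ᵐ y ∂P.map Y, ∀ᵐ v ∂P.map (V k), h' (y, v) = 0 := by
    filter_upwards [hliminf] with y hy
    rw [h.law_V k]
    refine ae_eq_zero_of_approx_deriv (S := {ξ | (ξ - z k) ^ 2 < 2 * r})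
      (((measurable_psi r).comp (by fun_prop)).div_const _) (by fun_prop)
      (isOpen_lt (by fun_prop) (by fun_prop)) ?_ ?_ ?_
    · intro x hx
      simp only [Set.mem_ofPred_eq, not_lt] at hx
      simp [psi_eq_zero hr hx]
    · intro K hK hKS
      obtain ⟨T, hT⟩ : ∃ T, T < 2 * r ∧ ∀ x ∈ K, (x - z k) ^ 2 ≤ T := by
        rcases K.eq_empty_or_nonempty with rfl | hne
        · exact ⟨0, by linarith, by simp⟩
        · obtain ⟨x₀, hx₀, hmax⟩ := hK.exists_isMaxOn hne
            (f := fun x => (x - z k) ^ 2) (by fun_prop)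
          exact ⟨_, hKS hx₀, fun x hx => hmax hx⟩
      refine ⟨Real.exp (theta r (max r T)) / mass r, by positivity, fun x hx => ?_⟩
      exact div_le_div_of_nonneg_right (psi_lower hr (le_max_left _ _)
        (max_lt (by linarith) hT.1) (sq_nonneg _) ((hT.2 x hx).trans (le_max_right _ _))) hmass.le
    · intro t ht
      have hfr : ∃ᶠ n in atTop, a n y < ENNReal.ofReal (t ^ 2) := by
        refine frequently_lt_of_liminf_lt (by isBoundedDefault) ?_
        rw [hy]
        positivity
      obtain ⟨n, hn⟩ := hfr.exists
      refine ⟨fun v => g n (y, v), fun v => g' n (y, v), fun v => ?_, ?_, ?_, ?_⟩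
      · exact hasDerivAt_eval_mvPolynomial (hasDerivAt_splitSeq_glue k y v)
          (fun j hj v' => splitSeq_glue_of_ne hj y v' v) (R n)
      · simp only [hg']
        have hc : ∀ i, Continuous fun v => glue k y v i := by
          intro i; unfold glue; split_ifs <;> fun_prop
        refine (hc _).mul ((MvPolynomial.continuous_eval _).comp (continuous_pi fun j => ?_))
        exact ((hc _).mul (hc _)).add ((continuous_const.sub (hc _)).mul (hc _))
      · rw [← h.law_V k]
        exact (lintegral_mono fun v => le_self_add).trans hn.le
      · rw [← h.law_V k]
        exact (lintegral_mono fun v => le_add_self).trans hn.le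
  have hprod : ∀ᵐ p ∂P.map W, h' p = 0 := by
    rw [h.map_prod k, ← hY]
    exact (Measure.ae_prod_iff_ae_ae (measurableSet_eq_fun hm' measurable_const)).2 hsec
  filter_upwards [hHh, ae_of_ae_map hW.aemeasurable hprod] with ω hω h0
  rw [hω]
  exact h0

end Closable

/-! ### Splittings -/

section Splitting

variable {Ω : Type*} [MeasurableSpace Ω] {P : Measure Ω} {r ε : ℝ} {z : ℕ → ℝ}
  {Z χ V U : ℕ → Ω → ℝ}

theorem mass_nonneg (r : ℝ) : 0 ≤ mass r := integral_nonneg fun _ => psi_nonneg _ _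

theorem IsSplitting.mass_pos [IsProbabilityMeasure P] (h : IsSplitting P r ε z Z χ V U) :
    0 < mass r := by
  refine (mass_nonneg r).lt_of_ne fun h0 => ?_
  have h1 := h.law_V 0
  simp only [← h0, div_zero, ENNReal.ofReal_zero] at h1
  have h2 : IsProbabilityMeasure (P.map (V 0)) :=
    Measure.isProbabilityMeasure_map (h.measurable_V 0).aemeasurable
  have h3 : (P.map (V 0)) Set.univ = 1 := measure_univ
  rw [h1] at h3
  simp at h3

theorem IsSplitting.bernoulli_le_one [IsProbabilityMeasure P] (h : IsSplitting P r ε z Z χ V U) :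
    ε * mass r ≤ 1 := by
  have h1 := h.chi_one 0
  have h2 : P {ω | χ 0 ω = 1} ≤ 1 := prob_le_one
  rw [h1, ENNReal.ofReal_le_one] at h2
  exact h2

theorem IsSplitting.chi_ae [IsProbabilityMeasure P] (h : IsSplitting P r ε z Z χ V U)
    (hε : 0 ≤ ε) (k : ℕ) : ∀ᵐ ω ∂P, χ k ω = 0 ∨ χ k ω = 1 := by
  have hm := h.measurable_chi k
  have m0 : MeasurableSet {ω | χ k ω = 0} := measurableSet_eq_fun hm measurable_const
  have m1 : MeasurableSet {ω | χ k ω = 1} := measurableSet_eq_fun hm measurable_const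
  have hd : Disjoint {ω | χ k ω = 0} {ω | χ k ω = 1} := by
    rw [Set.disjoint_left]
    intro ω h1 h2
    simp only [Set.mem_ofPred_eq] at h1 h2
    rw [h1] at h2
    exact zero_ne_one h2
  have hp := h.bernoulli_le_one
  have hp0 : 0 ≤ ε * mass r := mul_nonneg hε (mass_nonneg r)
  have hu : P ({ω | χ k ω = 0} ∪ {ω | χ k ω = 1}) = 1 := by
    rw [measure_union hd m1, h.chi_zero, h.chi_one, ← ENNReal.ofReal_add (by linarith) hp0]
    simp
  have hc := (prob_compl_eq_zero_iff (m0.union m1)).2 hu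
  rw [ae_iff]
  convert hc using 2
  ext ω
  simp

theorem IsSplitting.integral_chi [IsProbabilityMeasure P] (h : IsSplitting P r ε z Z χ V U)
    (hε : 0 ≤ ε) (k : ℕ) : ∫ ω, χ k ω ∂P = ε * mass r := by
  have hm := h.measurable_chi k
  have m1 : MeasurableSet {ω | χ k ω = 1} := measurableSet_eq_fun hm measurable_const
  have e : χ k =ᵐ[P] Set.indicator {ω | χ k ω = 1} 1 := by
    filter_upwards [h.chi_ae hε k] with ω hω
    rcases hω with h0 | h0 <;> simp [Set.indicator, h0]
  rw [integral_congr_ae e, integral_indicator_one m1, measureReal_def, h.chi_one,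
    ENNReal.toReal_ofReal (mul_nonneg hε (mass_nonneg r))]

/-- A measurable version of the sequence `Z`. -/
def splitZ (χ V U : ℕ → Ω → ℝ) (k : ℕ) (ω : Ω) : ℝ := χ k ω * V k ω + (1 - χ k ω) * U k ω

theorem IsSplitting.measurable_splitZ (h : IsSplitting P r ε z Z χ V U) (k : ℕ) :
    Measurable (splitZ χ V U k) :=
  ((h.measurable_chi k).mul (h.measurable_V k)).add
    ((measurable_const.sub (h.measurable_chi k)).mul (h.measurable_U k))

/-- Regrouping by sites: independence of all `χ_k, V_k, U_k` gives independence of the triples, and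
then of the pairs `(Z_k, ξ_k)`. -/
theorem iIndepFun_curry {ι κ : Type*} [IsProbabilityMeasure P] {X : ι × κ → Ω → ℝ}
    (hm : ∀ i, Measurable (X i)) (hX : iIndepFun X P) :
    iIndepFun (fun i ω j => X (i, j) ω) P := by
  have hp : ∀ i, IsProbabilityMeasure (P.map (X i)) := fun i =>
    Measure.isProbabilityMeasure_map (hm i).aemeasurable
  rw [iIndepFun_iff_map_fun_eq_infinitePi_map fun i => measurable_pi_lambda _ fun j => hm (i, j)]
  have h1 : ∀ i, P.map (fun ω j => X (i, j) ω) = Measure.infinitePi fun j => P.map (X (i, j)) :=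
    fun i => (hX.precomp (g := fun j => (i, j)) (Prod.mk_right_injective i)).map_fun_eq_infinitePi_map
      fun j => hm (i, j)
  simp_rw [h1]
  rw [← Measure.infinitePi_map_curry (fun i j => P.map (X (i, j))),
    ← hX.map_fun_eq_infinitePi_map hm, Measure.map_map (by fun_prop) (measurable_pi_lambda _ hm)]
  rfl

theorem MomentBound.of_eLpNorm_le {q a : ℝ} (hq : 0 < q) (ha : 0 ≤ a) {X : Ω → ℝ}
    (hX : AEStronglyMeasurable X P) (h : eLpNorm X (ENNReal.ofReal q) P ≤ ENNReal.ofReal a) :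
    MomentBound P q X (a ^ 2) := by
  have hX' : MemLp X (ENNReal.ofReal q) P := ⟨hX, h.trans_lt ENNReal.ofReal_lt_top⟩
  refine ⟨hX', ?_⟩
  have h0 : 0 ≤ ∫ ω, |X ω| ^ q ∂P := integral_nonneg fun ω => Real.rpow_nonneg (abs_nonneg _) _
  rw [hX'.eLpNorm_eq_integral_rpow_norm (by simpa using hq) ENNReal.ofReal_ne_top,
    ENNReal.toReal_ofReal hq.le, ENNReal.ofReal_le_ofReal_iff ha] at h
  have h1 := Real.rpow_le_rpow (Real.rpow_nonneg h0 _) h hq.le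
  rw [← Real.rpow_mul h0, inv_mul_cancel₀ hq.ne', Real.rpow_one] at h1
  refine h1.trans (le_of_eq ?_)
  rw [← Real.rpow_natCast, ← Real.rpow_mul ha]
  congr 1
  push_cast
  ring

theorem eLpNorm_sq {q : ℝ} (hq : 0 < q) (X : Ω → ℝ) :
    eLpNorm (fun ω => X ω ^ 2) (ENNReal.ofReal q) P = eLpNorm X (ENNReal.ofReal (2 * q)) P ^ 2 := by
  have := eLpNorm_norm_rpow (p := ENNReal.ofReal q) (μ := P) X (q := 2) two_pos
  rw [← ENNReal.ofReal_mul hq.le, mul_comm q 2] at this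
  rw [ENNReal.rpow_ofNat] at this
  rw [← this]
  congr 1
  funext ω
  simp [sq_abs]

/-- A bound for the moments of the variables attached to a site. -/
def momConst (M : ℝ) : ℝ := (M ^ 2 + 1) ^ 2

theorem one_le_momConst (M : ℝ) : 1 ≤ momConst M := by
  unfold momConst; nlinarith [sq_nonneg M]

/-- The variable `Z_k ^ 2 - 1` is needed in `L^q`, which is why moments of order `2 q` are assumed;
`ξ_k` is bounded by `1`. The resulting constant depends on `M` alone. -/
theorem IsSplitting.isSite [IsProbabilityMeasure P] (h : IsSplitting P r ε z Z χ V U)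
    (hε : 0 ≤ ε) {q M : ℝ} (hq : 2 ≤ q) (h1 : ∀ k, ∫ ω, Z k ω ∂P = 0)
    (h2 : ∀ k, ∫ ω, Z k ω ^ 2 ∂P = 1)
    (hM : ∀ k, eLpNorm (Z k) (ENNReal.ofReal (2 * q)) P ≤ ENNReal.ofReal M) :
    IsSite P q (momConst M) (splitZ χ V U) (fun k ω => χ k ω - ε * mass r) := by
  have hq0 : 0 < q := by linarith
  have hae : ∀ k, Z k =ᵐ[P] splitZ χ V U k := h.eq_split
  have hms := h.measurable_splitZ
  have hM' : ∀ k, eLpNorm (splitZ χ V U k) (ENNReal.ofReal (2 * q)) P ≤ ENNReal.ofReal |M| :=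
    fun k => by
      rw [← eLpNorm_congr_ae (hae k)]
      exact (hM k).trans (ENNReal.ofReal_le_ofReal (le_abs_self M))
  have hMZ : ∀ k, eLpNorm (splitZ χ V U k) (ENNReal.ofReal q) P ≤ ENNReal.ofReal |M| := fun k =>
    (eLpNorm_le_eLpNorm_of_exponent_le (ENNReal.ofReal_le_ofReal (by linarith))
      (hms k).aestronglyMeasurable).trans (hM' k)
  have hsq : ∀ k, eLpNorm (fun ω => splitZ χ V U k ω ^ 2) (ENNReal.ofReal q) P
      ≤ ENNReal.ofReal (M ^ 2) := fun k => by
    rw [eLpNorm_sq hq0, ← sq_abs M, ENNReal.ofReal_pow (abs_nonneg M)]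
    exact pow_le_pow_left' (hM' k) 2
  have hone : (1 : ENNReal) ≤ ENNReal.ofReal q := by
    rw [← ENNReal.ofReal_one]; exact ENNReal.ofReal_le_ofReal (by linarith)
  have hMm : |M| ^ 2 ≤ momConst M := by rw [sq_abs, momConst]; nlinarith [sq_nonneg M]
  have hp := h.bernoulli_le_one
  have hp0 : 0 ≤ ε * mass r := mul_nonneg hε (mass_nonneg r)
  have hχb : ∀ k, ∀ᵐ ω ∂P, ‖χ k ω - ε * mass r‖ ≤ 1 := fun k => by
    filter_upwards [h.chi_ae hε k] with ω hω
    rw [Real.norm_eq_abs, abs_le]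
    rcases hω with h0 | h0 <;> rw [h0] <;> constructor <;> linarith
  have hχi : ∀ k, Integrable (χ k) P := fun k => by
    refine Integrable.of_bound (h.measurable_chi k).aestronglyMeasurable 1 ?_
    filter_upwards [h.chi_ae hε k] with ω hω
    rcases hω with h0 | h0 <;> simp [h0]
  refine ⟨hms, fun k => (h.measurable_chi k).sub_const _, ?_, fun k => ?_, fun k => ?_, fun k => ?_,
    fun k => ?_, fun k => ?_, fun k => ?_⟩
  · have hi := iIndepFun_curry h.measurable_splitVar (show iIndepFun (splitVar χ V U) P from h.indep)
    exact hi.comp (fun _ (x : Fin 3 → ℝ) => (x 0 * x 1 + (1 - x 0) * x 2, x 0 - ε * mass r))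
      fun _ => by fun_prop
  · rw [← integral_congr_ae (hae k), h1]
  · have hi : MemLp (splitZ χ V U k) 2 P :=
      MemLp.mono_exponent (q := ENNReal.ofReal q)
        ⟨(hms k).aestronglyMeasurable, (hMZ k).trans_lt ENNReal.ofReal_lt_top⟩ (by
          rw [← ENNReal.ofReal_ofNat]; exact ENNReal.ofReal_le_ofReal hq)
    rw [integral_sub hi.integrable_sq (integrable_const _)]
    have : ∫ ω, splitZ χ V U k ω ^ 2 ∂P = ∫ ω, Z k ω ^ 2 ∂P :=
      integral_congr_ae ((hae k).symm.fun_comp fun x => x ^ 2)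
    rw [this, h2]
    simp
  · rw [integral_sub (hχi k) (integrable_const _), h.integral_chi hε]
    simp
  · exact (MomentBound.of_eLpNorm_le hq0 (abs_nonneg M) (hms k).aestronglyMeasurable
      (hMZ k)).mono hq0.le (sq_nonneg _) hMm
  · refine MomentBound.of_eLpNorm_le (a := M ^ 2 + 1) hq0 (by positivity)
      (((hms k).pow_const 2).sub_const 1).aestronglyMeasurable ?_
    rw [ENNReal.ofReal_add (sq_nonneg M) zero_le_one]
    refine (eLpNorm_sub_le (f := fun ω => splitZ χ V U k ω ^ 2) (g := fun _ => (1 : ℝ))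
      ((hms k).pow_const 2).aestronglyMeasurable aestronglyMeasurable_const hone).trans ?_
    refine add_le_add (hsq k) ?_
    have hq0' : ENNReal.ofReal q ≠ 0 := by simpa using hq0
    rw [eLpNorm_const _ hq0' (IsProbabilityMeasure.ne_zero P)]
    simp
  · refine (MomentBound.of_eLpNorm_le (a := 1) hq0 zero_le_one
      ((h.measurable_chi k).sub_const _).aestronglyMeasurable ?_).mono hq0.le (sq_nonneg _) (by
        simpa using one_le_momConst M)
    refine (eLpNorm_le_of_ae_bound (hχb k)).trans ?_
    simp

theorem ofReal_sub_sq_le (a b c : ℝ) :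
    ENNReal.ofReal ((a - b) ^ 2)
      ≤ 2 * ENNReal.ofReal ((a - c) ^ 2) + 2 * ENNReal.ofReal ((b - c) ^ 2) := by
  have : (2 : ENNReal) = ENNReal.ofReal 2 := by simp
  rw [this, ← ENNReal.ofReal_mul two_pos.le, ← ENNReal.ofReal_mul two_pos.le,
    ← ENNReal.ofReal_add (by positivity) (by positivity)]
  exact ENNReal.ofReal_le_ofReal (by nlinarith [sq_nonneg (a - c + (b - c))])

theorem tendsto_lintegral_sub_sq {a b : ℕ → Ω → ℝ} {F : Ω → ℝ} {A B : ℕ → ENNReal}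
    (hA : Tendsto A atTop (𝓝 0)) (hB : Tendsto B atTop (𝓝 0))
    (ha : ∀ n, AEMeasurable (a n) P) (hF : AEMeasurable F P)
    (h1 : ∀ n, ∫⁻ ω, ENNReal.ofReal ((a n ω - F ω) ^ 2) ∂P ≤ A n)
    (h2 : ∀ n, ∫⁻ ω, ENNReal.ofReal ((b n ω - F ω) ^ 2) ∂P ≤ B n) :
    Tendsto (fun n => ∫⁻ ω, ENNReal.ofReal ((a n ω - b n ω) ^ 2) ∂P) atTop (𝓝 0) := by
  have hAB : Tendsto (fun n => 2 * A n + 2 * B n) atTop (𝓝 0) := by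
    have := (ENNReal.Tendsto.const_mul hA (Or.inr ENNReal.ofNat_ne_top) (a := 2)).add
      (ENNReal.Tendsto.const_mul hB (Or.inr ENNReal.ofNat_ne_top) (a := 2))
    simpa using this
  refine tendsto_of_tendsto_of_tendsto_of_le_of_le tendsto_const_nhds hAB (fun _ => bot_le)
    fun n => ?_
  refine (lintegral_mono fun ω => ofReal_sub_sq_le (a n ω) (b n ω) (F ω)).trans ?_
  have := ha n
  rw [lintegral_add_left' (by fun_prop), lintegral_const_mul' _ _ ENNReal.ofNat_ne_top,
    lintegral_const_mul' _ _ ENNReal.ofNat_ne_top]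
  exact add_le_add (mul_le_mul_right (h1 n) _) (mul_le_mul_right (h2 n) _)

theorem IsSplitting.aemeasurable_eval (h : IsSplitting P r ε z Z χ V U) (Q : MvPolynomial ℕ ℝ) :
    AEMeasurable (fun ω => MvPolynomial.eval (fun k => Z k ω) Q) P := by
  refine (MvPolynomial.continuous_eval Q).measurable.comp_aemeasurable (aemeasurable_pi_iff.2 fun k => ?_)
  exact (h.measurable_splitZ k).aemeasurable.congr (EventuallyEq.symm (h.eq_split k))

/-- The Malliavin derivative is determined up to almost sure equality. -/
theorem IsSplitting.deriv_ae_eq [IsProbabilityMeasure P] (h : IsSplitting P r ε z Z χ V U)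
    (hr : 0 < r) {F : Ω → ℝ} {G G' : ℕ → Ω → ℝ} (hG : IsMalliavinDeriv P χ Z F G)
    (hG' : IsMalliavinDeriv P χ Z F G') (k : ℕ) : G k =ᵐ[P] G' k := by
  obtain ⟨hF, hm, Q, hQ, hQ'⟩ := hG
  obtain ⟨-, hm', R, hR, hR'⟩ := hG'
  have hc : ∀ (X : ℕ → ℕ → Ω → ℝ) n, ∫⁻ ω, ENNReal.ofReal (X k n ω ^ 2) ∂P
      ≤ ∫⁻ ω, ∑' k, ENNReal.ofReal (X k n ω ^ 2) ∂P := fun X n =>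
    lintegral_mono fun ω => ENNReal.le_tsum k
  have key := h.ae_eq_zero_of_tendsto hr h.mass_pos (R := fun n => Q n - R n) (k := k)
    (H := G k - G' k) ((hm k).sub (hm' k)) ?_ ?_
  · filter_upwards [key] with ω hω
    simpa [sub_eq_zero] using hω
  · simp only [simpleFunctional, map_sub]
    exact tendsto_lintegral_sub_sq (tendsto_eLpNorm_two_iff.1 hQ) (tendsto_eLpNorm_two_iff.1 hR)
      (fun n => h.aemeasurable_eval _) hF.aestronglyMeasurable.aemeasurable (fun n => le_rfl)
      fun n => le_rfl
  · have e : ∀ n ω, simpleDeriv χ Z (Q n - R n) k ω - (G k - G' k) ω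
        = (simpleDeriv χ Z (Q n) k ω - G k ω) - (simpleDeriv χ Z (R n) k ω - G' k ω) := by
      intro n ω
      simp only [simpleDeriv, map_sub, Pi.sub_apply]
      ring
    simp_rw [e]
    refine tendsto_lintegral_sub_sq (F := 0) hQ' hR' (fun n => ?_) aemeasurable_const
      (fun n => ?_) fun n => ?_
    · exact ((h.measurable_chi k).aemeasurable.mul (h.aemeasurable_eval _)).sub (hm k).aemeasurable
    · simp only [Pi.zero_apply, sub_zero]
      exact hc (fun k n ω => simpleDeriv χ Z (Q n) k ω - G k ω) n
    · simp only [Pi.zero_apply, sub_zero]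
      exact hc (fun k n ω => simpleDeriv χ Z (R n) k ω - G' k ω) n

theorem IsSplitting.malliavinCov_ae_eq [IsProbabilityMeasure P] (h : IsSplitting P r ε z Z χ V U)
    (hr : 0 < r) {F : Ω → ℝ} {G G' : ℕ → Ω → ℝ} (hG : IsMalliavinDeriv P χ Z F G)
    (hG' : IsMalliavinDeriv P χ Z F G') : malliavinCov G =ᵐ[P] malliavinCov G' := by
  filter_upwards [ae_all_iff.2 (h.deriv_ae_eq hr hG hG')] with ω hω
  simp [malliavinCov, hω]

end Splitting

/-! ### Derivatives of the truncated series -/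

/-- The derivative of `setPoly Z n φ` with respect to the `k`th variable. -/
def setDeriv (Z : ℕ → ℝ) (n : ℕ) (φ : Finset ℕ → ℝ) (k : ℕ) : ℝ :=
  ∑ A ∈ (Finset.range n).powerset, if k ∈ A then φ A * ∏ j ∈ A.erase k, Z j else 0

/-- The coefficients of the derivative with respect to the `k`th variable. -/
def shiftCoeff (φ : Finset ℕ → ℝ) (k : ℕ) (B : Finset ℕ) : ℝ := if k ∈ B then 0 else φ (insert k B)

theorem sum_mem_eq {n k : ℕ} (hk : k < n) (g : Finset ℕ → ℝ) :
    (∑ A ∈ (Finset.range n).powerset, if k ∈ A then g A else 0)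
      = ∑ B ∈ (Finset.range n).powerset, if k ∈ B then 0 else g (insert k B) := by
  have e : ∀ B, (if k ∈ B then 0 else g (insert k B)) = if k ∉ B then g (insert k B) else 0 := by
    intro B; by_cases h : k ∈ B <;> simp [h]
  simp_rw [e]
  rw [← Finset.sum_filter, ← Finset.sum_filter]
  refine Finset.sum_nbij' (fun A => A.erase k) (fun B => insert k B) ?_ ?_ ?_ ?_ ?_
  · intro A hA
    simp only [Finset.mem_filter, Finset.mem_powerset] at hA ⊢
    exact ⟨(Finset.erase_subset _ _).trans hA.1, Finset.notMem_erase _ _⟩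
  · intro B hB
    simp only [Finset.mem_filter, Finset.mem_powerset] at hB ⊢
    exact ⟨Finset.insert_subset (Finset.mem_range.2 hk) hB.1, Finset.mem_insert_self _ _⟩
  · intro A hA
    exact Finset.insert_erase (Finset.mem_filter.1 hA).2
  · intro B hB
    exact Finset.erase_insert (Finset.mem_filter.1 hB).2
  · intro A hA
    rw [Finset.insert_erase (Finset.mem_filter.1 hA).2]

theorem setDeriv_eq_setPoly {n k : ℕ} (hk : k < n) (Z : ℕ → ℝ) (φ : Finset ℕ → ℝ) :
    setDeriv Z n φ k = setPoly Z n (shiftCoeff φ k) := by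
  unfold setDeriv setPoly shiftCoeff
  rw [sum_mem_eq hk fun A => φ A * ∏ j ∈ A.erase k, Z j]
  refine Finset.sum_congr rfl fun B _ => ?_
  split_ifs with h
  · simp
  · rw [Finset.erase_insert h]

theorem setDeriv_eq_zero {n k : ℕ} (hk : n ≤ k) (Z : ℕ → ℝ) (φ : Finset ℕ → ℝ) :
    setDeriv Z n φ k = 0 := by
  refine Finset.sum_eq_zero fun A hA => if_neg fun h => ?_
  have := Finset.mem_range.1 (Finset.mem_powerset.1 hA h)
  omega

theorem sqSum_shiftCoeff {n k : ℕ} (hk : k < n) (φ : Finset ℕ → ℝ) :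
    sqSum (shiftCoeff φ k) n
      = ∑ A ∈ (Finset.range n).powerset, if k ∈ A then φ A ^ 2 else 0 := by
  unfold sqSum shiftCoeff
  rw [sum_mem_eq hk fun A => φ A ^ 2]
  refine Finset.sum_congr rfl fun B _ => ?_
  split_ifs <;> simp

/-- Each set is counted once for each of its elements, hence at most `N` times. So the derivative is
bounded in `L²(Ω; ℓ²)` by the same sum of squares as the series. -/
theorem sum_sqSum_shiftCoeff_le {φ : Finset ℕ → ℝ} {N : ℕ} (hφ : ∀ A, φ A ≠ 0 → A.card ≤ N)
    (n : ℕ) : ∑ k ∈ Finset.range n, sqSum (shiftCoeff φ k) n ≤ N * sqSum φ n := by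
  rw [Finset.sum_congr rfl fun k hk => sqSum_shiftCoeff (Finset.mem_range.1 hk) φ,
    Finset.sum_comm, sqSum, Finset.mul_sum]
  refine Finset.sum_le_sum fun A hA => ?_
  rw [← Finset.sum_filter, Finset.sum_const, nsmul_eq_mul]
  by_cases h0 : φ A = 0
  · simp [h0]
  · refine mul_le_mul_of_nonneg_right ?_ (sq_nonneg _)
    have : (Finset.range n).filter (fun k => k ∈ A) = A := by
      ext k
      simp only [Finset.mem_filter, and_iff_right_iff_imp]
      exact fun h => Finset.mem_powerset.1 hA h
    rw [this]
    exact_mod_cast hφ A h0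

theorem setDeriv_sub (Z : ℕ → ℝ) (φ : Finset ℕ → ℝ) {I J : ℕ} (h : J ≤ I) (k : ℕ) :
    setDeriv Z I φ k - setDeriv Z J φ k
      = setDeriv Z I (fun A => if A ⊆ Finset.range J then 0 else φ A) k := by
  unfold setDeriv
  have hsub : (Finset.range J).powerset ⊆ (Finset.range I).powerset :=
    Finset.powerset_mono.2 (Finset.range_subset_range.2 h)
  rw [← Finset.sum_sdiff hsub, ← Finset.sum_sdiff hsub (f := fun A => if k ∈ A then
    (if A ⊆ Finset.range J then 0 else φ A) * ∏ j ∈ A.erase k, Z j else 0)]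
  have e1 : ∑ A ∈ (Finset.range J).powerset, (if k ∈ A then
      (if A ⊆ Finset.range J then 0 else φ A) * ∏ j ∈ A.erase k, Z j else 0) = 0 :=
    Finset.sum_eq_zero fun A hA => by simp [Finset.mem_powerset.1 hA]
  rw [e1, add_zero, add_sub_cancel_right]
  refine Finset.sum_congr rfl fun A hA => ?_
  rw [if_neg (c := A ⊆ Finset.range J)
    fun h' => (Finset.mem_sdiff.1 hA).2 (Finset.mem_powerset.2 h')]

theorem dlin_eq_setDeriv {Ω : Type*} (Z : ℕ → Ω → ℝ) (n : ℕ) (φ : Finset ℕ → ℝ) (k : Fin n) (ω : Ω) :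
    dlin Z n (fun a => φ (supp a)) k ω = setDeriv (fun j => Z j ω) n φ k := by
  unfold dlin setDeriv
  rw [← sum_supp (fun A => if (k : ℕ) ∈ A then φ A * ∏ j ∈ A.erase k, Z j ω else 0)]
  refine Finset.sum_congr rfl fun a _ => ?_
  unfold restr
  by_cases ha : a k = true
  · have hk : (k : ℕ) ∈ supp a := mem_supp.2 ha
    rw [if_pos ha, if_pos hk]
    congr 1
    have h1 := prod_supp a fun j => if j = (k : ℕ) then 1 else Z j ω
    rw [← Finset.mul_prod_erase _ _ hk, if_pos rfl, one_mul] at h1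
    rw [Finset.prod_congr rfl fun j hj => if_neg (Finset.ne_of_mem_erase hj)] at h1
    rw [← h1]
    refine Finset.prod_congr rfl fun j _ => ?_
    by_cases hj : j = k
    · simp [hj]
    · have : (j : ℕ) ≠ k := fun h => hj (Fin.ext h)
      simp [hj, this]
  · rw [if_neg ha, if_neg fun h => ha (mem_supp.1 h), zero_mul]

/-- The polynomial whose value is `setPoly`. -/
def truncPoly (φ : Finset ℕ → ℝ) (n : ℕ) : MvPolynomial ℕ ℝ :=
  ∑ A ∈ (Finset.range n).powerset, MvPolynomial.C (φ A) * ∏ j ∈ A, MvPolynomial.X j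

theorem eval_truncPoly (φ : Finset ℕ → ℝ) (n : ℕ) (z : ℕ → ℝ) :
    MvPolynomial.eval z (truncPoly φ n) = setPoly z n φ := by
  simp [truncPoly, setPoly, map_sum, map_prod]

theorem eval_pderiv_prod_X (z : ℕ → ℝ) (k : ℕ) (A : Finset ℕ) :
    MvPolynomial.eval z (MvPolynomial.pderiv k (∏ j ∈ A, MvPolynomial.X j))
      = if k ∈ A then ∏ j ∈ A.erase k, z j else 0 := by
  induction A using Finset.induction_on with
  | empty => simp
  | insert a s ha ih =>
    rw [Finset.prod_insert ha, Derivation.leibniz, map_add, smul_eq_mul, smul_eq_mul, map_mul,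
      map_mul, ih, MvPolynomial.pderiv_X, MvPolynomial.eval_X, map_prod]
    simp only [MvPolynomial.eval_X]
    by_cases h : a = k
    · subst h
      simp [ha]
    · have h' : k ≠ a := fun e => h e.symm
      by_cases hk : k ∈ s
      · rw [if_pos hk, if_pos (Finset.mem_insert_of_mem hk), Finset.erase_insert_of_ne h,
          Finset.prod_insert fun h2 => ha (Finset.mem_of_mem_erase h2)]
        simp [h]
      · simp [hk, h, h']

theorem eval_pderiv_truncPoly (φ : Finset ℕ → ℝ) (n k : ℕ) (z : ℕ → ℝ) :
    MvPolynomial.eval z (MvPolynomial.pderiv k (truncPoly φ n)) = setDeriv z n φ k := by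
  unfold truncPoly setDeriv
  rw [map_sum, map_sum]
  refine Finset.sum_congr rfl fun A _ => ?_
  rw [MvPolynomial.pderiv_C_mul, map_mul, MvPolynomial.eval_C, eval_pderiv_prod_X]
  split_ifs <;> simp

section DerivLimit

variable {Ω : Type*} [MeasurableSpace Ω] {P : Measure Ω}

theorem lintegral_sq_le_of_eLpNorm_le {X : Ω → ℝ} {v : ℝ}
    (h : eLpNorm X 2 P ≤ ENNReal.ofReal (√v)) (hv : 0 ≤ v) :
    ∫⁻ ω, ENNReal.ofReal (X ω ^ 2) ∂P ≤ ENNReal.ofReal v := by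
  rw [eLpNorm_two_eq] at h
  have := ENNReal.rpow_le_rpow h zero_le_two
  rw [← ENNReal.rpow_mul, one_div, inv_mul_cancel₀ two_ne_zero, ENNReal.rpow_one,
    ENNReal.rpow_two, ← ENNReal.ofReal_pow (Real.sqrt_nonneg _), Real.sq_sqrt hv] at this
  exact this

theorem sqSum_nonneg (φ : Finset ℕ → ℝ) (n : ℕ) : 0 ≤ sqSum φ n :=
  Finset.sum_nonneg fun _ _ => sq_nonneg _

theorem IsSeq.lintegral_setPoly_sq_le [IsProbabilityMeasure P] {q m : ℝ} (hq : 2 ≤ q) (hm : 1 ≤ m)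
    {Z : ℕ → Ω → ℝ} (h : IsSeq P q m Z) {N : ℕ} {φ : Finset ℕ → ℝ}
    (hφ : ∀ A, φ A ≠ 0 → A.card ≤ N) (n : ℕ) :
    ∫⁻ ω, ENNReal.ofReal (setPoly (fun k => Z k ω) n φ ^ 2) ∂P
      ≤ ENNReal.ofReal (mlinConst q m ^ N * sqSum φ n) := by
  have hL := one_le_mlinConst hq hm
  have hv : 0 ≤ mlinConst q m ^ N * sqSum φ n := mul_nonneg (by positivity) (sqSum_nonneg _ _)
  have hb := h.momentBound_setPoly hq hm hφ n
  refine lintegral_sq_le_of_eLpNorm_le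
    ((eLpNorm_le_eLpNorm_of_exponent_le ?_ hb.1.aestronglyMeasurable).trans
      (hb.eLpNorm_le (by linarith) hv)) hv
  rw [← ENNReal.ofReal_ofNat]
  exact ENNReal.ofReal_le_ofReal hq

/-- The derivative of the truncated series, as a function of `ω` and of the index. -/
def truncDeriv (χ Z : ℕ → Ω → ℝ) (φ : Finset ℕ → ℝ) (n : ℕ) (x : Ω × ℕ) : ℝ :=
  χ x.2 x.1 * setDeriv (fun j => Z j x.1) n φ x.2

theorem measurable_truncDeriv {χ Z : ℕ → Ω → ℝ} (hχ : ∀ k, Measurable (χ k))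
    (hZ : ∀ k, Measurable (Z k)) (φ : Finset ℕ → ℝ) (n : ℕ) :
    Measurable (truncDeriv χ Z φ n) := by
  refine measurable_from_prod_countable_left fun k => ?_
  unfold truncDeriv setDeriv
  refine (hχ k).mul (Finset.measurable_sum _ fun A _ => ?_)
  dsimp only
  split_ifs
  · exact measurable_const.mul (Finset.measurable_prod _ fun j _ => hZ j)
  · exact measurable_const

omit [MeasurableSpace Ω] in
theorem truncDeriv_sub (χ Z : ℕ → Ω → ℝ) (φ : Finset ℕ → ℝ) {I J : ℕ} (h : J ≤ I) :
    truncDeriv χ Z φ I - truncDeriv χ Z φ J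
      = truncDeriv χ Z (fun A => if A ⊆ Finset.range J then 0 else φ A) I := by
  funext x
  simp only [truncDeriv, Pi.sub_apply]
  rw [← mul_sub, setDeriv_sub _ _ h]

/-- With the counting measure on the indices, `L²(Ω; ℓ²)` becomes a space of real functions on `Ω ×
ℕ`, and the completeness argument for the series can be reused for the derivatives. -/
theorem lintegral_prod_count [SFinite P] {f : Ω × ℕ → ENNReal} (hf : AEMeasurable f (P.prod Measure.count)) :
    ∫⁻ x, f x ∂P.prod Measure.count = ∫⁻ ω, ∑' k, f (ω, k) ∂P := by
  rw [lintegral_prod _ hf]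
  simp_rw [lintegral_count]

theorem IsSeq.lintegral_truncDeriv_le [IsProbabilityMeasure P] {q m : ℝ} (hq : 2 ≤ q) (hm : 1 ≤ m)
    {Z χ : ℕ → Ω → ℝ} (h : IsSeq P q m Z) (hχm : ∀ k, Measurable (χ k))
    (hχ : ∀ k, ∀ᵐ ω ∂P, χ k ω ^ 2 ≤ 1) {N : ℕ} {φ : Finset ℕ → ℝ}
    (hφ : ∀ A, φ A ≠ 0 → A.card ≤ N) (n : ℕ) :
    ∫⁻ x, ENNReal.ofReal (truncDeriv χ Z φ n x ^ 2) ∂P.prod Measure.count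
      ≤ ENNReal.ofReal (mlinConst q m ^ N * (N * sqSum φ n)) := by
  have hL := one_le_mlinConst hq hm
  have hmeas := measurable_truncDeriv hχm h.meas φ n
  rw [lintegral_prod_symm _ (by fun_prop), lintegral_count]
  rw [tsum_eq_sum (s := Finset.range n)]
  swap
  · intro k hk
    have hk' : n ≤ k := by simpa using hk
    simp [truncDeriv, setDeriv_eq_zero hk']
  have h1 : ∀ k ∈ Finset.range n, ∫⁻ ω, ENNReal.ofReal (truncDeriv χ Z φ n (ω, k) ^ 2) ∂P
      ≤ ENNReal.ofReal (mlinConst q m ^ N * sqSum (shiftCoeff φ k) n) := by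
    intro k hk
    refine le_trans ?_ (h.lintegral_setPoly_sq_le hq hm (N := N) (φ := shiftCoeff φ k) ?_ n)
    · refine lintegral_mono_ae ?_
      filter_upwards [hχ k] with ω hω
      refine ENNReal.ofReal_le_ofReal ?_
      simp only [truncDeriv]
      rw [setDeriv_eq_setPoly (Finset.mem_range.1 hk), mul_pow]
      exact mul_le_of_le_one_left (sq_nonneg _) hω
    · intro A hA
      unfold shiftCoeff at hA
      split_ifs at hA with h2
      · exact absurd rfl hA
      · have := hφ _ hA
        rw [Finset.card_insert_of_notMem h2] at this
        omega
  refine (Finset.sum_le_sum h1).trans ?_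
  rw [← ENNReal.ofReal_sum_of_nonneg fun k _ => mul_nonneg (by positivity) (sqSum_nonneg _ _),
    ← Finset.mul_sum]
  exact ENNReal.ofReal_le_ofReal
    (mul_le_mul_of_nonneg_left (sum_sqSum_shiftCoeff_le hφ n) (by positivity))

theorem IsSeq.eLpNorm_truncDeriv_le [IsProbabilityMeasure P] {q m : ℝ} (hq : 2 ≤ q) (hm : 1 ≤ m)
    {Z χ : ℕ → Ω → ℝ} (h : IsSeq P q m Z) (hχm : ∀ k, Measurable (χ k))
    (hχ : ∀ k, ∀ᵐ ω ∂P, χ k ω ^ 2 ≤ 1) {N : ℕ} {φ : Finset ℕ → ℝ}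
    (hφ : ∀ A, φ A ≠ 0 → A.card ≤ N) (n : ℕ) :
    eLpNorm (truncDeriv χ Z φ n) 2 (P.prod Measure.count)
      ≤ ENNReal.ofReal (√(mlinConst q m ^ N * (N * sqSum φ n))) := by
  have hL := one_le_mlinConst hq hm
  have h0 : 0 ≤ mlinConst q m ^ N * (N * sqSum φ n) :=
    mul_nonneg (by positivity) (mul_nonneg (by positivity) (sqSum_nonneg _ _))
  rw [eLpNorm_two_eq, Real.sqrt_eq_rpow, ← ENNReal.ofReal_rpow_of_nonneg h0 (by norm_num)]
  exact ENNReal.rpow_le_rpow (h.lintegral_truncDeriv_le hq hm hχm hχ hφ n) (by norm_num)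

theorem IsSeq.exists_limit_truncDeriv [IsProbabilityMeasure P] {q m : ℝ} (hq : 2 ≤ q) (hm : 1 ≤ m)
    {Z χ : ℕ → Ω → ℝ} (h : IsSeq P q m Z) (hχm : ∀ k, Measurable (χ k))
    (hχ : ∀ k, ∀ᵐ ω ∂P, χ k ω ^ 2 ≤ 1) {N : ℕ} {φ : Finset ℕ → ℝ}
    (hφ : ∀ A, φ A ≠ 0 → A.card ≤ N) {T : ℝ} (hT : Tendsto (sqSum φ) atTop (𝓝 T)) :
    ∃ G : Ω × ℕ → ℝ, Measurable G ∧ MemLp G 2 (P.prod Measure.count) ∧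
      (∀ n, MemLp (truncDeriv χ Z φ n) 2 (P.prod Measure.count)) ∧
      Tendsto (fun n => eLpNorm (truncDeriv χ Z φ n - G) 2 (P.prod Measure.count)) atTop (𝓝 0) := by
  have hL := one_le_mlinConst hq hm
  have hX : ∀ n, MemLp (truncDeriv χ Z φ n) 2 (P.prod Measure.count) := fun n =>
    ⟨(measurable_truncDeriv hχm h.meas φ n).aestronglyMeasurable,
      (h.eLpNorm_truncDeriv_le hq hm hχm hχ hφ n).trans_lt ENNReal.ofReal_lt_top⟩
  obtain ⟨F, hF, hlim⟩ := exists_limit_of_eLpNorm_le (p := 2) hX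
    (K := mlinConst q m ^ N * N) (by positivity) (sqSum_mono φ) hT fun J I hJI => by
      rw [truncDeriv_sub _ _ _ hJI, mul_assoc, ← sqSum_tail φ hJI]
      refine h.eLpNorm_truncDeriv_le hq hm hχm hχ (fun A hA => hφ A fun h0 => ?_) I
      simp [h0] at hA
  refine ⟨hF.1.mk F, hF.1.stronglyMeasurable_mk.measurable, (memLp_congr_ae hF.1.ae_eq_mk).1 hF, hX,
    hlim.congr fun n => eLpNorm_congr_ae ?_⟩
  filter_upwards [hF.1.ae_eq_mk] with x hx
  simp [hx]

/-- If the derivatives converge in `L²`, their square norms converge in `L¹`. -/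
theorem tendsto_lintegral_sq_sub_sq {E : Type*} [MeasurableSpace E] {μ : Measure E} {D : ℕ → E → ℝ}
    {G : E → ℝ} (hD : ∀ n, MemLp (D n) 2 μ) (hG : MemLp G 2 μ)
    (h : Tendsto (fun n => eLpNorm (D n - G) 2 μ) atTop (𝓝 0)) :
    Tendsto (fun n => ∫⁻ x, ‖D n x ^ 2 - G x ^ 2‖ₑ ∂μ) atTop (𝓝 0) := by
  have hb : Tendsto (fun n => eLpNorm (D n - G) 2 μ * (eLpNorm (D n - G) 2 μ
      + 2 * eLpNorm G 2 μ)) atTop (𝓝 0) := by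
    have h1 : Tendsto (fun n => eLpNorm (D n - G) 2 μ + 2 * eLpNorm G 2 μ) atTop
        (𝓝 (0 + 2 * eLpNorm G 2 μ)) := h.add tendsto_const_nhds
    have hne : 0 + 2 * eLpNorm G 2 μ ≠ ⊤ := by
      rw [zero_add]
      exact ENNReal.mul_ne_top ENNReal.ofNat_ne_top hG.2.ne
    have := ENNReal.Tendsto.mul h (Or.inr hne) h1 (Or.inr ENNReal.zero_ne_top)
    simpa using this
  refine tendsto_of_tendsto_of_tendsto_of_le_of_le tendsto_const_nhds hb (fun _ => bot_le)
    fun n => ?_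
  -- Factor `D ^ 2 - G ^ 2 = (D - G) ((D - G) + 2 G)`, then apply Cauchy–Schwarz.
  have e : ∫⁻ x, ‖D n x ^ 2 - G x ^ 2‖ₑ ∂μ = eLpNorm ((D n - G) • ((D n - G) + (G + G))) 1 μ := by
    rw [eLpNorm_one_eq_lintegral_enorm]
    refine lintegral_congr fun x => ?_
    congr 1
    simp only [Pi.smul_apply', Pi.add_apply, Pi.sub_apply, smul_eq_mul]
    ring
  have hs := ((hD n).sub hG).aestronglyMeasurable
  have hGm := hG.aestronglyMeasurable
  simp only [e]
  refine (eLpNorm_smul_le_mul_eLpNorm (p := 2) (q := 2) (hs.add (hGm.add hGm)) hs).trans ?_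
  refine mul_le_mul_right ((eLpNorm_add_le hs (hGm.add hGm) one_le_two).trans ?_) _
  refine add_le_add_right ((eLpNorm_add_le hGm hGm one_le_two).trans ?_) _
  rw [two_mul]

end DerivLimit

/-! ### The Malliavin derivative of the series -/

section Derivative

variable {Ω : Type*} [MeasurableSpace Ω] {P : Measure Ω}

-- The predicates from which the limits are chosen are equal, so the same limit is chosen: the
-- equality holds everywhere and not just almost surely.
open scoped Classical in
theorem l2Lim_congr {X X' : ℕ → Ω → ℝ} (h : ∀ n, X n =ᵐ[P] X' n) : l2Lim P X = l2Lim P X' := by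
  have e : (fun F : Ω → ℝ => MemLp F 2 P ∧
      Tendsto (fun J => eLpNorm (fun ω => X J ω - F ω) 2 P) atTop (𝓝 0))
      = fun F : Ω → ℝ => MemLp F 2 P ∧
      Tendsto (fun J => eLpNorm (fun ω => X' J ω - F ω) 2 P) atTop (𝓝 0) := by
    funext F
    have : (fun J => eLpNorm (fun ω => X J ω - F ω) 2 P)
        = fun J => eLpNorm (fun ω => X' J ω - F ω) 2 P :=
      funext fun J => eLpNorm_congr_ae (by
        filter_upwards [h J] with ω hω
        rw [hω])
    rw [this]
  exact congrArg (fun p : (Ω → ℝ) → Prop => if h : ∃ F, p F then h.choose else 0) e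

theorem SN_congr {Z Z' : ℕ → Ω → ℝ} (h : ∀ k, Z k =ᵐ[P] Z' k) (c : Coeff) (N : ℕ) :
    SN P c Z N = SN P c Z' N := by
  have : ∀ m, Phi P c Z m = Phi P c Z' m := fun m => by
    refine l2Lim_congr fun J => ?_
    filter_upwards [ae_all_iff.2 h] with ω hω
    simp [partialPhi, hω]
  funext ω
  simp [SN, this]

theorem IsMalliavinDeriv.congr {χ Z Z' : ℕ → Ω → ℝ} (h : ∀ k, Z k =ᵐ[P] Z' k) {F : Ω → ℝ}
    {G : ℕ → Ω → ℝ} (hG : IsMalliavinDeriv P χ Z F G) : IsMalliavinDeriv P χ Z' F G := by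
  obtain ⟨h1, h2, Q, h3, h4⟩ := hG
  have e : ∀ᵐ ω ∂P, (fun k => Z k ω) = fun k => Z' k ω := by
    filter_upwards [ae_all_iff.2 h] with ω hω
    funext k; exact hω k
  refine ⟨h1, h2, Q, h3.congr fun n => eLpNorm_congr_ae ?_, h4.congr fun n => lintegral_congr_ae ?_⟩
  · filter_upwards [e] with ω hω
    simp only [simpleFunctional, hω]
  · filter_upwards [e] with ω hω
    simp only [simpleDeriv, hω]

theorem totCoeff_ne_zero {c : Coeff} {N : ℕ} {A : Finset ℕ} (h : totCoeff c N A ≠ 0) :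
    1 ≤ A.card ∧ A.card ≤ N := by
  obtain ⟨m, hm, h'⟩ := Finset.exists_ne_zero_of_sum_ne_zero h
  rw [phiCoeff_ne_zero h']
  exact Finset.mem_Icc.1 hm

theorem setPoly_totCoeff (c : Coeff) (N n : ℕ) (z : ℕ → ℝ) :
    setPoly z n (totCoeff c N) = ∑ m ∈ Finset.Icc 1 N, setPoly z n (phiCoeff c m) := by
  simp only [setPoly, totCoeff, Finset.sum_mul]
  exact Finset.sum_comm

theorem IsSeq.tendsto_SN [IsProbabilityMeasure P] {q m : ℝ} (hq : 2 ≤ q) (hm : 1 ≤ m)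
    {Z : ℕ → Ω → ℝ} (h : IsSeq P q m Z) {c : Coeff} (hc : c.Admissible) {N : ℕ}
    (hs : ∀ m, 1 ≤ m → m ≤ N → Summable fun α : Fin m → ℕ => c m α ^ 2) :
    MemLp (SN P c Z N) 2 P ∧ Tendsto (fun n => eLpNorm (fun ω =>
      setPoly (fun k => Z k ω) n (totCoeff c N) - SN P c Z N ω) 2 P) atTop (𝓝 0) := by
  have hq2 : (2 : ENNReal) ≤ ENNReal.ofReal q := by
    rw [← ENNReal.ofReal_ofNat]; exact ENNReal.ofReal_le_ofReal hq
  have hl : ∀ l ∈ Finset.Icc 1 N, MemLp (Phi P c Z l) (ENNReal.ofReal q) P ∧ Tendsto (fun n =>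
      eLpNorm ((fun ω => setPoly (fun k => Z k ω) n (phiCoeff c l)) - Phi P c Z l)
        (ENNReal.ofReal q) P) atTop (𝓝 0) := fun l hl =>
    h.tendsto_Phi hq hm hc (hs l (Finset.mem_Icc.1 hl).1 (Finset.mem_Icc.1 hl).2)
  have hm' : ∀ n, ∀ l ∈ Finset.Icc 1 N, AEStronglyMeasurable
      ((fun ω => setPoly (fun k => Z k ω) n (phiCoeff c l)) - Phi P c Z l) P := fun n l hl' =>
    ((h.momentBound_setPoly hq hm (N := l) (fun A hA => (phiCoeff_ne_zero hA).le) n).1.sub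
      (hl l hl').1).aestronglyMeasurable
  refine ⟨memLp_finsetSum _ fun l hl' => (hl l hl').1.mono_exponent hq2, ?_⟩
  have hsum : Tendsto (fun n => ∑ l ∈ Finset.Icc 1 N,
      eLpNorm ((fun ω => setPoly (fun k => Z k ω) n (phiCoeff c l)) - Phi P c Z l)
        (ENNReal.ofReal q) P) atTop (𝓝 0) := by
    have := tendsto_finsetSum (Finset.Icc 1 N) fun l hl' => (hl l hl').2
    simpa using this
  refine tendsto_of_tendsto_of_tendsto_of_le_of_le tendsto_const_nhds hsum (fun _ => bot_le)
    fun n => ?_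
  have e : (fun ω => setPoly (fun k => Z k ω) n (totCoeff c N) - SN P c Z N ω)
      = ∑ l ∈ Finset.Icc 1 N,
        ((fun ω => setPoly (fun k => Z k ω) n (phiCoeff c l)) - Phi P c Z l) := by
    funext ω
    simp [setPoly_totCoeff, SN, Finset.sum_sub_distrib]
  rw [e]
  refine (eLpNorm_sum_le (hm' n) one_le_two).trans (Finset.sum_le_sum fun l hl' => ?_)
  exact eLpNorm_le_eLpNorm_of_exponent_le hq2 (hm' n l hl')

/-- The series has a derivative, whose covariance is the almost sure limit of the covariances of
truncated series. -/
theorem IsSeq.exists_deriv [IsProbabilityMeasure P] {q m : ℝ} (hq : 2 ≤ q) (hm : 1 ≤ m)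
    {Z χ : ℕ → Ω → ℝ} (h : IsSeq P q m Z) (hχm : ∀ k, Measurable (χ k))
    (hχ : ∀ k, ∀ᵐ ω ∂P, χ k ω = 0 ∨ χ k ω = 1) {c : Coeff} (hc : c.Admissible) {N : ℕ}
    (hs : ∀ m, 1 ≤ m → m ≤ N → Summable fun α : Fin m → ℕ => c m α ^ 2) :
    ∃ G : ℕ → Ω → ℝ, IsMalliavinDeriv P χ Z (SN P c Z N) G ∧ ∃ ns : ℕ → ℕ, StrictMono ns ∧
      ∀ᵐ ω ∂P, Tendsto (fun i => ∑ k : Fin (ns i),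
        χ k ω * dlin Z (ns i) (fun a => totCoeff c N (supp a)) k ω ^ 2) atTop
        (𝓝 (malliavinCov G ω)) := by
  have hχ1 : ∀ k, ∀ᵐ ω ∂P, χ k ω ^ 2 ≤ 1 := fun k => by
    filter_upwards [hχ k] with ω hω
    rcases hω with h0 | h0 <;> simp [h0]
  obtain ⟨G, hGm, hG, hD, hlim⟩ := h.exists_limit_truncDeriv hq hm hχm hχ1
    (fun A hA => (totCoeff_ne_zero hA).2) (tendsto_sqSum_totCoeff hc hs)
  obtain ⟨hSN, hSNlim⟩ := h.tendsto_SN hq hm hc hs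
  have hDm := fun n => measurable_truncDeriv hχm h.meas (totCoeff c N) n
  refine ⟨fun k ω => G (ω, k), ⟨hSN, fun k => (hGm.comp (by fun_prop)).aestronglyMeasurable,
    fun n => truncPoly (totCoeff c N) n, ?_, ?_⟩, ?_⟩
  · simpa only [simpleFunctional, eval_truncPoly] using hSNlim
  · have h1 := tendsto_eLpNorm_two_iff.1 hlim
    refine h1.congr fun n => ?_
    have := hDm n
    rw [lintegral_prod_count (by fun_prop)]
    simp only [simpleDeriv, eval_pderiv_truncPoly]
    rfl
  have hcov : malliavinCov (fun k ω => G (ω, k))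
      = fun ω => (∑' k, ENNReal.ofReal (G (ω, k) ^ 2)).toReal := by
    funext ω
    rw [ENNReal.tsum_toReal_eq fun k => ENNReal.ofReal_ne_top]
    simp [malliavinCov, ENNReal.toReal_ofReal, sq_nonneg]
  have hcovm : Measurable (malliavinCov fun k ω => G (ω, k)) := by
    rw [hcov]
    refine (Measurable.tsum fun k => ?_).ennreal_toReal
    fun_prop
  have hsq : ∀ᵐ ω ∂P, Summable fun k => G (ω, k) ^ 2 := by
    have hfin : ∫⁻ x, ENNReal.ofReal (G x ^ 2) ∂P.prod Measure.count ≠ ⊤ := by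
      have h1 := hG.2.ne
      rw [eLpNorm_two_eq] at h1
      intro h2
      rw [h2, ENNReal.top_rpow_of_pos (by norm_num)] at h1
      exact h1 rfl
    rw [lintegral_prod_count (by fun_prop)] at hfin
    filter_upwards [ae_lt_top (Measurable.tsum fun k => by fun_prop) hfin] with ω hω
    have := ENNReal.summable_toReal hω.ne
    simpa [ENNReal.toReal_ofReal, sq_nonneg] using this
  have hDsum : ∀ n ω, ∑' k, truncDeriv χ Z (totCoeff c N) n (ω, k) ^ 2
      = ∑ k ∈ Finset.range n, truncDeriv χ Z (totCoeff c N) n (ω, k) ^ 2 := fun n ω =>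
    tsum_eq_sum fun k hk => by
      have hk' : n ≤ k := by simpa using hk
      simp [truncDeriv, setDeriv_eq_zero hk']
  set S : ℕ → Ω → ℝ := fun n ω =>
    ∑ k ∈ Finset.range n, truncDeriv χ Z (totCoeff c N) n (ω, k) ^ 2 with hS
  have hSm : ∀ n, Measurable (S n) := fun n => Finset.measurable_sum _ fun k _ =>
    ((hDm n).comp (by fun_prop)).pow_const 2
  -- The difference of the covariances is at most the sum over `k` of `|D_k^2 - G_k^2|`. Convergence
  -- in `L¹` follows, hence almost sure convergence along a subsequence.
  have hL1 : Tendsto (fun n => eLpNorm (S n - malliavinCov fun k ω => G (ω, k)) 1 P)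
      atTop (𝓝 0) := by
    refine tendsto_of_tendsto_of_tendsto_of_le_of_le tendsto_const_nhds
      (tendsto_lintegral_sq_sub_sq hD hG hlim) (fun _ => bot_le) fun n => ?_
    have := hDm n
    simp only
    rw [eLpNorm_one_eq_lintegral_enorm, lintegral_prod_count (by fun_prop)]
    refine lintegral_mono_ae ?_
    filter_upwards [hsq] with ω hω
    have hsn : Summable fun k => truncDeriv χ Z (totCoeff c N) n (ω, k) ^ 2 :=
      summable_of_ne_finset_zero (s := Finset.range n) fun k hk => by
        have hk' : n ≤ k := by simpa using hk
        simp [truncDeriv, setDeriv_eq_zero hk']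
    simp only [Pi.sub_apply, hS, malliavinCov]
    rw [← hDsum n ω, ← hsn.tsum_sub hω]
    exact enorm_tsum_le_tsum_enorm
  obtain ⟨ns, hns, hae⟩ := (tendstoInMeasure_of_tendsto_eLpNorm one_ne_zero
    (fun n => (hSm n).aestronglyMeasurable) hcovm.aestronglyMeasurable hL1).exists_seq_tendsto_ae
  refine ⟨ns, hns, ?_⟩
  filter_upwards [hae, ae_all_iff.2 hχ] with ω hω hχω
  refine hω.congr fun i => ?_
  simp only [hS]
  rw [Finset.sum_range]
  refine Finset.sum_congr rfl fun k _ => ?_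
  rw [dlin_eq_setDeriv]
  simp only [truncDeriv]
  -- `χ_k ^ 2 = χ_k`, which makes the covariance linear in the `χ_k`.
  rcases hχω k with h0 | h0 <;> simp [h0]

end Derivative

/-! ### Small values of the Malliavin covariance -/

theorem sum_restr_sq {n : ℕ} (f : (Fin n → Bool) → ℝ) :
    ∑ k, ∑ A, restr f k A ^ 2 = ∑ A, size A * f A ^ 2 := by
  rw [Finset.sum_comm]
  refine Finset.sum_congr rfl fun A _ => ?_
  rw [size, Nat.cast_sum, Finset.sum_mul]
  refine Finset.sum_congr rfl fun k _ => ?_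
  unfold restr
  cases A k <;> simp

/-- A bound for the fluctuations of the Malliavin covariance of the series: `i` is `i_N(c)`, `δ`
bounds the influence factors and `K` bounds the contractions. -/
def covBound (L i δ K : ℝ) (N : ℕ) : ℝ :=
  2 * (N ^ 2 * ((2 * L + 1) ^ (2 * N) * (N * N.factorial * δ ^ 2) * (N * i))
    + (2 * L) ^ (2 * N) * N ^ 4 * (2 * 2 ^ N * K * i))
    + 2 * (L * ((2 * L + 1) ^ (2 * N) * (N * N.factorial * δ ^ 2) * (N * i)))

section SmallBall

variable {Ω : Type*} [MeasurableSpace Ω] {P : Measure Ω}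

theorem sqSum_totCoeff_le {c : Coeff} (hc : c.Admissible) {N : ℕ}
    (hs : ∀ m, 1 ≤ m → m ≤ N → Summable fun α : Fin m → ℕ => c m α ^ 2) (n : ℕ) :
    sqSum (totCoeff c N) n ≤ iN c N :=
  (sqSum_mono _).ge_of_tendsto (tendsto_sqSum_totCoeff hc hs) n

/-- One of the two factors of each square is bounded uniformly in `k` by the influences; the other,
summed over `k`, counts each set at most `N` times and gives `N i_N(c)`. -/
theorem sum_wSq_restr_sq_le {c : Coeff} (hc : c.Admissible) {N : ℕ}
    (hs : ∀ m, 1 ≤ m → m ≤ N → Summable fun α : Fin m → ℕ => c m α ^ 2) {lam : ℝ} (hlam : 1 ≤ lam)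
    (n : ℕ) : ∑ k : Fin n, wSq lam (restr (fun a => totCoeff c N (supp a)) k) ^ 2
      ≤ lam ^ (2 * N) * (N * N.factorial * deltaBar c N ^ 2) * (N * iN c N) := by
  set f : (Fin n → Bool) → ℝ := fun a => totCoeff c N (supp a) with hf
  have hsize : ∀ A, f A ≠ 0 → size A ≤ N := fun A hA => by
    rw [← card_supp]; exact (totCoeff_ne_zero hA).2
  have h1 : ∀ k, wSq lam (restr f k) ≤ lam ^ N * ∑ A, restr f k A ^ 2 := fun k =>
    wSq_le hlam fun A hA => hsize A fun h0 => hA (by simp [restr, h0])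
  have h2 : ∑ k, ∑ A, restr f k A ^ 2 ≤ N * iN c N := by
    rw [sum_restr_sq]
    calc ∑ A, (size A : ℝ) * f A ^ 2 ≤ ∑ A, (N : ℝ) * f A ^ 2 := by
          refine Finset.sum_le_sum fun A _ => ?_
          by_cases h0 : f A = 0
          · simp [h0]
          · exact mul_le_mul_of_nonneg_right (by exact_mod_cast hsize A h0) (sq_nonneg _)
      _ = N * sqSum (totCoeff c N) n := by rw [← Finset.mul_sum, hf, sum_supp_sq]
      _ ≤ N * iN c N := by
          have := sqSum_totCoeff_le hc hs n
          gcongr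
  have h3 : ∀ k, ∑ A, restr f k A ^ 2 ≤ N * N.factorial * deltaBar c N ^ 2 :=
    sum_restr_tot_sq_le hc hs n
  have h0 : ∀ k, 0 ≤ ∑ A, restr f k A ^ 2 := fun k => Finset.sum_nonneg fun _ _ => sq_nonneg _
  calc ∑ k, wSq lam (restr f k) ^ 2
      ≤ ∑ k, (lam ^ N * ∑ A, restr f k A ^ 2) ^ 2 :=
        Finset.sum_le_sum fun k _ => pow_le_pow_left₀ (wSq_nonneg (by linarith) _) (h1 k) 2
    _ ≤ ∑ k, lam ^ (2 * N) * (N * N.factorial * deltaBar c N ^ 2) * ∑ A, restr f k A ^ 2 := by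
        refine Finset.sum_le_sum fun k _ => ?_
        rw [mul_pow, sq (∑ A, restr f k A ^ 2), ← pow_mul, mul_comm N 2, mul_assoc]
        exact mul_le_mul_of_nonneg_left (mul_le_mul_of_nonneg_right (h3 k) (h0 k)) (by positivity)
    _ ≤ _ := by
        rw [← Finset.mul_sum]
        exact mul_le_mul_of_nonneg_left h2 (by positivity)

theorem IsSite.momentBound_truncCov [IsProbabilityMeasure P] {q m : ℝ} (hq : 2 ≤ q) (hm : 1 ≤ m)
    {Z ξ χ : ℕ → Ω → ℝ} (h : IsSite P q m Z ξ) {p₀ : ℝ} (h0 : 0 ≤ p₀) (h1 : p₀ ≤ 1)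
    (hχ : ∀ k ω, χ k ω = p₀ + ξ k ω) {c : Coeff} (hc : c.Admissible) {N : ℕ}
    (hs : ∀ m, 1 ≤ m → m ≤ N → Summable fun α : Fin m → ℕ => c m α ^ 2) (n : ℕ) :
    MomentBound P q (fun ω =>
      (∑ k : Fin n, χ k ω * dlin Z n (fun a => totCoeff c N (supp a)) k ω ^ 2)
        - p₀ * covCoeff (fun a : Fin n → Bool => totCoeff c N (supp a)) (fun _ => 0))
      (covBound (siteConst q m) (iN c N) (deltaBar c N) (∑ l ∈ Finset.Icc 1 N,
        √(cumulant4 gaussSeq (mlin coordSeq n fun a => phiCoeff c l (supp a)))) N) := by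
  have hL : 1 ≤ siteConst q m := by
    have := one_le_smoothConst hq
    rw [siteConst]; nlinarith
  have hb := h.momentBound_cov hq hm h0 h1 hχ (n := n) (N := N)
    (f := fun a => totCoeff c N (supp a))
    (fun A hA => by rw [← card_supp]; exact totCoeff_ne_zero hA) rfl
  set L := siteConst q m with hLdef
  have hw0 : 0 ≤ ∑ k : Fin n, wSq (2 * L + 1) (restr (fun a => totCoeff c N (supp a)) k) ^ 2 :=
    Finset.sum_nonneg fun _ _ => sq_nonneg _
  have hi0 : 0 ≤ ∑ A : Fin n → Bool, totCoeff c N (supp A) ^ 2 :=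
    Finset.sum_nonneg fun _ _ => sq_nonneg _
  have hw := sum_wSq_restr_sq_le hc hs (lam := 2 * L + 1) (by linarith) n
  have hi : ∑ A : Fin n → Bool, totCoeff c N (supp A) ^ 2 ≤ iN c N := by
    rw [sum_supp_sq]; exact sqSum_totCoeff_le hc hs n
  have hK : ∑ l ∈ Finset.Icc 1 N,
      √(contrSq (homPart (fun a : Fin n → Bool => totCoeff c N (supp a)) l) l)
      ≤ ∑ l ∈ Finset.Icc 1 N,
        √(cumulant4 gaussSeq (mlin coordSeq n fun a => phiCoeff c l (supp a))) := by
    refine Finset.sum_le_sum fun l hl => Real.sqrt_le_sqrt ?_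
    rw [homPart_totCoeff c hl]
    exact contrSq_phiCoeff_le c (Finset.mem_Icc.1 hl).1 n
  have hK0 : 0 ≤ ∑ l ∈ Finset.Icc 1 N,
      √(contrSq (homPart (fun a : Fin n → Bool => totCoeff c N (supp a)) l) l) :=
    Finset.sum_nonneg fun _ _ => Real.sqrt_nonneg _
  refine hb.mono (by linarith) (by positivity) ?_
  unfold covBound
  gcongr

theorem MomentBound.prob_ge_le {q v a : ℝ} (hq : 0 < q) (hv : 0 ≤ v) (ha : 0 < a) {X : Ω → ℝ}
    (h : MomentBound P q X v) : P {ω | a ≤ |X ω|} ≤ ENNReal.ofReal ((√v / a) ^ q) := by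
  have h1 := meas_ge_le_mul_pow_eLpNorm_enorm P (p := ENNReal.ofReal q) (by simpa using hq)
    ENNReal.ofReal_ne_top h.1.aestronglyMeasurable (ε := ENNReal.ofReal a) (by simpa using ha)
    (fun h => absurd h ENNReal.ofReal_ne_top)
  have e : {ω | ENNReal.ofReal a ≤ ‖X ω‖ₑ} = {ω | a ≤ |X ω|} := by
    ext ω
    simp only [Set.mem_ofPred_eq]
    rw [← ofReal_norm, ENNReal.ofReal_le_ofReal_iff (norm_nonneg _), Real.norm_eq_abs]
  rw [e, ENNReal.toReal_ofReal hq.le] at h1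
  refine h1.trans ((mul_le_mul_right
    (ENNReal.rpow_le_rpow (h.eLpNorm_le hq hv) hq.le) _).trans (le_of_eq ?_))
  rw [← ENNReal.mul_rpow_of_nonneg _ _ hq.le, ← ENNReal.ofReal_inv_of_pos ha,
    ← ENNReal.ofReal_mul (by positivity), ENNReal.ofReal_rpow_of_nonneg (by positivity) hq.le]
  congr 2
  ring

theorem covBound_nonneg {L i δ K : ℝ} (hL : 0 ≤ L) (hi : 0 ≤ i) (hK : 0 ≤ K) (N : ℕ) :
    0 ≤ covBound L i δ K N := by
  unfold covBound; positivity

/-- The bound for small values of the limit of the covariances of truncated series. -/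
theorem IsSite.prob_cov_le [IsProbabilityMeasure P] {q m : ℝ} (hq : 2 ≤ q) (hm : 1 ≤ m)
    {Z ξ χ : ℕ → Ω → ℝ} (h : IsSite P q m Z ξ) {p₀ : ℝ} (h0 : 0 < p₀) (h1 : p₀ ≤ 1)
    (hχ : ∀ k ω, χ k ω = p₀ + ξ k ω) {c : Coeff} (hc : c.Admissible) {N : ℕ}
    (hs : ∀ m, 1 ≤ m → m ≤ N → Summable fun α : Fin m → ℕ => c m α ^ 2) (hi : 0 < iN c N)
    {ns : ℕ → ℕ} (hns : StrictMono ns) {σ : Ω → ℝ}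
    (hlim : ∀ᵐ ω ∂P, Tendsto (fun i => ∑ k : Fin (ns i),
        χ k ω * dlin Z (ns i) (fun a => totCoeff c N (supp a)) k ω ^ 2) atTop (𝓝 (σ ω)))
    {η : ℝ} (hη : η ≤ 1 / 2 * p₀ * iN c N) :
    P {ω | σ ω ≤ η} ≤ ENNReal.ofReal ((√(covBound (siteConst q m) (iN c N) (deltaBar c N)
      (∑ l ∈ Finset.Icc 1 N, √(kappa4 c l)) N) / (p₀ * iN c N / 3)) ^ q) := by
  have hq0 : 0 < q := by linarith
  have hL : 0 ≤ siteConst q m := by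
    have := one_le_smoothConst hq
    rw [siteConst]; positivity
  set S : ℕ → Ω → ℝ := fun n ω =>
    ∑ k : Fin n, χ k ω * dlin Z n (fun a => totCoeff c N (supp a)) k ω ^ 2 with hS
  set s : ℕ → ℝ := fun n =>
    p₀ * covCoeff (fun a : Fin n → Bool => totCoeff c N (supp a)) (fun _ => 0) with hsdef
  set K : ℕ → ℝ := fun n => ∑ l ∈ Finset.Icc 1 N,
    √(cumulant4 gaussSeq (mlin coordSeq n fun a => phiCoeff c l (supp a))) with hKdef
  have hb : ∀ n, MomentBound P q (fun ω => S n ω - s n)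
      (covBound (siteConst q m) (iN c N) (deltaBar c N) (K n) N) :=
    fun n => h.momentBound_truncCov hq hm h0.le h1 hχ hc hs n
  have hSm : ∀ n, AEStronglyMeasurable (S n) P := fun n => by
    have := (hb n).1.aestronglyMeasurable.add (aestronglyMeasurable_const (b := s n))
    refine this.congr (ae_of_all _ fun ω => ?_)
    simp
  have hsge : ∀ n, p₀ * sqSum (totCoeff c N) n ≤ s n := fun n => by
    refine mul_le_mul_of_nonneg_left ?_ h0.le
    rw [covCoeff_zero, ← sum_supp_sq]
    refine Finset.sum_le_sum fun A _ => ?_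
    by_cases hA : totCoeff c N (supp A) = 0
    · simp [hA]
    · refine le_mul_of_one_le_left (sq_nonneg _) ?_
      rw [← card_supp]
      exact_mod_cast (totCoeff_ne_zero hA).1
  -- The value `η` is at most `θ / 2` and the truncated covariances are tested at `2 θ / 3`. The gap
  -- `θ / 6` absorbs their convergence to `σ`, and a deviation of asymptotic size `θ / 3` from the
  -- constant term remains.
  set θ := p₀ * iN c N with hθ
  have hθ0 : 0 < θ := mul_pos h0 hi
  have hsq := (tendsto_sqSum_totCoeff hc hs).comp hns.tendsto_atTop
  have ht : Tendsto (fun j => p₀ * sqSum (totCoeff c N) (ns j) - 2 / 3 * θ) atTop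
      (𝓝 (θ / 3)) := by
    have := (hsq.const_mul p₀).sub (tendsto_const_nhds (x := 2 / 3 * θ))
    rwa [show p₀ * iN c N - 2 / 3 * θ = θ / 3 by rw [hθ]; ring] at this
  have hKlim : Tendsto (fun j => K (ns j)) atTop (𝓝 (∑ l ∈ Finset.Icc 1 N, √(kappa4 c l))) := by
    have : Tendsto K atTop (𝓝 (∑ l ∈ Finset.Icc 1 N, √(kappa4 c l))) :=
      tendsto_finsetSum _ fun l hl =>
        (tendsto_cumulant4 hc (hs l (Finset.mem_Icc.1 hl).1 (Finset.mem_Icc.1 hl).2)).sqrt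
    exact this.comp hns.tendsto_atTop
  have hmain : ∀ᶠ j in atTop, P {ω | S (ns j) ω < 2 / 3 * θ} ≤ ENNReal.ofReal
      ((√(covBound (siteConst q m) (iN c N) (deltaBar c N) (K (ns j)) N)
        / (p₀ * sqSum (totCoeff c N) (ns j) - 2 / 3 * θ)) ^ q) := by
    filter_upwards [ht.eventually_const_lt (by positivity : (0 : ℝ) < θ / 3)] with j hj
    refine (measure_mono fun ω hω => ?_).trans ((hb (ns j)).prob_ge_le hq0 (covBound_nonneg hL hi.le
      (Finset.sum_nonneg fun _ _ => Real.sqrt_nonneg _) N) hj)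
    simp only [Set.mem_ofPred_eq] at hω ⊢
    have := hsge (ns j)
    rw [abs_sub_comm]
    exact le_trans (by linarith) (le_abs_self _)
  have hmeas := tendstoInMeasure_of_tendsto_ae (fun j => hSm (ns j)) hlim
  have h3 : Tendsto (fun j => P {ω | θ / 6 ≤ |S (ns j) ω - σ ω|}) atTop (𝓝 0) := by
    have := tendstoInMeasure_iff_norm.1 hmeas (θ / 6) (by positivity)
    simpa only [Real.norm_eq_abs] using this
  have h4 : Tendsto (fun j => ENNReal.ofReal
      ((√(covBound (siteConst q m) (iN c N) (deltaBar c N) (K (ns j)) N)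
        / (p₀ * sqSum (totCoeff c N) (ns j) - 2 / 3 * θ)) ^ q)
      + P {ω | θ / 6 ≤ |S (ns j) ω - σ ω|}) atTop (𝓝 (ENNReal.ofReal
      ((√(covBound (siteConst q m) (iN c N) (deltaBar c N)
        (∑ l ∈ Finset.Icc 1 N, √(kappa4 c l)) N) / (θ / 3)) ^ q) + 0)) := by
    refine Tendsto.add (ENNReal.tendsto_ofReal (Tendsto.rpow_const (Tendsto.div ?_ ht (by positivity))
      (Or.inr hq0.le))) h3
    have hcont : Continuous fun x : ℝ =>
        √(covBound (siteConst q m) (iN c N) (deltaBar c N) x N) := by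
      unfold covBound; fun_prop
    exact (hcont.tendsto _).comp hKlim
  rw [add_zero] at h4
  refine ge_of_tendsto h4 (hmain.mono fun j hj => ?_)
  refine (measure_mono fun ω hω => ?_).trans ((measure_union_le _ _).trans (add_le_add_left hj _))
  simp only [Set.mem_union, Set.mem_ofPred_eq] at hω ⊢
  by_contra! hcon
  have h5 := (le_abs_self _).trans_lt hcon.2
  have h6 : η ≤ θ / 2 := by rw [hθ]; linarith
  linarith [hcon.1]

end SmallBall

/-! ### Constants -/

/-- A constant which absorbs the powers `(2 L + 1) ^ N`. -/
def absorbConst (L : ℝ) : ℝ := (6 + 2 * L) * Real.exp (256 * (2 * L + 1) ^ 2)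

/-- All exponentials in `N` are absorbed by one factorial through `x ^ N ≤ exp x * N!`, with `x =
256 (2 L + 1) ^ 2`; here `256 = 128 * 2`, and `128 ^ N` dominates `N ^ 7`. -/
theorem pow_mul_le_absorb {L : ℝ} (hL : 1 ≤ L) (N : ℕ) :
    (6 + 2 * L) * ((2 * L + 1) ^ (2 * N) * N ^ 4 * 2 ^ N * N.factorial) * N ^ 3
      ≤ absorbConst L * N.factorial ^ 2 := by
  have h1 : (256 * (2 * L + 1) ^ 2) ^ N ≤ Real.exp (256 * (2 * L + 1) ^ 2) * N.factorial := by
    have := Real.pow_div_factorial_le_exp (256 * (2 * L + 1) ^ 2) (by positivity) N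
    rwa [div_le_iff₀ (by positivity)] at this
  have h2 : (N : ℝ) ^ 7 ≤ 128 ^ N := by
    have : (N : ℝ) ≤ 2 ^ N := by exact_mod_cast N.lt_two_pow_self.le
    calc (N : ℝ) ^ 7 ≤ (2 ^ N) ^ 7 := by gcongr
      _ = 128 ^ N := by rw [← pow_mul, mul_comm, pow_mul]; norm_num
  calc (6 + 2 * L) * ((2 * L + 1) ^ (2 * N) * N ^ 4 * 2 ^ N * N.factorial) * N ^ 3
      = (6 + 2 * L) * (N ^ 7 * 2 ^ N * (2 * L + 1) ^ (2 * N)) * N.factorial := by ring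
    _ ≤ (6 + 2 * L) * (128 ^ N * 2 ^ N * (2 * L + 1) ^ (2 * N)) * N.factorial := by gcongr
    _ = (6 + 2 * L) * (256 * (2 * L + 1) ^ 2) ^ N * N.factorial := by
        rw [mul_pow, ← pow_mul, ← mul_pow]; norm_num
    _ ≤ (6 + 2 * L) * (Real.exp (256 * (2 * L + 1) ^ 2) * N.factorial) * N.factorial := by gcongr
    _ = absorbConst L * N.factorial ^ 2 := by unfold absorbConst; ring

/-- The three terms of `covBound` contribute `2`, `4` and `2 L` to the factor `6 + 2 L`. The
additional `N ^ 3` becomes `N ^ (-3/2)` after the square root, which is smaller than the required `N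
^ (-5/4)`. -/
theorem covBound_le {L i δ K s : ℝ} (hL : 1 ≤ L) (hi : 0 ≤ i) (hδ : δ ^ 2 ≤ s ^ 2) (hK : K ≤ s ^ 2)
    {N : ℕ} (hN : 1 ≤ N) : covBound L i δ K N * N ^ 3 ≤ absorbConst L * i * s ^ 2 * N.factorial ^ 2 := by
  have hN1 : (1 : ℝ) ≤ N := by exact_mod_cast hN
  have hf : (1 : ℝ) ≤ N.factorial := by exact_mod_cast N.factorial_pos
  have h2 : (1 : ℝ) ≤ 2 ^ N := one_le_pow₀ one_le_two
  set F : ℝ := (N.factorial : ℝ) with hF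
  set X : ℝ := (2 * L + 1) ^ (2 * N) with hX
  set T : ℝ := 2 ^ N with hT
  have hX0 : 0 ≤ X := by positivity
  have hY : (2 * L) ^ (2 * N) ≤ X := by rw [hX]; gcongr; linarith
  have hN2 : (1 : ℝ) ≤ N ^ 2 := one_le_pow₀ hN1
  have e1 : covBound L i δ K N
      ≤ (6 + 2 * L) * (X * N ^ 4 * T * F) * (i * s ^ 2) := by
    have a1 : 2 * (N ^ 2 * (X * (N * F * δ ^ 2) * (N * i)))
        ≤ 2 * (X * N ^ 4 * T * F) * (i * s ^ 2) := by
      calc 2 * (N ^ 2 * (X * (N * F * δ ^ 2) * (N * i)))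
          = 2 * (X * N ^ 4 * 1 * F) * (i * δ ^ 2) := by ring
        _ ≤ _ := by gcongr
    have a2 : 2 * ((2 * L) ^ (2 * N) * N ^ 4 * (2 * T * K * i))
        ≤ 4 * (X * N ^ 4 * T * F) * (i * s ^ 2) := by
      calc 2 * ((2 * L) ^ (2 * N) * N ^ 4 * (2 * T * K * i))
          = 4 * ((2 * L) ^ (2 * N) * N ^ 4 * T * 1) * (i * K) := by ring
        _ ≤ 4 * ((2 * L) ^ (2 * N) * N ^ 4 * T * 1) * (i * s ^ 2) := by gcongr
        _ ≤ _ := by gcongr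
    have a3 : 2 * (L * (X * (N * F * δ ^ 2) * (N * i)))
        ≤ 2 * L * (X * N ^ 4 * T * F) * (i * s ^ 2) := by
      calc 2 * (L * (X * (N * F * δ ^ 2) * (N * i)))
          = 2 * L * (X * (N ^ 2 * 1) * 1 * F) * (i * δ ^ 2) := by ring
        _ ≤ 2 * L * (X * (N ^ 2 * N ^ 2) * T * F) * (i * s ^ 2) := by gcongr
        _ = _ := by ring
    unfold covBound
    rw [← hX, ← hT, ← hF]
    linarith
  calc covBound L i δ K N * N ^ 3
      ≤ (6 + 2 * L) * (X * N ^ 4 * T * F) * (i * s ^ 2) * N ^ 3 := by gcongr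
    _ = (6 + 2 * L) * (X * N ^ 4 * T * F) * N ^ 3 * (i * s ^ 2) := by ring
    _ ≤ absorbConst L * F ^ 2 * (i * s ^ 2) :=
        mul_le_mul_of_nonneg_right (pow_mul_le_absorb hL N) (by positivity)
    _ = _ := by ring

/-- The numerator `1 + i` comes from `√i ≤ (1 + i) / 2`, and `3 / 2` collects this half with the `3`
of the deviation `p₀ i / 3`. The factors `N! ^ 3` and `2 ^ N` leave room to spare. -/
theorem sqrt_covBound_le {L i δ K s p₀ : ℝ} (hL : 1 ≤ L) (hi : 0 < i) (hs : 0 ≤ s)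
    (hδ : δ ^ 2 ≤ s ^ 2) (hK : K ≤ s ^ 2) (hp : 0 < p₀) {N : ℕ} (hN : 1 ≤ N) :
    √(covBound L i δ K N) / (p₀ * i / 3) ≤ 3 / 2 * √(absorbConst L) * (1 + i) / (p₀ * i)
      * N.factorial ^ 3 * 2 ^ N * (N : ℝ) ^ (-(5 / 4) : ℝ) * s := by
  have hN1 : (1 : ℝ) ≤ N := by exact_mod_cast hN
  have hN0 : (0 : ℝ) < N := by linarith
  have hf : (1 : ℝ) ≤ N.factorial := by exact_mod_cast N.factorial_pos
  have h2 : (1 : ℝ) ≤ 2 ^ N := one_le_pow₀ one_le_two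
  have hA : 0 ≤ absorbConst L := by unfold absorbConst; positivity
  set F : ℝ := (N.factorial : ℝ) with hF
  set R : ℝ := (N : ℝ) ^ (-(5 / 4) : ℝ) with hR
  have hR0 : 0 < R := by positivity
  have hR2 : ((N : ℝ) ^ 3)⁻¹ ≤ R ^ 2 := by
    rw [hR, ← Real.rpow_natCast (_ ^ _), ← Real.rpow_mul hN0.le, ← Real.rpow_natCast, ← Real.rpow_neg hN0.le]
    exact Real.rpow_le_rpow_of_exponent_le hN1 (by norm_num)
  have h3 : covBound L i δ K N ≤ (√(absorbConst L) * √i * s * (F ^ 3 * 2 ^ N * R)) ^ 2 := by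
    have h4 := covBound_le hL hi.le hδ hK hN
    rw [← le_div_iff₀ (by positivity), div_eq_mul_inv] at h4
    refine h4.trans ?_
    rw [mul_pow, mul_pow, mul_pow, Real.sq_sqrt hA, Real.sq_sqrt hi.le, mul_assoc]
    refine mul_le_mul_of_nonneg_left ?_ (by positivity)
    have h5 : F ^ 1 ≤ F ^ 3 := pow_le_pow_right₀ hf (by norm_num)
    calc F ^ 2 * ((N : ℝ) ^ 3)⁻¹ ≤ F ^ 2 * R ^ 2 := by gcongr
      _ = (F ^ 1 * 1 * R) ^ 2 := by ring
      _ ≤ (F ^ 3 * 2 ^ N * R) ^ 2 := by gcongr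
  have h6 : √(covBound L i δ K N) ≤ √(absorbConst L) * √i * s * (F ^ 3 * 2 ^ N * R) :=
    Real.sqrt_le_iff.2 ⟨by positivity, h3⟩
  have h7 : √i ≤ (1 + i) / 2 := by
    nlinarith [Real.sq_sqrt hi.le, sq_nonneg (√i - 1)]
  rw [div_le_iff₀ (by positivity)]
  calc √(covBound L i δ K N) ≤ √(absorbConst L) * √i * s * (F ^ 3 * 2 ^ N * R) := h6
    _ ≤ √(absorbConst L) * ((1 + i) / 2) * s * (F ^ 3 * 2 ^ N * R) := by gcongr
    _ = _ := by field_simp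

/-- Since `√κ = (κ ^ (1/4)) ^ 2`, this is the bound of a sum of squares by the square of the sum.
The square root in the contraction bound, followed by the one in `L^q`, produces the exponent `1 /
4`. -/
theorem sum_sqrt_kappa4_le {c : Coeff} (hc : c.Admissible) {N : ℕ}
    (hs : ∀ m, 1 ≤ m → m ≤ N → Summable fun α : Fin m → ℕ => c m α ^ 2) :
    ∑ l ∈ Finset.Icc 1 N, √(kappa4 c l) ≤ kappaBar c N ^ 2 := by
  have h0 : ∀ l ∈ Finset.Icc 1 N, 0 ≤ kappa4 c l := fun l hl =>
    kappa4_nonneg hc (Finset.mem_Icc.1 hl).1 (hs l (Finset.mem_Icc.1 hl).1 (Finset.mem_Icc.1 hl).2)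
  have h1 : ∑ l ∈ Finset.Icc 1 N, √(kappa4 c l)
      = ∑ l ∈ Finset.Icc 1 N, (kappa4 c l ^ (1 / 4 : ℝ)) ^ 2 := by
    refine Finset.sum_congr rfl fun l hl => ?_
    rw [← Real.rpow_natCast, ← Real.rpow_mul (h0 l hl), Real.sqrt_eq_rpow]
    norm_num
  rw [h1, kappaBar]
  exact Finset.sum_sq_le_sq_sum_of_nonneg fun l hl => Real.rpow_nonneg (h0 l hl) _

theorem kappaBar_nonneg {c : Coeff} (hc : c.Admissible) {N : ℕ}
    (hs : ∀ m, 1 ≤ m → m ≤ N → Summable fun α : Fin m → ℕ => c m α ^ 2) : 0 ≤ kappaBar c N :=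
  Finset.sum_nonneg fun l hl => Real.rpow_nonneg (kappa4_nonneg hc (Finset.mem_Icc.1 hl).1
    (hs l (Finset.mem_Icc.1 hl).1 (Finset.mem_Icc.1 hl).2)) _

theorem deltaBar_nonneg (c : Coeff) (N : ℕ) : 0 ≤ deltaBar c N :=
  Finset.sum_nonneg fun l _ => delta_nonneg c l

/-- A bound by a power of order `q` gives a bound by a smaller power, for probabilities. -/
theorem prob_le_rpow {Ω : Type*} [MeasurableSpace Ω] {P : Measure Ω} [IsProbabilityMeasure P]
    {A : Set Ω} {x y p q : ℝ} (hx : 0 ≤ x) (hxy : x ≤ y) (hp : 0 ≤ p) (hpq : p ≤ q)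
    (h : P A ≤ ENNReal.ofReal (x ^ q)) : P A ≤ ENNReal.ofReal (y ^ p) := by
  -- For `y ≥ 1` the bound is trivial; otherwise `x < 1`, and lowering the exponent only increases
  -- the power.
  rcases le_or_gt 1 y with hy | hy
  · refine prob_le_one.trans ?_
    rw [ENNReal.one_le_ofReal]
    exact Real.one_le_rpow hy hp
  · refine h.trans (ENNReal.ofReal_le_ofReal ?_)
    rcases hx.eq_or_lt with rfl | hx'
    · rcases hp.eq_or_lt with rfl | hp'
      · rw [Real.rpow_zero]
        exact Real.rpow_le_one le_rfl zero_le_one hpq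
      · rw [Real.zero_rpow (by linarith)]
        positivity
    · exact (Real.rpow_le_rpow_of_exponent_ge hx' (hxy.trans hy.le) hpq).trans
        (Real.rpow_le_rpow hx hxy hp)

end

end StochSeries

theorem lemma4p6 (p : ℝ) (hp : 1 ≤ p) (M : ℝ) :
    ∃ C : ℝ, 0 < C ∧
      ∀ {Ω : Type*} [MeasurableSpace Ω] (P : Measure Ω) [IsProbabilityMeasure P]
        (r ε : ℝ) (z : ℕ → ℝ) (Z χ V U : ℕ → Ω → ℝ),
        0 < r → 0 < ε →
        StochSeries.IsSplitting P r ε z Z χ V U →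
        (∀ k, ∫ ω, Z k ω ∂P = 0) →
        (∀ k, ∫ ω, Z k ω ^ 2 ∂P = 1) →
        (∀ k, eLpNorm (Z k) (ENNReal.ofReal (max (2 * p) 4)) P ≤ ENNReal.ofReal M) →
        ∀ (N : ℕ), 1 ≤ N →
        ∀ (c : StochSeries.Coeff), c.Admissible →
        (∀ m, 1 ≤ m → m ≤ N → Summable (fun α : Fin m → ℕ => c m α ^ 2)) →
        0 < StochSeries.iN c N →
        (∃ DS : ℕ → Ω → ℝ,
          StochSeries.IsMalliavinDeriv P χ Z (StochSeries.SN P c Z N) DS) ∧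
        ∀ DS : ℕ → Ω → ℝ,
          StochSeries.IsMalliavinDeriv P χ Z (StochSeries.SN P c Z N) DS →
          ∀ η : ℝ, η ≤ (1 / 2) * (ε * StochSeries.mass r) * StochSeries.iN c N →
            P {ω | StochSeries.malliavinCov DS ω ≤ η} ≤
              ENNReal.ofReal
                ((C * (1 + StochSeries.iN c N) / (ε * StochSeries.mass r * StochSeries.iN c N)
                  * (N.factorial : ℝ) ^ 3 * 2 ^ N * (N : ℝ) ^ (-(5 / 4) : ℝ)
                  * (StochSeries.kappaBar c N + StochSeries.deltaBar c N)) ^ p) := by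
  -- Two-smoothness needs an order at least `2`. The estimate is proved with exponent `q` and
  -- weakened to `p` at the end; `2 q = max (2 p) 4` is the order of the assumed moments.
  set q := max p 2 with hqdef
  have hq : 2 ≤ q := le_max_right _ _
  have hpq : p ≤ q := le_max_left _ _
  have h2q : max (2 * p) 4 = 2 * q := by
    rw [hqdef, mul_max_of_nonneg _ _ zero_le_two]; norm_num
  set m := StochSeries.momConst M with hmdef
  have hm : 1 ≤ m := StochSeries.one_le_momConst M
  set L := StochSeries.siteConst q m with hLdef
  have hL : 1 ≤ L := by
    have := StochSeries.one_le_smoothConst hq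
    rw [hLdef, StochSeries.siteConst]; nlinarith
  have hA : 0 < StochSeries.absorbConst L := by unfold StochSeries.absorbConst; positivity
  -- `L` is built from `q` and `m`, hence from `p` and `M` only.
  refine ⟨3 / 2 * √(StochSeries.absorbConst L), by positivity, ?_⟩
  intro Ω _ P _ r ε z Z χ V U hr hε h h1 h2 hM N hN c hc hs hi
  rw [h2q] at hM
  have hp0 : 0 < ε * StochSeries.mass r := mul_pos hε h.mass_pos
  have hsite := h.isSite hε.le hq h1 h2 hM
  -- `Z` agrees with its measurable version only almost surely; the series and its derivatives are
  -- insensitive to this change.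
  have hae : ∀ k, Z k =ᵐ[P] StochSeries.splitZ χ V U k := h.eq_split
  obtain ⟨G, hG, ns, hns, hlim⟩ := hsite.isSeq.exists_deriv hq hm h.measurable_chi
    (h.chi_ae hε.le) hc hs
  rw [← StochSeries.SN_congr hae] at hG
  replace hG := hG.congr fun k => (hae k).symm
  refine ⟨⟨G, hG⟩, fun DS hDS η hη => ?_⟩
  have hDG := h.malliavinCov_ae_eq hr hDS hG
  have hσ : P {ω | StochSeries.malliavinCov DS ω ≤ η}
      = P {ω | StochSeries.malliavinCov G ω ≤ η} := by
    refine measure_congr ?_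
    filter_upwards [hDG] with ω hω
    simp only [eq_iff_iff]
    change StochSeries.malliavinCov DS ω ≤ η ↔ StochSeries.malliavinCov G ω ≤ η
    rw [hω]
  rw [hσ]
  have hb := hsite.prob_cov_le hq hm hp0 h.bernoulli_le_one (χ := χ) (fun k ω => by ring) hc hs hi
    hns hlim hη
  have hκ := StochSeries.kappaBar_nonneg hc hs
  have hδ := StochSeries.deltaBar_nonneg c N
  refine StochSeries.prob_le_rpow (by positivity) (StochSeries.sqrt_covBound_le hL hi
    (add_nonneg hκ hδ) ?_ ?_ hp0 hN) (by linarith) hpq hb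
  · exact pow_le_pow_left₀ hδ (by linarith) 2
  · exact (StochSeries.sum_sqrt_kappa4_le hc hs).trans (pow_le_pow_left₀ hκ (by linarith) 2)
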